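/- Let $V$ be a complex vector space of dimension $n$ and let $0\le r\le k\le n$. For $E\in\operatorname{Gr}(k,V)$ write $\widehat E\in\bigwedge^kV$ for a Plücker representative. Let $\sigma_2(\operatorname{Gr}(m,W))\subset\mathbb P(\bigwedge^mW)$ be the ordinary secant variety of a Grassmannian (the Zariski closure of the union of the lines spanned by two of its points), and let the restricted chordal variety $\sigma_2^r(\operatorname{Gr}(k,V))\subset\mathbb P(\bigwedge^kV)$ be the Zariski closure of the set of points $[\lambda_1\widehat E_1+\lambda_2\widehat E_2]$ with $E_1,E_2\in\operatorname{Gr}(k,V)$ and $\dim(E_1\cap E_2)\ge r$. Let $$\mathcal I_r=\{(E,[t],[\widehat E\wedge t]) : E\in\operatorname{Gr}(r,V),\ [t]\in\sigma_2(\operatorname{Gr}(k-r,V/E))\}$$ be the incidence variety, with its projection $(E,[t],p)\mapsto p$ to $\mathbb P(\bigwedge^kV)$. Two $k$-planes always meet in dimension at least $2k-n$; put $\rho=\max(r,2k-n)$ (so $\rho=r$ if $n\ge 2k-r$). Set $$\operatorname{v.dim}=\rho(n-\rho)+2(k-\rho)(n-k)+1,\qquad \operatorname{exp.dim}=\min\Big\{\operatorname{v.dim},\tbinom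 nk-1\Big\}$$ for $\sigma_2^r(\operatorname{Gr}(k,V))$, and $\operatorname{v.dim}(\sigma_2(X))=2\dim X+1$ for ordinary secant varieties. 1. The image of the projection of $\mathcal I_r$ is $\sigma_2^r(\operatorname{Gr}(k,V))$, and $\sigma_2^\rho(\operatorname{Gr}(k,V))=\sigma_2^r(\operatorname{Gr}(k,V))$. 2. Suppose $k-r\ge 2$ and $n-k\ge2$. Then the projection $\mathcal I_\rho\to\sigma_2^r(\operatorname{Gr}(k,V))$ is generically finite: its fibers over the points of some dense Zariski open subset of $\sigma_2^r(\operatorname{Gr}(k,V))$ are finite. Hence, for every $E\in\operatorname{Gr}(\rho,V)$, $$\dim\sigma_2^r(\operatorname{Gr}(k,V))=\rho(n-\rho)+\dim\sigma_2(\operatorname{Gr}(k-\rho,V/E)),$$ and the defect $\operatorname{v.dim}-\dim$ of $\sigma_2^r(\operatorname{Gr}(k,V))$ equals the defect $\operatorname{v.dim}-\dim$ of $\sigma_2(\operatorname{Gr}(k-\rho,V/E))$. If this defect is positive, then $n=k+2$ or $k-r=2$. 3. Suppose $k-r\ge2$. If $\sigma_2^r(\operatorname{Gr}(k,V))$ is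 defective, that is, $\dim\sigma_2^r(\operatorname{Gr}(k,V))<\operatorname{exp.dim}$, then $n=k+2$ or $k-r=2$. -/

import Mathlib

open Module Set
open scoped LinearAlgebra.Projectivization

noncomputable section

namespace RestrictedChordal

section Projective

variable {W : Type*} [AddCommGroup W] [Module ℂ W]

/-- A homogeneous polynomial function of degree `d` on `W`: an element of the algebra generated by
the linear forms which is homogeneous of degree `d`. -/
def IsForm (d : ℕ) (f : W → ℂ) : Prop :=
  f ∈ Algebra.adjoin ℂ (range fun φ : Dual ℂ W => (φ : W → ℂ)) ∧
    ∀ (c : ℂ) (w : W), f (c • w) = c ^ d * f w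

/-- The common zero locus in `ℙ W` of a family of functions on `W` (used for families of forms). -/
def zeroLocus (F : Set (W → ℂ)) : Set (ℙ ℂ W) :=
  {p | ∀ f ∈ F, ∀ w ∈ p.submodule, f w = 0}

/-- A subset of `ℙ W` is algebraic if it is the zero locus of a family of forms. -/
def IsAlgebraicSet (Z : Set (ℙ ℂ W)) : Prop :=
  ∃ F : Set (W → ℂ), (∀ f ∈ F, ∃ d, IsForm d f) ∧ Z = zeroLocus F

lemma isForm_one : IsForm 0 (1 : W → ℂ) :=
  ⟨one_mem _, by simp⟩

lemma IsForm.mul {d e : ℕ} {f g : W → ℂ} (hf : IsForm d f) (hg : IsForm e g) :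
    IsForm (d + e) (f * g) :=
  ⟨mul_mem hf.1 hg.1, fun c w => by
    simp only [Pi.mul_apply, hf.2, hg.2]; ring⟩

lemma isAlgebraicSet_empty : IsAlgebraicSet (∅ : Set (ℙ ℂ W)) := by
  refine ⟨{1}, by rintro f rfl; exact ⟨0, isForm_one⟩, ?_⟩
  ext p
  simp only [mem_empty_iff_false, false_iff]
  intro h
  have := h 1 rfl 0 (Submodule.zero_mem _)
  simp at this

lemma isAlgebraicSet_sInter (A : Set (Set (ℙ ℂ W))) (hA : A ⊆ {Z | IsAlgebraicSet Z}) :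
    IsAlgebraicSet (⋂₀ A) := by
  refine ⟨{f | (∃ d, IsForm d f) ∧ ∃ Z ∈ A, ∀ p ∈ Z, ∀ w ∈ p.submodule, f w = 0},
    fun f hf => hf.1, ?_⟩
  ext p
  constructor
  · rintro hp f ⟨-, Z, hZ, hf⟩
    exact hf p (hp Z hZ)
  · intro hp Z hZ
    obtain ⟨F, hF, rfl⟩ := hA hZ
    exact fun f hf => hp f ⟨hF f hf, _, hZ, fun q hq => hq f hf⟩

lemma IsForm.vanish_iff {d : ℕ} {f : W → ℂ} (hf : IsForm d f) (p : ℙ ℂ W) :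
    (∀ w ∈ p.submodule, f w = 0) ↔ f p.rep = 0 := by
  rw [p.submodule_eq]
  constructor
  · exact fun h => h _ (Submodule.mem_span_singleton_self _)
  · intro h w hw
    obtain ⟨c, rfl⟩ := Submodule.mem_span_singleton.1 hw
    rw [hf.2, h, mul_zero]

lemma isAlgebraicSet_union (A B : Set (ℙ ℂ W)) (hA : IsAlgebraicSet A) (hB : IsAlgebraicSet B) :
    IsAlgebraicSet (A ∪ B) := by
  obtain ⟨F, hF, rfl⟩ := hA
  obtain ⟨G, hG, rfl⟩ := hB
  refine ⟨{h | ∃ f ∈ F, ∃ g ∈ G, h = f * g}, ?_, ?_⟩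
  · rintro h ⟨f, hf, g, hg, rfl⟩
    obtain ⟨d, hd⟩ := hF f hf
    obtain ⟨e, he⟩ := hG g hg
    exact ⟨d + e, hd.mul he⟩
  · ext p
    constructor
    · rintro (hp | hp) h ⟨f, hf, g, hg, rfl⟩ w hw
      · simp [hp f hf w hw]
      · simp [hp g hg w hw]
    · intro hp
      by_contra hcon
      simp only [mem_union, not_or, zeroLocus, mem_ofPred_eq, not_forall] at hcon
      obtain ⟨⟨f, hf, hf'⟩, ⟨g, hg, hg'⟩⟩ := hcon
      obtain ⟨d, hd⟩ := hF f hf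
      obtain ⟨e, he⟩ := hG g hg
      have h1 : f p.rep ≠ 0 := fun h => by
        obtain ⟨w, hw, h0⟩ := hf'; exact h0 ((hd.vanish_iff p).2 h w hw)
      have h2 : g p.rep ≠ 0 := fun h => by
        obtain ⟨w, hw, h0⟩ := hg'; exact h0 ((he.vanish_iff p).2 h w hw)
      have := ((hd.mul he).vanish_iff p).1 (hp _ ⟨f, hf, g, hg, rfl⟩)
      exact (mul_ne_zero h1 h2) this

/-- The Zariski topology on the projective space `ℙ W`. -/
instance zariskiTopology : TopologicalSpace (ℙ ℂ W) :=
  TopologicalSpace.ofClosed {Z | IsAlgebraicSet Z} isAlgebraicSet_empty isAlgebraicSet_sInter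
    fun A hA B hB => isAlgebraicSet_union A B hA hB

lemma isClosed_iff_isAlgebraicSet (Z : Set (ℙ ℂ W)) : IsClosed Z ↔ IsAlgebraicSet Z := by
  rw [← isOpen_compl_iff]
  have h : IsOpen Zᶜ ↔ Zᶜᶜ ∈ {Z : Set (ℙ ℂ W) | IsAlgebraicSet Z} := Iff.rfl
  rw [h, compl_compl, mem_ofPred_eq]

/-- The affine cone over a subset of `ℙ W`. -/
def cone (X : Set (ℙ ℂ W)) : Set W :=
  {w | ∃ p ∈ X, w ∈ p.submodule}

/-- The homogeneous coordinate ring of `X ⊆ ℙ W`: the algebra of polynomial functions restricted to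
the affine cone over `X`. -/
def coordRing (X : Set (ℙ ℂ W)) : Subalgebra ℂ (cone X → ℂ) :=
  Algebra.adjoin ℂ (range fun (φ : Dual ℂ W) (w : cone X) => φ (w : W))

/-- The dimension of a projective variety: the transcendence degree over `ℂ` of its homogeneous
coordinate ring (which is the dimension of the affine cone), minus one. -/
def projDim (X : Set (ℙ ℂ W)) : ℤ :=
  (Cardinal.toNat (Algebra.trdeg ℂ (coordRing X)) : ℤ) - 1

/-- The `s`-secant variety of `X ⊆ ℙ W`: the Zariski closure of the union of the linear spans of
`s` points of `X`. -/
def secantVariety (s : ℕ) (X : Set (ℙ ℂ W)) : Set (ℙ ℂ W) :=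
  closure {p | ∃ x : Fin s → ℙ ℂ W, (∀ i, x i ∈ X) ∧ p.submodule ≤ ⨆ i, (x i).submodule}

/-- The virtual dimension of the `s`-secant variety of `X`. -/
def secantVirtualDim (s : ℕ) (X : Set (ℙ ℂ W)) : ℤ :=
  s * projDim X + (s - 1)

end Projective

section Grassmannian

variable {V : Type*} [AddCommGroup V] [Module ℂ V]

/-- The subspace `⋀ᵏE` of `⋀ᵏV`. If `dim E = k`, it is the line spanned by `e₁ ∧ ⋯ ∧ eₖ` for any
basis `e₁, …, eₖ` of `E`. -/
def pluckerLine (k : ℕ) (E : Submodule ℂ V) : Submodule ℂ (⋀[ℂ]^k V) :=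
  LinearMap.range (exteriorPower.map k E.subtype)

variable (V) in
/-- The Grassmannian of `k`-dimensional subspaces of `V` in its Plücker embedding. -/
def grassmannian (k : ℕ) : Set (ℙ ℂ (⋀[ℂ]^k V)) :=
  {p | ∃ E : Submodule ℂ V, finrank ℂ E = k ∧ p.submodule = pluckerLine k E}

variable (V) in
/-- The `r`-restricted `s`-secant variety of `Gr(k, V)`: the Zariski closure of the set of all
points `[λ₁ Ê₁ + ⋯ + λₛ Êₛ]` with `Eᵢ ∈ Gr(k, V)` and `dim (⋂ Eᵢ) ≥ r`. -/
def restrictedSecant (s r k : ℕ) : Set (ℙ ℂ (⋀[ℂ]^k V)) :=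
  closure {p | ∃ E : Fin s → Submodule ℂ V, (∀ i, finrank ℂ (E i) = k) ∧
    r ≤ finrank ℂ (⨅ i, E i : Submodule ℂ V) ∧ p.submodule ≤ ⨆ i, pluckerLine k (E i)}

/-- `p = [Ê ∧ t]` where `[t] = q` is a point of `ℙ (⋀ᵐ(V/E))`: some nonzero `w` on the line `p` is the
product of an element `e` of `⋀ʳE` and a lift `t ∈ ⋀ᵐV` of an element of the line `q`. (The
product depends only on the class of `t` in `⋀ᵐ(V/E)` when `dim E = r`.) -/
def IsWedge {k m : ℕ} (r : ℕ) (E : Submodule ℂ V) (q : ℙ ℂ (⋀[ℂ]^m (V ⧸ E)))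
    (p : ℙ ℂ (⋀[ℂ]^k V)) : Prop :=
  ∃ e ∈ pluckerLine r E, ∃ t : ⋀[ℂ]^m V, exteriorPower.map m E.mkQ t ∈ q.submodule ∧
    ∃ w ∈ p.submodule, w ≠ 0 ∧ (w : ExteriorAlgebra ℂ V) = (e : ExteriorAlgebra ℂ V) * t

variable (V) in
/-- The incidence variety of all `((E, q), p)` with `E ∈ Gr(r, V)`, `q = [t]` a point of
`σₛ(Gr(k - r, V/E))`, and `p = [Ê ∧ t] ∈ ℙ (⋀ᵏV)`. -/
def incidenceVariety (s r k : ℕ) :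
    Set ((Σ E : Submodule ℂ V, ℙ ℂ (⋀[ℂ]^(k - r) (V ⧸ E))) × ℙ ℂ (⋀[ℂ]^k V)) :=
  {x | finrank ℂ x.1.1 = r ∧ x.1.2 ∈ secantVariety s (grassmannian (V ⧸ x.1.1) (k - r)) ∧
    IsWedge r x.1.1 x.1.2 x.2}

/-- The virtual dimension of `σₛʳ(Gr(k, n))`: choose `E ∈ Gr(r, n)`, then `s` points of
`Gr(k - r, n - r)`, then a point in the span of `s` points. -/
def restrictedVirtualDim (s r k n : ℕ) : ℤ :=
  r * (n - r) + s * ((k - r) * (n - k)) + (s - 1)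

/-- The expected dimension of `σₛʳ(Gr(k, n))`. -/
def restrictedExpectedDim (s r k n : ℕ) : ℤ :=
  min (restrictedVirtualDim s r k n) ((n.choose k : ℤ) - 1)

/-- Two `k`-planes in `n`-space always meet in dimension at least `2k - n`, so the size of the
overlap of two general `k`-planes meeting in dimension at least `r` is `max r (2k - n)`. -/
def overlap (r k n : ℕ) : ℕ :=
  max r (2 * k - n)

end Grassmannian

end RestrictedChordal

end

/-! All arguments take place on affine cones in the exterior algebra. A point of the set whose
closure is the restricted chordal variety is e₁∧⋯∧eᵣ∧t with t a sum of two decomposable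
(k−r)-vectors (`mem_restricted_iff`). Multiplication by e₁∧⋯∧eᵣ carries secants of Gr(k−r, V/E) to
restricted secants, and contraction with forms dual to the eᵢ undoes it (`eq_ιMulti_mul_contrs`,
`map_contrs_ιMulti_mul`). Both operations are linear, hence compatible with Zariski closure. That {v
| v∧w = 0} has dimension at least r is a closed condition, so every limit point w is still divisible
by some e₁∧⋯∧eᵣ. This gives the image of the projection. Replacing r by ρ is the dimension formula
for E₁ + E₂.

With m = k−ρ = min(k−r, n−k) one has ρ+2m ≤ n, so V/E contains two independent m-planes. For m ≥ 2
the sum of their Plücker vectors is annihilated by no nonzero vector (`exists_annihilator_eq_bot`).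
Hence on a dense open subset the annihilator has dimension ρ; there E is recovered as the
annihilator and [t] by contraction, so a fiber has at most one point.

Dimension is the transcendence degree of an algebra of functions on a parametrized cone. In the
graph chart E is spanned by eᵢ+Xᵢ with Xᵢ in a fixed complement, and the points w =
(e₁+X₁)∧⋯∧(eᵣ+Xᵣ)∧t are dense (`vanishes_on_restrictedCone`). Cramer's rule applied to (eᵢ+Xᵢ)∧w = 0
makes X rational in w, and a unipotent substitution makes t polynomial in X and w. So passing from t
to w adds exactly ρ(n−ρ) (`trdeg_graphMap`). The same computation gives the dimension of the
Grassmannian, and the defects agree.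

For 3 ≤ m and 2m ≤ N, take two disjoint families A, B of basis vectors in an N-dimensional space.
Replacing at most one factor of b_A, or of b_B, yields distinct basis multivectors, so the two
tangent spaces at b_A+b_B are independent and the secant variety of Gr(m, N) has no defect
(`le_trdeg_secantPoint`). A positive defect thus forces m = 2. If n ≤ k+1, every k-vector is
decomposable and the variety is the whole projective space. -/

noncomputable section

namespace RestrictedChordal

/-! ### Decomposable vectors, divisibility and contraction. -/

section ExteriorPreliminaries

variable {V : Type*} [AddCommGroup V] [Module ℂ V]

/-- The cone of decomposable vectors `c • v₁ ∧ ⋯ ∧ vₖ` in the exterior algebra. -/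
def decomposables (k : ℕ) (V : Type*) [AddCommGroup V] [Module ℂ V] :
    Set (ExteriorAlgebra ℂ V) :=
  {w | ∃ (c : ℂ) (v : Fin k → V), w = c • ExteriorAlgebra.ιMulti ℂ k v}

lemma exists_dual_family {ι : Type*} [DecidableEq ι] {u : ι → V} (hu : LinearIndependent ℂ u) :
    ∃ φ : ι → Dual ℂ V, ∀ i j, φ i (u j) = if i = j then 1 else 0 := by
  obtain ⟨g, hg⟩ := (Finsupp.linearCombination ℂ u).exists_leftInverse_of_injective
    (LinearMap.ker_eq_bot.2 hu)
  refine ⟨fun i => Finsupp.lapply i ∘ₗ g, fun i j => ?_⟩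
  have h := LinearMap.congr_fun hg (Finsupp.single j 1)
  simp only [LinearMap.comp_apply, Finsupp.linearCombination_single, one_smul,
    LinearMap.id_apply] at h
  simp [h, Finsupp.single_apply, eq_comm]

lemma decomposables_subset (k : ℕ) {w : ExteriorAlgebra ℂ V} (hw : w ∈ decomposables k V) :
    w ∈ ⋀[ℂ]^k V := by
  obtain ⟨c, v, rfl⟩ := hw
  exact Submodule.smul_mem _ _ (exteriorPower.ιMulti ℂ k v).2

lemma zero_mem_decomposables (k : ℕ) : (0 : ExteriorAlgebra ℂ V) ∈ decomposables k V :=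
  ⟨0, 0, by simp⟩

lemma smul_mem_decomposables {k : ℕ} (c : ℂ) {w : ExteriorAlgebra ℂ V}
    (hw : w ∈ decomposables k V) : c • w ∈ decomposables k V := by
  obtain ⟨d, v, rfl⟩ := hw
  exact ⟨c * d, v, by rw [mul_smul]⟩

lemma map_mem_decomposables {k : ℕ} {U : Type*} [AddCommGroup U] [Module ℂ U] (f : V →ₗ[ℂ] U)
    {w : ExteriorAlgebra ℂ V} (hw : w ∈ decomposables k V) :
    ExteriorAlgebra.map f w ∈ decomposables k U := by
  obtain ⟨d, v, rfl⟩ := hw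
  exact ⟨d, f ∘ v, by rw [map_smul, ExteriorAlgebra.map_apply_ιMulti]⟩

/-- Pairing with a dual family gives the determinant of the identity matrix. -/
lemma ιMulti_ne_zero {k : ℕ} {u : Fin k → V} (hu : LinearIndependent ℂ u) :
    ExteriorAlgebra.ιMulti ℂ k u ≠ 0 := by
  obtain ⟨φ, hφ⟩ := exists_dual_family hu
  intro h
  have h0 : exteriorPower.ιMulti ℂ k u = 0 := Subtype.ext h
  have := exteriorPower.pairingDual_ιMulti_ιMulti φ u
  rw [h0, map_zero] at this
  have h1 : (Matrix.of fun i j => φ j (u i)) = (1 : Matrix (Fin k) (Fin k) ℂ) := by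
    ext i j
    simp [hφ, Matrix.one_apply, eq_comm]
  rw [h1, Matrix.det_one] at this
  exact zero_ne_one this

lemma linearIndependent_of_ιMulti_ne_zero {k : ℕ} {u : Fin k → V}
    (hu : ExteriorAlgebra.ιMulti ℂ k u ≠ 0) : LinearIndependent ℂ u := by
  by_contra h
  exact hu (AlternatingMap.map_linearDependent _ _ h)

lemma ιMulti_mem_pluckerLine {k : ℕ} {E : Submodule ℂ V} {v : Fin k → V} (hv : ∀ i, v i ∈ E) :
    exteriorPower.ιMulti ℂ k v ∈ pluckerLine k E :=
  ⟨exteriorPower.ιMulti ℂ k fun i => ⟨v i, hv i⟩, by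
    rw [exteriorPower.map_apply_ιMulti]; rfl⟩

lemma finrank_pluckerLine [FiniteDimensional ℂ V] {k : ℕ} {E : Submodule ℂ V}
    (hE : finrank ℂ E = k) : finrank ℂ (pluckerLine k E) = 1 := by
  rw [pluckerLine, LinearMap.finrank_range_of_inj
    (exteriorPower.map_injective_field (by simp)), exteriorPower.finrank_eq, hE, Nat.choose_self]

lemma pluckerLine_eq_span [FiniteDimensional ℂ V] {k : ℕ} {E : Submodule ℂ V}
    (hE : finrank ℂ E = k) {u : Fin k → V} (hu : LinearIndependent ℂ u) (huE : ∀ i, u i ∈ E) :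
    pluckerLine k E = ℂ ∙ exteriorPower.ιMulti ℂ k u := by
  symm
  apply Submodule.eq_of_le_of_finrank_eq
  · rw [Submodule.span_singleton_le_iff_mem]
    exact ιMulti_mem_pluckerLine huE
  · rw [finrank_pluckerLine hE, finrank_span_singleton]
    exact fun h => ιMulti_ne_zero hu (congrArg Subtype.val h)

lemma exists_basis_of_finrank_eq [FiniteDimensional ℂ V] {k : ℕ} {E : Submodule ℂ V}
    (hE : finrank ℂ E = k) : ∃ u : Fin k → V, LinearIndependent ℂ u ∧ (∀ i, u i ∈ E) ∧
      Submodule.span ℂ (range u) = E := by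
  let b := finBasisOfFinrankEq ℂ E hE
  refine ⟨fun i => b i, ?_, fun i => (b i).2, ?_⟩
  · exact b.linearIndependent.map' E.subtype (by simp)
  · have := congrArg (Submodule.map E.subtype) b.span_eq
    rw [Submodule.map_span, Submodule.map_top, Submodule.range_subtype, ← range_comp] at this
    exact this

lemma ιMulti_mem_span [FiniteDimensional ℂ V] {k : ℕ} {u v : Fin k → V}
    (hu : LinearIndependent ℂ u) (hv : ∀ i, v i ∈ Submodule.span ℂ (range u)) :
    ∃ c : ℂ, ExteriorAlgebra.ιMulti ℂ k v = c • ExteriorAlgebra.ιMulti ℂ k u := by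
  have hE : finrank ℂ (Submodule.span ℂ (range u)) = k := by
    rw [finrank_span_eq_card hu, Fintype.card_fin]
  have h := ιMulti_mem_pluckerLine hv
  rw [pluckerLine_eq_span hE hu fun i => Submodule.subset_span (mem_range_self i),
    Submodule.mem_span_singleton] at h
  obtain ⟨c, hc⟩ := h
  exact ⟨c, (congrArg Subtype.val hc).symm⟩

lemma coe_mem_decomposables [FiniteDimensional ℂ V] {k : ℕ} {E : Submodule ℂ V}
    (hE : finrank ℂ E = k) {w : ⋀[ℂ]^k V} (hw : w ∈ pluckerLine k E) :
    (w : ExteriorAlgebra ℂ V) ∈ decomposables k V := by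
  obtain ⟨u, hu, huE, -⟩ := exists_basis_of_finrank_eq hE
  rw [pluckerLine_eq_span hE hu huE, Submodule.mem_span_singleton] at hw
  obtain ⟨c, rfl⟩ := hw
  exact ⟨c, u, rfl⟩

/-! ### Products of vectors -/

lemma ιMulti_mul_ι_comm {r : ℕ} (e : Fin r → V) (v : V) :
    ExteriorAlgebra.ιMulti ℂ r e * ExteriorAlgebra.ι ℂ v =
      (-1 : ℂ) ^ r • (ExteriorAlgebra.ι ℂ v * ExteriorAlgebra.ιMulti ℂ r e) := by
  induction r with
  | zero => simp
  | succ r ih =>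
    rw [ExteriorAlgebra.ιMulti_succ_apply, mul_assoc, ih, mul_smul_comm, ← mul_assoc,
      eq_neg_of_add_eq_zero_left (ExteriorAlgebra.ι_add_mul_swap (e 0) v), pow_succ, mul_smul,
      neg_mul, mul_assoc, smul_neg, neg_one_smul, smul_neg]

lemma ι_mul_ιMulti_eq_zero {r : ℕ} {e : Fin r → V} {v : V}
    (hv : v ∈ Submodule.span ℂ (range e)) :
    ExteriorAlgebra.ι ℂ v * ExteriorAlgebra.ιMulti ℂ r e = 0 := by
  induction hv using Submodule.span_induction with
  | mem x hx =>
    obtain ⟨i, rfl⟩ := hx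
    rw [ExteriorAlgebra.ιMulti_apply]
    exact ExteriorAlgebra.ι_mul_prod_list e i
  | zero => simp
  | add x y _ _ hx hy => rw [map_add, add_mul, hx, hy, add_zero]
  | smul c x _ hx => rw [map_smul, smul_mul_assoc, hx, smul_zero]

lemma ιMulti_mul_ι_eq_zero {r : ℕ} {e : Fin r → V} {v : V}
    (hv : v ∈ Submodule.span ℂ (range e)) :
    ExteriorAlgebra.ιMulti ℂ r e * ExteriorAlgebra.ι ℂ v = 0 := by
  rw [ιMulti_mul_ι_comm, ι_mul_ιMulti_eq_zero hv, smul_zero]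

/-- Multiplication by `e₁ ∧ ⋯ ∧ eᵣ` only depends on the other factor modulo `⟨e₁, …, eᵣ⟩`. -/
lemma ιMulti_mul_map {r : ℕ} {e : Fin r → V} {f : V →ₗ[ℂ] V}
    (hf : ∀ v, f v - v ∈ Submodule.span ℂ (range e)) (x : ExteriorAlgebra ℂ V) :
    ExteriorAlgebra.ιMulti ℂ r e * ExteriorAlgebra.map f x =
      ExteriorAlgebra.ιMulti ℂ r e * x := by
  induction x using CliffordAlgebra.left_induction with
  | algebraMap c => rw [AlgHom.commutes]
  | add x y hx hy => rw [map_add, mul_add, mul_add, hx, hy]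
  | ι_mul x v hx =>
    change ExteriorAlgebra.ιMulti ℂ r e * ExteriorAlgebra.map f (ExteriorAlgebra.ι ℂ v * x) =
      ExteriorAlgebra.ιMulti ℂ r e * (ExteriorAlgebra.ι ℂ v * x)
    have h1 : ExteriorAlgebra.ιMulti ℂ r e * ExteriorAlgebra.ι ℂ (f v) =
        ExteriorAlgebra.ιMulti ℂ r e * ExteriorAlgebra.ι ℂ v := by
      rw [← sub_eq_zero, ← mul_sub, ← map_sub]
      exact ιMulti_mul_ι_eq_zero (hf v)
    rw [map_mul, ExteriorAlgebra.map_apply_ι, ← mul_assoc, h1, ιMulti_mul_ι_comm, ← mul_assoc,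
      ιMulti_mul_ι_comm, smul_mul_assoc, smul_mul_assoc, mul_assoc, hx, mul_assoc]

/-! ### Contraction -/

/-- Left contraction with a linear form. -/
def contr (φ : Dual ℂ V) : ExteriorAlgebra ℂ V →ₗ[ℂ] ExteriorAlgebra ℂ V :=
  CliffordAlgebra.contractLeft φ

lemma contr_ι_mul (φ : Dual ℂ V) (v : V) (x : ExteriorAlgebra ℂ V) :
    contr φ (ExteriorAlgebra.ι ℂ v * x) = φ v • x - ExteriorAlgebra.ι ℂ v * contr φ x :=
  CliffordAlgebra.contractLeft_ι_mul φ v x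

lemma contr_one (φ : Dual ℂ V) : contr φ (1 : ExteriorAlgebra ℂ V) = 0 :=
  CliffordAlgebra.contractLeft_one _ φ

lemma contr_ιMulti_mem (φ : Dual ℂ V) {k : ℕ} (v : Fin (k + 1) → V) :
    contr φ (ExteriorAlgebra.ιMulti ℂ (k + 1) v) ∈ ⋀[ℂ]^k V := by
  induction k with
  | zero =>
    rw [ExteriorAlgebra.ιMulti_succ_apply, ExteriorAlgebra.ιMulti_zero_apply, contr_ι_mul,
      contr_one, mul_zero, sub_zero]
    exact Submodule.smul_mem _ _ (by simp)
  | succ k ih =>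
    rw [ExteriorAlgebra.ιMulti_succ_apply, contr_ι_mul]
    refine Submodule.sub_mem _ (Submodule.smul_mem _ _ (exteriorPower.ιMulti ℂ _ _).2) ?_
    have h := Submodule.mul_mem_mul (LinearMap.mem_range_self (ExteriorAlgebra.ι ℂ) (v 0))
      (ih (Matrix.vecTail v))
    rwa [← pow_succ'] at h

lemma contr_mem (φ : Dual ℂ V) {k : ℕ} {w : ExteriorAlgebra ℂ V} (hw : w ∈ ⋀[ℂ]^(k + 1) V) :
    contr φ w ∈ ⋀[ℂ]^k V := by
  rw [← ExteriorAlgebra.ιMulti_span_fixedDegree] at hw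
  induction hw using Submodule.span_induction with
  | mem x hx => obtain ⟨v, rfl⟩ := hx; exact contr_ιMulti_mem φ v
  | zero => simp
  | add x y _ _ hx hy => rw [map_add]; exact Submodule.add_mem _ hx hy
  | smul c x _ hx => rw [map_smul]; exact Submodule.smul_mem _ _ hx

lemma contr_ιMulti_eq_zero {φ : Dual ℂ V} {k : ℕ} {v : Fin k → V} (hv : ∀ i, φ (v i) = 0) :
    contr φ (ExteriorAlgebra.ιMulti ℂ k v) = 0 := by
  induction k with
  | zero => rw [ExteriorAlgebra.ιMulti_zero_apply, contr_one]
  | succ k ih =>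
    rw [ExteriorAlgebra.ιMulti_succ_apply, contr_ι_mul, hv, zero_smul, zero_sub,
      ih (v := Matrix.vecTail v) fun i => hv i.succ, mul_zero, neg_zero]

/-- The contraction of a decomposable vector is decomposable. -/
lemma contr_mem_decomposables [FiniteDimensional ℂ V] (φ : Dual ℂ V) {k : ℕ}
    {w : ExteriorAlgebra ℂ V} (hw : w ∈ decomposables (k + 1) V) :
    contr φ w ∈ decomposables k V := by
  obtain ⟨c, v, rfl⟩ := hw
  rw [map_smul]
  apply smul_mem_decomposables
  by_cases hli : LinearIndependent ℂ v
  swap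
  · rw [AlternatingMap.map_linearDependent _ _ hli, map_zero]
    exact zero_mem_decomposables k
  by_cases hφ : ∀ i, φ (v i) = 0
  · rw [contr_ιMulti_eq_zero hφ]
    exact zero_mem_decomposables k
  obtain ⟨i, hi⟩ := not_forall.1 hφ
  set E := Submodule.span ℂ (range v) with hE
  have hEr : finrank ℂ E = k + 1 := by
    rw [finrank_span_eq_card hli, Fintype.card_fin]
  set ψ : E →ₗ[ℂ] ℂ := φ.domRestrict E with hψ
  have hvE : ∀ i, v i ∈ E := fun i => Submodule.subset_span (mem_range_self i)
  have hψ0 : ψ ≠ 0 := fun h => hi (LinearMap.congr_fun h ⟨v i, hvE i⟩)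
  have hker : finrank ℂ (LinearMap.ker ψ) = k := by
    have := LinearMap.finrank_range_add_finrank_ker ψ
    rw [LinearMap.range_eq_top.2 (LinearMap.surjective hψ0), finrank_top, finrank_self, hEr] at this
    omega
  obtain ⟨b, hb, hbE, -⟩ := exists_basis_of_finrank_eq hker
  -- A basis of the kernel of φ on E, completed by `v i`, gives the same line of k+1-vectors as v,
  -- and its contraction is a multiple of the wedge of `b'` alone.
  set b' : Fin k → V := fun j => (b j : V) with hb'
  have hbφ : ∀ j, φ (b' j) = 0 := fun j => hbE j
  have hbli : LinearIndependent ℂ b' := hb.map' E.subtype (by simp)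
  have hbc : LinearIndependent ℂ (Fin.cons (v i) b' : Fin (k + 1) → V) := by
    rw [linearIndependent_finCons]
    refine ⟨hbli, fun h => hi ?_⟩
    have : Submodule.span ℂ (range b') ≤ LinearMap.ker φ := by
      rw [Submodule.span_le]
      rintro _ ⟨j, rfl⟩
      exact hbφ j
    exact this h
  have hbcE : ∀ j, (Fin.cons (v i) b' : Fin (k + 1) → V) j ∈ E := by
    intro j
    refine Fin.cases (hvE i) (fun j => ?_) j
    exact (b j).2
  have hmem := ιMulti_mem_pluckerLine hvE
  rw [pluckerLine_eq_span hEr hbc hbcE, Submodule.mem_span_singleton] at hmem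
  obtain ⟨d, hd⟩ := hmem
  have hd' : d • ExteriorAlgebra.ιMulti ℂ (k + 1) (Fin.cons (v i) b' : Fin (k + 1) → V) =
      ExteriorAlgebra.ιMulti ℂ (k + 1) v := congrArg Subtype.val hd
  rw [← hd', map_smul, ExteriorAlgebra.ιMulti_succ_apply, contr_ι_mul]
  apply smul_mem_decomposables
  have ht : Matrix.vecTail (Fin.cons (v i) b' : Fin (k + 1) → V) = b' := rfl
  rw [ht, contr_ιMulti_eq_zero hbφ, mul_zero, sub_zero]
  exact ⟨_, b', rfl⟩

/-- Iterated contraction with `φ₁`, then `φ₂`, and so on. -/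
def contrs : (r : ℕ) → (Fin r → Dual ℂ V) → ExteriorAlgebra ℂ V →ₗ[ℂ] ExteriorAlgebra ℂ V
  | 0, _ => LinearMap.id
  | r + 1, φ => contrs r (Fin.tail φ) ∘ₗ contr (φ 0)

lemma contrs_mem {r m k : ℕ} (hk : k = r + m) (φ : Fin r → Dual ℂ V) {w : ExteriorAlgebra ℂ V}
    (hw : w ∈ ⋀[ℂ]^k V) : contrs r φ w ∈ ⋀[ℂ]^m V := by
  induction r generalizing k w with
  | zero => rw [zero_add] at hk; subst hk; exact hw
  | succ r ih =>
    obtain rfl : k = (r + m) + 1 := by omega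
    exact ih rfl _ (contr_mem _ hw)

lemma contrs_mem_decomposables [FiniteDimensional ℂ V] {r m k : ℕ} (hk : k = r + m)
    (φ : Fin r → Dual ℂ V) {w : ExteriorAlgebra ℂ V} (hw : w ∈ decomposables k V) :
    contrs r φ w ∈ decomposables m V := by
  induction r generalizing k w with
  | zero => rw [zero_add] at hk; subst hk; exact hw
  | succ r ih =>
    obtain rfl : k = (r + m) + 1 := by omega
    exact ih rfl _ (contr_mem_decomposables _ hw)

/-- A vector annihilated by `e₁, …, eᵣ` is divisible by `e₁ ∧ ⋯ ∧ eᵣ`. -/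
lemma eq_ιMulti_mul_contrs {r : ℕ} {e : Fin r → V} {φ : Fin r → Dual ℂ V}
    (hφ : ∀ i j, φ i (e j) = if i = j then 1 else 0) {w : ExteriorAlgebra ℂ V}
    (hw : ∀ i, ExteriorAlgebra.ι ℂ (e i) * w = 0) :
    w = ExteriorAlgebra.ιMulti ℂ r e * contrs r φ w := by
  induction r generalizing w with
  | zero => simp [contrs]
  | succ r ih =>
    -- Contracting eᵢ∧w = 0. The case i = 0 divides w by e₀; the other cases show that the quotient
    -- is again annihilated by the remaining eᵢ.
    have h0 : ∀ i, φ 0 (e i) • w = ExteriorAlgebra.ι ℂ (e i) * contr (φ 0) w := by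
      intro i
      rw [← sub_eq_zero, ← contr_ι_mul, hw, map_zero]
    have h1 := h0 0
    rw [hφ, if_pos rfl, one_smul] at h1
    have h2 : ∀ i : Fin r, ExteriorAlgebra.ι ℂ (e i.succ) * contr (φ 0) w = 0 := by
      intro i
      rw [← h0, hφ, if_neg (Fin.succ_ne_zero i).symm, zero_smul]
    have h3 := ih (e := Matrix.vecTail e) (φ := Fin.tail φ)
      (fun i j => (hφ i.succ j.succ).trans (by simp only [Fin.succ_inj])) h2
    rw [ExteriorAlgebra.ιMulti_succ_apply, mul_assoc]
    change w = ExteriorAlgebra.ι ℂ (e 0) * (_ * contrs r (Fin.tail φ) (contr (φ 0) w))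
    rw [← h3]
    exact h1

lemma contrs_ι_mul {r : ℕ} {φ : Fin r → Dual ℂ V} {v : V} (hv : ∀ i, φ i v = 0)
    (x : ExteriorAlgebra ℂ V) :
    contrs r φ (ExteriorAlgebra.ι ℂ v * x) =
      (-1 : ℂ) ^ r • (ExteriorAlgebra.ι ℂ v * contrs r φ x) := by
  induction r generalizing x with
  | zero => simp [contrs]
  | succ r ih =>
    change contrs r (Fin.tail φ) (contr (φ 0) _) = _
    rw [contr_ι_mul, hv, zero_smul, zero_sub, map_neg,
      ih (φ := Fin.tail φ) fun i => hv i.succ, pow_succ, mul_smul,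
      neg_one_smul, smul_neg]
    rfl

/-- Contraction recovers `x` modulo `⟨e₁, …, eᵣ⟩` from `e₁ ∧ ⋯ ∧ eᵣ ∧ x`. -/
lemma map_contrs_ιMulti_mul {U : Type*} [AddCommGroup U] [Module ℂ U] {r : ℕ} {e : Fin r → V}
    {φ : Fin r → Dual ℂ V} (hφ : ∀ i j, φ i (e j) = if i = j then 1 else 0)
    {f : V →ₗ[ℂ] U} (hf : ∀ i, f (e i) = 0) (x : ExteriorAlgebra ℂ V) :
    ExteriorAlgebra.map f (contrs r φ (ExteriorAlgebra.ιMulti ℂ r e * x)) =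
      ExteriorAlgebra.map f x := by
  induction r with
  | zero => simp [contrs]
  | succ r ih =>
    change ExteriorAlgebra.map f (contrs r (Fin.tail φ) (contr (φ 0) _)) = _
    -- The first contraction removes e₀ up to a term e₀∧y. The later forms vanish on e₀, so this
    -- term stays a multiple of e₀ and is killed by f.
    rw [ExteriorAlgebra.ιMulti_succ_apply, mul_assoc, contr_ι_mul, hφ, if_pos rfl, one_smul,
      map_sub, map_sub, contrs_ι_mul, map_smul, map_mul (ExteriorAlgebra.map f), ExteriorAlgebra.map_apply_ι, hf,
      map_zero,
      zero_mul, smul_zero, sub_zero]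
    · exact ih (e := Matrix.vecTail e) (φ := Fin.tail φ)
        (fun i j => (hφ i.succ j.succ).trans (by simp only [Fin.succ_inj])) fun i => hf i.succ
    · intro i
      exact (hφ i.succ 0).trans (if_neg (Fin.succ_ne_zero i))

end ExteriorPreliminaries

/-! ### Affine cones over secants and restricted secants. -/

section Cones

variable {V : Type*} [AddCommGroup V] [Module ℂ V]

/-- The sums of `s` decomposable vectors of degree `m`. -/
def secantCone (s m : ℕ) (V : Type*) [AddCommGroup V] [Module ℂ V] : Set (ExteriorAlgebra ℂ V) :=
  {w | ∃ a : Fin s → ExteriorAlgebra ℂ V, (∀ i, a i ∈ decomposables m V) ∧ w = ∑ i, a i}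

/-- The products of a decomposable vector of degree `r` with a sum of `s` decomposable vectors of
degree `m`. -/
def restrictedCone (s r m : ℕ) (V : Type*) [AddCommGroup V] [Module ℂ V] :
    Set (ExteriorAlgebra ℂ V) :=
  {w | ∃ e : Fin r → V, ∃ t ∈ secantCone s m V, w = ExteriorAlgebra.ιMulti ℂ r e * t}

lemma smul_mem_secantCone {s m : ℕ} (c : ℂ) {w : ExteriorAlgebra ℂ V}
    (hw : w ∈ secantCone s m V) : c • w ∈ secantCone s m V := by
  obtain ⟨a, ha, rfl⟩ := hw
  exact ⟨fun i => c • a i, fun i => smul_mem_decomposables c (ha i), Finset.smul_sum⟩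

lemma smul_mem_restrictedCone {s r m : ℕ} (c : ℂ) {w : ExteriorAlgebra ℂ V}
    (hw : w ∈ restrictedCone s r m V) : c • w ∈ restrictedCone s r m V := by
  obtain ⟨e, t, ht, rfl⟩ := hw
  exact ⟨e, c • t, smul_mem_secantCone c ht, by rw [mul_smul_comm]⟩

lemma map_mem_secantCone {s m : ℕ} {U : Type*} [AddCommGroup U] [Module ℂ U] (f : V →ₗ[ℂ] U)
    {w : ExteriorAlgebra ℂ V} (hw : w ∈ secantCone s m V) :
    ExteriorAlgebra.map f w ∈ secantCone s m U := by
  obtain ⟨a, ha, rfl⟩ := hw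
  exact ⟨fun i => ExteriorAlgebra.map f (a i), fun i => map_mem_decomposables f (ha i),
    map_sum _ _ _⟩

lemma ιMulti_mul_mem_decomposables {r m k : ℕ} (hk : k = r + m) (e : Fin r → V)
    {a : ExteriorAlgebra ℂ V} (ha : a ∈ decomposables m V) :
    ExteriorAlgebra.ιMulti ℂ r e * a ∈ decomposables k V := by
  subst hk
  obtain ⟨c, v, rfl⟩ := ha
  exact ⟨c, Fin.append e v, by rw [mul_smul_comm, ExteriorAlgebra.ιMulti_mul_ιMulti]⟩

lemma restrictedCone_subset_secantCone {s r m k : ℕ} (hk : k = r + m) {w : ExteriorAlgebra ℂ V}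
    (hw : w ∈ restrictedCone s r m V) : w ∈ secantCone s k V := by
  obtain ⟨e, t, ⟨a, ha, rfl⟩, rfl⟩ := hw
  exact ⟨fun i => ExteriorAlgebra.ιMulti ℂ r e * a i,
    fun i => ιMulti_mul_mem_decomposables hk e (ha i), Finset.mul_sum _ _ _⟩

lemma secantCone_subset {s k : ℕ} {w : ExteriorAlgebra ℂ V} (hw : w ∈ secantCone s k V) :
    w ∈ ⋀[ℂ]^k V := by
  obtain ⟨a, ha, rfl⟩ := hw
  exact Submodule.sum_mem _ fun i _ => decomposables_subset k (ha i)

/-- Contraction sends restricted secants of `Gr(k, V)` to secants of `Gr(m, V)`. -/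
lemma contrs_mem_secantCone [FiniteDimensional ℂ V] {s r m k : ℕ} (hk : k = r + m)
    (φ : Fin r → Dual ℂ V) {w : ExteriorAlgebra ℂ V} (hw : w ∈ secantCone s k V) :
    contrs r φ w ∈ secantCone s m V := by
  obtain ⟨a, ha, rfl⟩ := hw
  exact ⟨fun i => contrs r φ (a i), fun i => contrs_mem_decomposables hk φ (ha i), map_sum _ _ _⟩

lemma rep_mem_submodule {W : Type*} [AddCommGroup W] [Module ℂ W] (p : ℙ ℂ W) :
    p.rep ∈ p.submodule := by
  rw [p.submodule_eq]
  exact Submodule.mem_span_singleton_self _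

lemma submodule_le_iff {W : Type*} [AddCommGroup W] [Module ℂ W] (p : ℙ ℂ W)
    (S : Submodule ℂ W) : p.submodule ≤ S ↔ p.rep ∈ S := by
  rw [p.submodule_eq, Submodule.span_singleton_le_iff_mem]

lemma mem_grassmannian_of_mem [FiniteDimensional ℂ V] {k : ℕ} {p : ℙ ℂ (⋀[ℂ]^k V)}
    (hp : (p.rep : ExteriorAlgebra ℂ V) ∈ decomposables k V) : p ∈ grassmannian V k := by
  obtain ⟨c, v, hv⟩ := hp
  have hv' : p.rep = c • exteriorPower.ιMulti ℂ k v := Subtype.ext hv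
  have hc : c ≠ 0 := by
    rintro rfl
    exact p.rep_nonzero (by rw [hv', zero_smul])
  have hli : LinearIndependent ℂ v := by
    apply linearIndependent_of_ιMulti_ne_zero
    intro h
    exact p.rep_nonzero (Subtype.ext (by rw [hv, h, smul_zero]; rfl))
  have hfr : finrank ℂ (Submodule.span ℂ (range v)) = k := by
    rw [finrank_span_eq_card hli, Fintype.card_fin]
  refine ⟨Submodule.span ℂ (range v), hfr, ?_⟩
  rw [pluckerLine_eq_span hfr hli fun i => Submodule.subset_span (mem_range_self i),
    p.submodule_eq, hv', Submodule.span_singleton_smul_eq (IsUnit.mk0 c hc)]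

lemma mem_grassmannian_iff [FiniteDimensional ℂ V] {k : ℕ} (p : ℙ ℂ (⋀[ℂ]^k V)) :
    p ∈ grassmannian V k ↔ (p.rep : ExteriorAlgebra ℂ V) ∈ decomposables k V := by
  refine ⟨?_, mem_grassmannian_of_mem⟩
  rintro ⟨E, hE, hp⟩
  exact coe_mem_decomposables hE (hp ▸ rep_mem_submodule p)

lemma mk_rep_smul {W : Type*} [AddCommGroup W] [Module ℂ W] {w : W} (hw : w ≠ 0) :
    ∃ a : ℂ, a ≠ 0 ∧ (Projectivization.mk ℂ w hw).rep = a • w := by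
  obtain ⟨a, ha⟩ := Projectivization.exists_smul_eq_mk_rep ℂ w hw
  exact ⟨a, a.ne_zero, ha.symm⟩

lemma mem_iSup_iff_exists_sum {W : Type*} [AddCommGroup W] [Module ℂ W] {s : ℕ}
    (S : Fin s → Submodule ℂ W) (w : W) :
    w ∈ ⨆ i, S i ↔ ∃ a : Fin s → W, (∀ i, a i ∈ S i) ∧ w = ∑ i, a i := by
  constructor
  · intro h
    rw [Submodule.mem_iSup_iff_exists_finsupp] at h
    obtain ⟨f, hf, hs⟩ := h
    exact ⟨f, hf, by rw [← hs, Finsupp.sum_fintype _ _ fun _ => rfl]⟩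
  · rintro ⟨a, ha, rfl⟩
    exact Submodule.sum_mem _ fun i _ => Submodule.mem_iSup_of_mem i (ha i)

/-- Spans of points become sums of decomposable vectors, a cone with a polynomial parametrization.
-/
lemma mem_secants_iff [FiniteDimensional ℂ V] {s k : ℕ} (p : ℙ ℂ (⋀[ℂ]^k V)) :
    (∃ x : Fin s → ℙ ℂ (⋀[ℂ]^k V), (∀ i, x i ∈ grassmannian V k) ∧
      p.submodule ≤ ⨆ i, (x i).submodule) ↔
      (p.rep : ExteriorAlgebra ℂ V) ∈ secantCone s k V := by
  simp only [submodule_le_iff, mem_iSup_iff_exists_sum]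
  constructor
  · rintro ⟨x, hx, a, ha, hp⟩
    refine ⟨fun i => a i, fun i => ?_, by rw [hp, Submodule.coe_sum]⟩
    obtain ⟨E, hE, hxE⟩ := hx i
    exact coe_mem_decomposables hE (hxE ▸ ha i)
  · rintro ⟨a, ha, hp⟩
    classical
    let a' : Fin s → ⋀[ℂ]^k V := fun i => ⟨a i, decomposables_subset k (ha i)⟩
    have hp' : p.rep = ∑ i, a' i := Subtype.ext (by rw [hp, Submodule.coe_sum])
    -- A vanishing summand defines no point; the point of a nonzero summand `a' j` stands in for it.
    obtain ⟨j, hj⟩ : ∃ j, a' j ≠ 0 := by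
      by_contra! h
      exact p.rep_nonzero (by rw [hp', Finset.sum_eq_zero fun i _ => h i])
    have key : ∀ i, ∃ y : ℙ ℂ (⋀[ℂ]^k V), y ∈ grassmannian V k ∧ a' i ∈ y.submodule := by
      have aux : ∀ i, a' i ≠ 0 → ∃ y : ℙ ℂ (⋀[ℂ]^k V), y ∈ grassmannian V k ∧
          a' i ∈ y.submodule := by
        intro i hi
        refine ⟨Projectivization.mk ℂ (a' i) hi, ?_, ?_⟩
        · rw [mem_grassmannian_iff]
          obtain ⟨c, -, hc⟩ := mk_rep_smul hi
          rw [hc]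
          exact smul_mem_decomposables c (ha i)
        · rw [Projectivization.submodule_mk]
          exact Submodule.mem_span_singleton_self _
      intro i
      by_cases hi : a' i = 0
      · obtain ⟨y, hy, -⟩ := aux j hj
        exact ⟨y, hy, hi ▸ Submodule.zero_mem _⟩
      · exact aux i hi
    choose x hx hx' using key
    exact ⟨x, hx, a', hx', hp'⟩

lemma linearIndependent_append {r m : ℕ} {e : Fin r → V} {a : Fin m → V}
    (h : LinearIndependent ℂ (Sum.elim e a)) : LinearIndependent ℂ (Fin.append e a) := by
  rw [← Fin.append_comp_sumElim] at h
  have := (linearIndependent_equiv (finSumFinEquiv (m := r) (n := m)) (R := ℂ)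
    (f := Fin.append e a)).1
  apply this
  convert h using 1
  ext x
  rcases x with x | x <;> simp

lemma exists_append_basis [FiniteDimensional ℂ V] {r m : ℕ} {e : Fin r → V}
    (he : LinearIndependent ℂ e) {E : Submodule ℂ V} (hE : finrank ℂ E = r + m)
    (heE : ∀ i, e i ∈ E) :
    ∃ a : Fin m → V, LinearIndependent ℂ (Fin.append e a) ∧ ∀ i, Fin.append e a i ∈ E := by
  set F := Submodule.span ℂ (range e)
  have hFE : F ≤ E := Submodule.span_le.2 (range_subset_iff.2 heE)
  obtain ⟨A, hAE, hA⟩ : ∃ A ≤ E, IsCompl (F.submoduleOf E) (A.submoduleOf E) := by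
    obtain ⟨A', hA'⟩ := (F.submoduleOf E).exists_isCompl
    refine ⟨A'.map E.subtype, Submodule.map_subtype_le _ _, ?_⟩
    have h : (A'.map E.subtype).submoduleOf E = A' :=
      Submodule.comap_map_eq_of_injective E.injective_subtype A'
    rwa [h]
  have hd : Disjoint F A := by
    rw [Submodule.disjoint_def]
    intro x hF hA'
    have := (Submodule.disjoint_def.1 hA.disjoint) ⟨x, hFE hF⟩ hF hA'
    exact congrArg Subtype.val this
  have hfr : finrank ℂ A = m := by
    have h1 := Submodule.finrank_add_eq_of_isCompl hA
    rw [(Submodule.submoduleOfEquivOfLe hFE).finrank_eq,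
      (Submodule.submoduleOfEquivOfLe hAE).finrank_eq, hE, finrank_span_eq_card he,
      Fintype.card_fin] at h1
    omega
  obtain ⟨a, ha, haA, hspan⟩ := exists_basis_of_finrank_eq hfr
  refine ⟨a, linearIndependent_append (he.sum_type ha (by rwa [hspan])), fun i => ?_⟩
  refine Fin.addCases (fun i => ?_) (fun i => ?_) i
  · rw [Fin.append_left]; exact heE i
  · rw [Fin.append_right]; exact hAE (haA i)

lemma exists_linearIndependent_mem [FiniteDimensional ℂ V] {r : ℕ} {S : Submodule ℂ V}
    (hr : r ≤ finrank ℂ S) : ∃ e : Fin r → V, LinearIndependent ℂ e ∧ ∀ i, e i ∈ S := by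
  obtain ⟨u, hu, huS, -⟩ := exists_basis_of_finrank_eq (rfl : finrank ℂ S = _)
  exact ⟨u ∘ Fin.castLE hr, hu.comp _ (Fin.castLE_injective hr), fun i => huS _⟩

/-- The common subspace supplies e: once e is completed to a basis of Eᵢ, the Plücker vector of Eᵢ
is e₁∧⋯∧eᵣ times a decomposable vector. Conversely, a nonzero product e₁∧⋯∧eᵣ∧aᵢ represents a plane
containing e. -/
lemma mem_restricted_iff [FiniteDimensional ℂ V] {s r m k : ℕ} (hk : k = r + m)
    (p : ℙ ℂ (⋀[ℂ]^k V)) :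
    (∃ E : Fin s → Submodule ℂ V, (∀ i, finrank ℂ (E i) = k) ∧
      r ≤ finrank ℂ (⨅ i, E i : Submodule ℂ V) ∧ p.submodule ≤ ⨆ i, pluckerLine k (E i)) ↔
      (p.rep : ExteriorAlgebra ℂ V) ∈ restrictedCone s r m V := by
  simp only [submodule_le_iff, mem_iSup_iff_exists_sum]
  subst hk
  constructor
  · rintro ⟨E, hE, hr, a, ha, hp⟩
    obtain ⟨e, he, heF⟩ := exists_linearIndependent_mem hr
    have key : ∀ i, ∃ b ∈ decomposables m V,
        (a i : ExteriorAlgebra ℂ V) = ExteriorAlgebra.ιMulti ℂ r e * b := by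
      intro i
      obtain ⟨b, hb, hbE⟩ := exists_append_basis he (hE i) fun j => iInf_le E i (heF j)
      have := ha i
      rw [pluckerLine_eq_span (hE i) hb hbE, Submodule.mem_span_singleton] at this
      obtain ⟨c, hc⟩ := this
      refine ⟨c • ExteriorAlgebra.ιMulti ℂ m b, ⟨c, b, rfl⟩, ?_⟩
      rw [← hc, mul_smul_comm, ExteriorAlgebra.ιMulti_mul_ιMulti]
      rfl
    choose b hb hab using key
    refine ⟨e, ∑ i, b i, ⟨b, hb, rfl⟩, ?_⟩
    rw [hp, Submodule.coe_sum, Finset.mul_sum]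
    exact Finset.sum_congr rfl fun i _ => hab i
  · rintro ⟨e, _, ⟨a, ha, rfl⟩, hp⟩
    rw [Finset.mul_sum] at hp
    choose c v hv using ha
    have hterm : ∀ i, ExteriorAlgebra.ιMulti ℂ r e * a i =
        c i • ExteriorAlgebra.ιMulti ℂ (r + m) (Fin.append e (v i)) := fun i => by
      rw [hv, mul_smul_comm, ExteriorAlgebra.ιMulti_mul_ιMulti]
    have hli : ∀ i, ExteriorAlgebra.ιMulti ℂ r e * a i ≠ 0 →
        LinearIndependent ℂ (Fin.append e (v i)) := fun i hi => by
      apply linearIndependent_of_ιMulti_ne_zero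
      intro h
      exact hi (by rw [hterm, h, smul_zero])
    -- A nonvanishing product makes e independent, and its plane stands in for the terms that
    -- vanish.
    obtain ⟨j, hj⟩ : ∃ j, ExteriorAlgebra.ιMulti ℂ r e * a j ≠ 0 := by
      by_contra! h
      exact p.rep_nonzero (Subtype.ext (by rw [hp, Finset.sum_eq_zero fun i _ => h i]; rfl))
    have key : ∀ i, ∃ F : Submodule ℂ V, finrank ℂ F = r + m ∧ (∀ l, e l ∈ F) ∧
        ∃ x ∈ pluckerLine (r + m) F, (x : ExteriorAlgebra ℂ V) =
          ExteriorAlgebra.ιMulti ℂ r e * a i := by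
      have aux : ∀ i, ExteriorAlgebra.ιMulti ℂ r e * a i ≠ 0 →
          ∃ F : Submodule ℂ V, finrank ℂ F = r + m ∧ (∀ l, e l ∈ F) ∧
          ∃ x ∈ pluckerLine (r + m) F, (x : ExteriorAlgebra ℂ V) =
          ExteriorAlgebra.ιMulti ℂ r e * a i := fun i hi => by
        have hsub : ∀ l, Fin.append e (v i) l ∈
            Submodule.span ℂ (range (Fin.append e (v i))) := fun l =>
          Submodule.subset_span (mem_range_self l)
        refine ⟨Submodule.span ℂ (range (Fin.append e (v i))), ?_, fun l => ?_,
          c i • exteriorPower.ιMulti ℂ (r + m) (Fin.append e (v i)),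
          Submodule.smul_mem _ _ (ιMulti_mem_pluckerLine hsub), (hterm i).symm⟩
        · rw [finrank_span_eq_card (hli i hi), Fintype.card_fin]
        · have := hsub (Fin.castAdd m l)
          rwa [Fin.append_left] at this
      intro i
      by_cases hi : ExteriorAlgebra.ιMulti ℂ r e * a i = 0
      · obtain ⟨F, h1, h2, -⟩ := aux j hj
        exact ⟨F, h1, h2, 0, Submodule.zero_mem _, by rw [hi]; rfl⟩
      · exact aux i hi
    choose F hF heF x hx hxa using key
    refine ⟨F, hF, ?_, x, hx, Subtype.ext ?_⟩
    · have he : LinearIndependent ℂ e := by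
        apply linearIndependent_of_ιMulti_ne_zero
        intro h
        exact hj (by rw [h, zero_mul])
      have hle : Submodule.span ℂ (range e) ≤ ⨅ i, F i :=
        le_iInf fun i => Submodule.span_le.2 (range_subset_iff.2 (heF i))
      have := Submodule.finrank_mono hle
      rwa [finrank_span_eq_card he, Fintype.card_fin] at this
    · rw [hp, Submodule.coe_sum]
      exact Finset.sum_congr rfl fun i _ => (hxa i).symm

end Cones

/-! ### Forms, linear maps and Zariski closure. -/

section ZariskiClosure

variable {W : Type*} [AddCommGroup W] [Module ℂ W] {W' : Type*} [AddCommGroup W'] [Module ℂ W']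

lemma mem_closure_iff_forms (X : Set (ℙ ℂ W)) (p : ℙ ℂ W) :
    p ∈ closure X ↔ ∀ d f, IsForm d f → (∀ x ∈ X, f x.rep = 0) → f p.rep = 0 := by
  constructor
  · intro hp d f hf hX
    have hc : IsClosed (zeroLocus ({f} : Set (W → ℂ))) :=
      (isClosed_iff_isAlgebraicSet _).2 ⟨{f}, by rintro g rfl; exact ⟨d, hf⟩, rfl⟩
    have hsub : X ⊆ zeroLocus ({f} : Set (W → ℂ)) := by
      rintro x hx g rfl
      exact (hf.vanish_iff x).2 (hX x hx)
    exact (hf.vanish_iff p).1 (closure_minimal hsub hc hp f rfl)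
  · intro h
    obtain ⟨F, hF, hcl⟩ := (isClosed_iff_isAlgebraicSet _).1 (isClosed_closure (s := X))
    rw [hcl]
    intro f hf
    obtain ⟨d, hd⟩ := hF f hf
    rw [hd.vanish_iff]
    refine h d f hd fun x hx => ?_
    have := subset_closure hx
    rw [hcl] at this
    exact (hd.vanish_iff x).1 (this f hf)

lemma isForm_dual (φ : Dual ℂ W) : IsForm 1 (φ : W → ℂ) :=
  ⟨Algebra.subset_adjoin (mem_range_self φ), fun c w => by simp⟩

lemma IsForm.comp_linearMap {d : ℕ} {f : W' → ℂ} (hf : IsForm d f) (L : W →ₗ[ℂ] W') :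
    IsForm d (f ∘ L) := by
  refine ⟨?_, fun c w => by simp [hf.2]⟩
  have h := hf.1
  clear hf
  induction h using Algebra.adjoin_induction with
  | mem x hx =>
    obtain ⟨φ, rfl⟩ := hx
    exact Algebra.subset_adjoin ⟨φ ∘ₗ L, rfl⟩
  | algebraMap r => exact Subalgebra.algebraMap_mem _ r
  | add x y _ _ hx hy => exact add_mem hx hy
  | mul x y _ _ hx hy => exact mul_mem hx hy

lemma mk_mem_closure_of_linearMap (L : W →ₗ[ℂ] W') {X : Set (ℙ ℂ W)} {X' : Set (ℙ ℂ W')}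
    (hX : ∀ x ∈ X, ∀ h : L x.rep ≠ 0, Projectivization.mk ℂ (L x.rep) h ∈ X')
    {p : ℙ ℂ W} (hp : p ∈ closure X) (h : L p.rep ≠ 0) :
    Projectivization.mk ℂ (L p.rep) h ∈ closure X' := by
  rw [mem_closure_iff_forms] at hp ⊢
  intro d f hf hfX
  -- The pullback of f alone may fail to vanish at points of X in the kernel of L, namely if f is a
  -- nonzero constant. The extra linear factor ℓ repairs this without vanishing at p.
  obtain ⟨ℓ, hℓ⟩ : ∃ ℓ : Dual ℂ W', ℓ (L p.rep) ≠ 0 := by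
    by_contra! h'
    exact h ((forall_dual_apply_eq_zero_iff ℂ _).1 h')
  have h1 := hp _ _ ((hf.mul (isForm_dual ℓ)).comp_linearMap L) (fun x hx => by
    by_cases h0 : L x.rep = 0
    · simp [h0]
    · obtain ⟨a, ha, hrep⟩ := mk_rep_smul h0
      have := hfX _ (hX x hx h0)
      rw [hrep, hf.2] at this
      have h2 := (mul_eq_zero.1 this).resolve_left (pow_ne_zero _ ha)
      simp [h2])
  obtain ⟨a, ha, hrep⟩ := mk_rep_smul h
  rw [hrep, hf.2]
  have h2 : f (L p.rep) * ℓ (L p.rep) = 0 := h1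
  rw [(mul_eq_zero.1 h2).resolve_right hℓ, mul_zero]

lemma isForm_det {d : ℕ} (T : Fin d → Fin d → Dual ℂ W) :
    IsForm d fun w => (Matrix.of fun i j => T i j w).det := by
  constructor
  · have : (fun w => (Matrix.of fun i j => T i j w).det) =
        ∑ σ : Equiv.Perm (Fin d), ((Equiv.Perm.sign σ : ℤ) : ℂ) •
          ∏ i, (T (σ i) i : W → ℂ) := by
      ext w
      simp [Matrix.det_apply, Finset.sum_apply, Finset.prod_apply, Units.smul_def]
    rw [this]
    exact Subalgebra.sum_mem _ fun σ _ => Subalgebra.smul_mem _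
      (Subalgebra.prod_mem _ fun i _ => Algebra.subset_adjoin (mem_range_self _)) _
  · intro c w
    have : (Matrix.of fun i j => T i j (c • w)) = c • Matrix.of fun i j => T i j w := by
      ext i j
      simp
    change (Matrix.of fun i j => T i j (c • w)).det = _
    rw [this, Matrix.det_smul, Fintype.card_fin]

/-- Independence is tested by minors against arbitrary linear forms; this is what turns rank
conditions into equations. -/
lemma linearIndependent_iff_exists_det {d : ℕ} (x : Fin d → W) :
    LinearIndependent ℂ x ↔
      ∃ ℓ : Fin d → Dual ℂ W, (Matrix.of fun i j => ℓ i (x j)).det ≠ 0 := by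
  constructor
  · intro h
    obtain ⟨ℓ, hℓ⟩ := exists_dual_family h
    refine ⟨ℓ, ?_⟩
    have : (Matrix.of fun i j => ℓ i (x j)) = (1 : Matrix (Fin d) (Fin d) ℂ) := by
      ext i j
      simp [hℓ, Matrix.one_apply]
    simp [this]
  · rintro ⟨ℓ, hℓ⟩
    rw [Fintype.linearIndependent_iff]
    intro g hg
    have h0 : (Matrix.of fun i j => ℓ i (x j)).mulVec g = 0 := by
      ext i
      have := congrArg (ℓ i) hg
      simpa [Matrix.mulVec, dotProduct, mul_comm] using this
    exact congrFun (Matrix.eq_zero_of_mulVec_eq_zero hℓ h0)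

lemma mk_mem_of_rep_iff {X : Set (ℙ ℂ W)} {S : W → Prop} (hS : ∀ (c : ℂ) w, S w → S (c • w))
    (hX : ∀ p, p ∈ X ↔ S p.rep) {w : W} (hw : w ≠ 0) (hwS : S w) :
    Projectivization.mk ℂ w hw ∈ X := by
  rw [hX]
  obtain ⟨c, -, hc⟩ := mk_rep_smul hw
  rw [hc]
  exact hS c w hwS

end ZariskiClosure

/-! ### The annihilator of a multivector and its semicontinuity. -/

section Annihilator

variable {V : Type*} [AddCommGroup V] [Module ℂ V]

/-- The space of vectors `v` with `v ∧ w = 0`. -/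
def annihilator (w : ExteriorAlgebra ℂ V) : Submodule ℂ V :=
  LinearMap.ker (LinearMap.mulRight ℂ w ∘ₗ ExteriorAlgebra.ι ℂ)

lemma mem_annihilator {w : ExteriorAlgebra ℂ V} {v : V} :
    v ∈ annihilator w ↔ ExteriorAlgebra.ι ℂ v * w = 0 := Iff.rfl

lemma annihilator_smul {c : ℂ} (hc : c ≠ 0) (w : ExteriorAlgebra ℂ V) :
    annihilator (c • w) = annihilator w := by
  ext v
  rw [mem_annihilator, mem_annihilator, mul_smul_comm, smul_eq_zero_iff_right hc]

/-- Rank–nullity for v ↦ v∧w: nullity at least s means rank below dim V + 1 − s. For s > dim V the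
truncated difference is 0, the empty family is independent, and both sides are false. -/
lemma le_finrank_annihilator_iff [FiniteDimensional ℂ V] (s : ℕ) (w : ExteriorAlgebra ℂ V) :
    s ≤ finrank ℂ (annihilator w) ↔ ∀ v : Fin (finrank ℂ V + 1 - s) → V,
      ¬ LinearIndependent ℂ fun i => ExteriorAlgebra.ι ℂ (v i) * w := by
  set T : V →ₗ[ℂ] ExteriorAlgebra ℂ V := LinearMap.mulRight ℂ w ∘ₗ ExteriorAlgebra.ι ℂ with hT
  have hrk : finrank ℂ (LinearMap.range T) + finrank ℂ (annihilator w) = finrank ℂ V :=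
    LinearMap.finrank_range_add_finrank_ker T
  constructor
  · intro hs v hv
    have h1 : LinearIndependent ℂ fun i => (⟨T (v i), LinearMap.mem_range_self T _⟩ :
        LinearMap.range T) := LinearIndependent.of_comp (LinearMap.range T).subtype hv
    have := h1.fintype_card_le_finrank
    rw [Fintype.card_fin] at this
    omega
  · intro h
    by_contra! hs
    have hle : finrank ℂ V + 1 - s ≤ finrank ℂ (LinearMap.range T) := by omega
    obtain ⟨x, hx, hxT⟩ : ∃ x : Fin (finrank ℂ V + 1 - s) → ExteriorAlgebra ℂ V,
        LinearIndependent ℂ x ∧ ∀ i, x i ∈ LinearMap.range T := by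
      let b := finBasis ℂ (LinearMap.range T)
      exact ⟨fun i => b (Fin.castLE hle i),
        (b.linearIndependent.map' (LinearMap.range T).subtype (by simp)).comp _
          (Fin.castLE_injective hle), fun i => (b _).2⟩
    choose v hv using hxT
    refine h v ?_
    have : (fun i => ExteriorAlgebra.ι ℂ (v i) * w) = x := funext hv
    rwa [this]

/-- The map v ↦ v∧w depends linearly on w, so the minors bounding its rank are forms in w. -/
lemma isClosed_le_finrank_annihilator [FiniteDimensional ℂ V] (k s : ℕ) :
    IsClosed {p : ℙ ℂ (⋀[ℂ]^k V) |
      s ≤ finrank ℂ (annihilator (p.rep : ExteriorAlgebra ℂ V))} := by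
  rw [isClosed_iff_isAlgebraicSet]
  let T (v : Fin (finrank ℂ V + 1 - s) → V)
      (ℓ : Fin (finrank ℂ V + 1 - s) → Dual ℂ (ExteriorAlgebra ℂ V)) (i j) :
      Dual ℂ (⋀[ℂ]^k V) :=
    ℓ i ∘ₗ LinearMap.mulLeft ℂ (ExteriorAlgebra.ι ℂ (v j)) ∘ₗ (⋀[ℂ]^k V).subtype
  refine ⟨{f | ∃ v ℓ, f = fun w => (Matrix.of fun i j => T v ℓ i j w).det}, ?_, ?_⟩
  · rintro f ⟨v, ℓ, rfl⟩
    exact ⟨_, isForm_det _⟩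
  · ext p
    rw [mem_ofPred_eq, le_finrank_annihilator_iff]
    constructor
    · rintro h f ⟨v, ℓ, rfl⟩
      rw [(isForm_det _).vanish_iff]
      by_contra hdet
      exact h v ((linearIndependent_iff_exists_det _).2 ⟨ℓ, hdet⟩)
    · intro h v hv
      obtain ⟨ℓ, hℓ⟩ := (linearIndependent_iff_exists_det _).1 hv
      exact hℓ (h _ ⟨v, ℓ, rfl⟩ p.rep (rep_mem_submodule p))

end Annihilator

/-! ### The incidence variety and its image. -/

section Projection

variable {V : Type*} [AddCommGroup V] [Module ℂ V] {U : Type*} [AddCommGroup U] [Module ℂ U]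

lemma coe_exteriorPower_map {m : ℕ} (f : V →ₗ[ℂ] U) (t : ⋀[ℂ]^m V) :
    (exteriorPower.map m f t : ExteriorAlgebra ℂ U) = ExteriorAlgebra.map f t := by
  have h : (⋀[ℂ]^m U).subtype ∘ₗ exteriorPower.map m f =
      (ExteriorAlgebra.map f).toLinearMap ∘ₗ (⋀[ℂ]^m V).subtype := by
    apply exteriorPower.linearMap_ext
    ext v
    simp
  exact LinearMap.congr_fun h t

lemma ιMulti_mul_mem {r m k : ℕ} (hk : k = r + m) (e : Fin r → V) {x : ExteriorAlgebra ℂ V}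
    (hx : x ∈ ⋀[ℂ]^m V) : ExteriorAlgebra.ιMulti ℂ r e * x ∈ ⋀[ℂ]^k V := by
  subst hk
  have := Submodule.mul_mem_mul (exteriorPower.ιMulti ℂ r e).2 hx
  rwa [← pow_add] at this

lemma map_mem_exteriorPower {m : ℕ} (f : V →ₗ[ℂ] U) {x : ExteriorAlgebra ℂ V}
    (hx : x ∈ ⋀[ℂ]^m V) : ExteriorAlgebra.map f x ∈ ⋀[ℂ]^m U := by
  have := (exteriorPower.map m f ⟨x, hx⟩).2
  rwa [coe_exteriorPower_map] at this

/-- The linear map `t ↦ e₁ ∧ ⋯ ∧ eᵣ ∧ (⋀ᵐσ)(t)`. -/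
def wedgeMap {r m k : ℕ} (hk : k = r + m) (e : Fin r → V) (σ : U →ₗ[ℂ] V) :
    ⋀[ℂ]^m U →ₗ[ℂ] ⋀[ℂ]^k V :=
  (LinearMap.mulLeft ℂ (ExteriorAlgebra.ιMulti ℂ r e) ∘ₗ
    (ExteriorAlgebra.map σ).toLinearMap).restrict fun _ hx =>
      ιMulti_mul_mem hk e (map_mem_exteriorPower σ hx)

lemma coe_wedgeMap {r m k : ℕ} (hk : k = r + m) (e : Fin r → V) (σ : U →ₗ[ℂ] V)
    (t : ⋀[ℂ]^m U) : (wedgeMap hk e σ t : ExteriorAlgebra ℂ V) =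
      ExteriorAlgebra.ιMulti ℂ r e * ExteriorAlgebra.map σ t := rfl

/-- The linear map `w ↦ (⋀ᵐf)(φᵣ ⌟ ⋯ φ₁ ⌟ w)`. -/
def contrMap {r m k : ℕ} (hk : k = r + m) (φ : Fin r → Dual ℂ V) (f : V →ₗ[ℂ] U) :
    ⋀[ℂ]^k V →ₗ[ℂ] ⋀[ℂ]^m U :=
  ((ExteriorAlgebra.map f).toLinearMap ∘ₗ contrs r φ).restrict fun _ hx =>
    map_mem_exteriorPower f (contrs_mem hk φ hx)

lemma coe_contrMap {r m k : ℕ} (hk : k = r + m) (φ : Fin r → Dual ℂ V) (f : V →ₗ[ℂ] U)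
    (w : ⋀[ℂ]^k V) : (contrMap hk φ f w : ExteriorAlgebra ℂ U) =
      ExteriorAlgebra.map f (contrs r φ w) := rfl

lemma exists_section (E : Submodule ℂ V) : ∃ σ : (V ⧸ E) →ₗ[ℂ] V, E.mkQ ∘ₗ σ = LinearMap.id :=
  E.mkQ.exists_rightInverse_of_surjective (Submodule.range_mkQ E)

lemma section_mkQ_sub_mem {E : Submodule ℂ V} {σ : (V ⧸ E) →ₗ[ℂ] V}
    (hσ : E.mkQ ∘ₗ σ = LinearMap.id) (v : V) : (σ ∘ₗ E.mkQ) v - v ∈ E := by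
  rw [← Submodule.Quotient.mk_eq_zero, ← Submodule.mkQ_apply, map_sub, LinearMap.comp_apply,
    ← LinearMap.comp_apply E.mkQ, hσ, LinearMap.id_apply, sub_self]

lemma ιMulti_mul_map_section {E : Submodule ℂ V} {σ : (V ⧸ E) →ₗ[ℂ] V}
    (hσ : E.mkQ ∘ₗ σ = LinearMap.id) {r : ℕ} {e : Fin r → V}
    (he : Submodule.span ℂ (range e) = E) (x : ExteriorAlgebra ℂ V) :
    ExteriorAlgebra.ιMulti ℂ r e * ExteriorAlgebra.map σ (ExteriorAlgebra.map E.mkQ x) =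
      ExteriorAlgebra.ιMulti ℂ r e * x := by
  rw [← AlgHom.comp_apply, ExteriorAlgebra.map_comp_map]
  exact ιMulti_mul_map (fun v => he ▸ section_mkQ_sub_mem hσ v) x

lemma map_contrs_ιMulti_mul_map_section {E : Submodule ℂ V} {σ : (V ⧸ E) →ₗ[ℂ] V}
    (hσ : E.mkQ ∘ₗ σ = LinearMap.id) {r : ℕ} {e : Fin r → V} (he : ∀ i, e i ∈ E)
    {φ : Fin r → Dual ℂ V} (hφ : ∀ i j, φ i (e j) = if i = j then 1 else 0)
    (x : ExteriorAlgebra ℂ (V ⧸ E)) :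
    ExteriorAlgebra.map E.mkQ (contrs r φ
      (ExteriorAlgebra.ιMulti ℂ r e * ExteriorAlgebra.map σ x)) = x := by
  rw [map_contrs_ιMulti_mul hφ fun i => by simpa using he i, ← AlgHom.comp_apply,
    ExteriorAlgebra.map_comp_map, hσ, ExteriorAlgebra.map_id, AlgHom.id_apply]

/-- A basis of E and a section of the quotient map replace the arbitrary lift of q by the linear map
`wedgeMap`; two lifts differ by terms that multiplication by e₁∧⋯∧eᵣ kills. -/
lemma isWedge_iff [FiniteDimensional ℂ V] {r m k : ℕ} (hk : k = r + m) {E : Submodule ℂ V}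
    {e : Fin r → V} (he : LinearIndependent ℂ e) (hE : Submodule.span ℂ (range e) = E)
    {σ : (V ⧸ E) →ₗ[ℂ] V} (hσ : E.mkQ ∘ₗ σ = LinearMap.id)
    (q : ℙ ℂ (⋀[ℂ]^m (V ⧸ E))) (p : ℙ ℂ (⋀[ℂ]^k V)) :
    IsWedge r E q p ↔ ∃ c : ℂ, c ≠ 0 ∧ p.rep = c • wedgeMap hk e σ q.rep := by
  have heE : ∀ i, e i ∈ E := fun i => hE ▸ Submodule.subset_span (mem_range_self i)
  have hEr : finrank ℂ E = r := by rw [← hE, finrank_span_eq_card he, Fintype.card_fin]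
  constructor
  · rintro ⟨e', he', t, ht, w, hw, hw0, hwe⟩
    rw [pluckerLine_eq_span hEr he heE, Submodule.mem_span_singleton] at he'
    obtain ⟨c, rfl⟩ := he'
    rw [q.submodule_eq, Submodule.mem_span_singleton] at ht
    obtain ⟨d, hd⟩ := ht
    rw [p.submodule_eq, Submodule.mem_span_singleton] at hw
    obtain ⟨b, rfl⟩ := hw
    have hd' : d • (q.rep : ExteriorAlgebra ℂ (V ⧸ E)) = ExteriorAlgebra.map E.mkQ t := by
      rw [← coe_exteriorPower_map, ← hd]; rfl
    have hb : b ≠ 0 := by rintro rfl; simp at hw0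
    have h1 : b • p.rep = (c * d) • wedgeMap hk e σ q.rep := by
      apply Subtype.ext
      rw [hwe, Submodule.coe_smul, Submodule.coe_smul, coe_wedgeMap, mul_smul, ← mul_smul_comm,
        ← map_smul, hd', ιMulti_mul_map_section hσ hE, smul_mul_assoc]
      rfl
    have hcd : c * d ≠ 0 := by
      intro h
      rw [h, zero_smul] at h1
      exact hw0 h1
    refine ⟨b⁻¹ * (c * d), mul_ne_zero (inv_ne_zero hb) hcd, ?_⟩
    rw [mul_smul, ← h1, smul_smul, inv_mul_cancel₀ hb, one_smul]
  · rintro ⟨c, hc, hp⟩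
    refine ⟨c • exteriorPower.ιMulti ℂ r e, Submodule.smul_mem _ _ (ιMulti_mem_pluckerLine heE),
      exteriorPower.map m σ q.rep, ?_, p.rep, rep_mem_submodule p, p.rep_nonzero, ?_⟩
    · rw [← LinearMap.comp_apply, ← exteriorPower.map_comp, hσ, exteriorPower.map_id]
      exact rep_mem_submodule q
    · rw [hp, coe_exteriorPower_map]
      simp [coe_wedgeMap]

/-- `wedgeMap` is linear and sends secants of Gr(m, V/E) to restricted secants, hence limits to
limits. -/
lemma image_incidence_subset [FiniteDimensional ℂ V] {s r m k : ℕ} (hk : k = r + m)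
    {E : Submodule ℂ V} (hE : finrank ℂ E = r) {q : ℙ ℂ (⋀[ℂ]^m (V ⧸ E))}
    (hq : q ∈ secantVariety s (grassmannian (V ⧸ E) m)) {p : ℙ ℂ (⋀[ℂ]^k V)}
    (hp : IsWedge r E q p) : p ∈ restrictedSecant V s r k := by
  obtain ⟨e, he, -, hspan⟩ := exists_basis_of_finrank_eq hE
  obtain ⟨σ, hσ⟩ := exists_section E
  obtain ⟨c, hc, hpc⟩ := (isWedge_iff hk he hspan hσ q p).1 hp
  have h0 : wedgeMap hk e σ q.rep ≠ 0 := by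
    intro h
    exact p.rep_nonzero (by rw [hpc, h, smul_zero])
  have hmem : Projectivization.mk ℂ _ h0 ∈ restrictedSecant V s r k := by
    refine mk_mem_closure_of_linearMap (wedgeMap hk e σ) (fun x hx h => ?_) hq h0
    refine mk_mem_of_rep_iff
      (S := fun w : ⋀[ℂ]^k V => (w : ExteriorAlgebra ℂ V) ∈ restrictedCone s r m V)
      (fun c _ hw => smul_mem_restrictedCone c hw) (mem_restricted_iff hk) h ?_
    rw [mem_ofPred_eq, mem_secants_iff] at hx
    exact ⟨e, _, map_mem_secantCone σ hx, rfl⟩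
  convert hmem
  rw [← p.mk_rep, Projectivization.mk_eq_mk_iff']
  exact ⟨c, hpc.symm⟩

lemma le_finrank_annihilator_of_mem [FiniteDimensional ℂ V] {s r m k : ℕ} (hk : k = r + m)
    {p : ℙ ℂ (⋀[ℂ]^k V)} (hp : p ∈ restrictedSecant V s r k) :
    r ≤ finrank ℂ (annihilator (p.rep : ExteriorAlgebra ℂ V)) := by
  refine closure_minimal ?_ (isClosed_le_finrank_annihilator k r) hp
  intro x hx
  rw [mem_ofPred_eq, mem_restricted_iff hk] at hx
  obtain ⟨e, t, -, hx⟩ := hx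
  have he : LinearIndependent ℂ e := by
    apply linearIndependent_of_ιMulti_ne_zero
    intro h
    exact x.rep_nonzero (Subtype.ext (by rw [hx, h, zero_mul]; rfl))
  have hle : Submodule.span ℂ (range e) ≤ annihilator (x.rep : ExteriorAlgebra ℂ V) := by
    intro v hv
    rw [mem_annihilator, hx, ← mul_assoc, ι_mul_ιMulti_eq_zero hv, zero_mul]
  have := Submodule.finrank_mono hle
  rwa [finrank_span_eq_card he, Fintype.card_fin] at this

/-- The bound on the annihilator persists in the closure, so p is divisible by some e₁∧⋯∧eᵣ. The
quotient is a contraction of p, hence a limit of secants, because contraction is linear and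
preserves decomposability. -/
lemma exists_incidence [FiniteDimensional ℂ V] {s r m k : ℕ} (hk : k = r + m)
    {p : ℙ ℂ (⋀[ℂ]^k V)} (hp : p ∈ restrictedSecant V s r k) :
    ∃ (E : Submodule ℂ V) (q : ℙ ℂ (⋀[ℂ]^m (V ⧸ E))), finrank ℂ E = r ∧
      q ∈ secantVariety s (grassmannian (V ⧸ E) m) ∧ IsWedge r E q p := by
  obtain ⟨e, he, hann⟩ := exists_linearIndependent_mem (le_finrank_annihilator_of_mem hk hp)
  obtain ⟨φ, hφ⟩ := exists_dual_family he
  set E := Submodule.span ℂ (range e) with hE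
  obtain ⟨σ, hσ⟩ := exists_section E
  have hdiv := eq_ιMulti_mul_contrs hφ hann
  have hback : wedgeMap hk e σ (contrMap hk φ E.mkQ p.rep) = p.rep := by
    apply Subtype.ext
    rw [coe_wedgeMap, coe_contrMap, ιMulti_mul_map_section hσ hE.symm, ← hdiv]
  have h0 : contrMap hk φ E.mkQ p.rep ≠ 0 := by
    intro h
    rw [h, map_zero] at hback
    exact p.rep_nonzero hback.symm
  refine ⟨E, Projectivization.mk ℂ _ h0, ?_, ?_, ?_⟩
  · rw [hE, finrank_span_eq_card he, Fintype.card_fin]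
  · refine mk_mem_closure_of_linearMap (contrMap hk φ E.mkQ) (fun x hx h => ?_) hp h0
    refine mk_mem_of_rep_iff (S := fun w : ⋀[ℂ]^m (V ⧸ E) => (w : ExteriorAlgebra ℂ (V ⧸ E)) ∈
      secantCone s m (V ⧸ E)) (fun c _ hw => smul_mem_secantCone c hw)
      mem_secants_iff h ?_
    rw [mem_ofPred_eq, mem_restricted_iff hk] at hx
    exact map_mem_secantCone _
      (contrs_mem_secantCone hk φ (restrictedCone_subset_secantCone hk hx))
  · rw [isWedge_iff hk he hE.symm hσ]
    obtain ⟨a, ha, hrep⟩ := mk_rep_smul h0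
    refine ⟨a⁻¹, inv_ne_zero ha, ?_⟩
    rw [hrep, map_smul, hback, smul_smul, inv_mul_cancel₀ ha, one_smul]

theorem image_incidenceVariety [FiniteDimensional ℂ V] (s : ℕ) {r k : ℕ} (hr : r ≤ k) :
    Prod.snd '' incidenceVariety V s r k = restrictedSecant V s r k := by
  have hk : k = r + (k - r) := by omega
  ext p
  constructor
  · rintro ⟨⟨⟨E, q⟩, p⟩, ⟨hE, hq, hp⟩, rfl⟩
    exact image_incidence_subset hk hE hq hp
  · intro hp
    obtain ⟨E, q, hE, hq, hp⟩ := exists_incidence hk hp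
    exact ⟨⟨⟨E, q⟩, p⟩, ⟨hE, hq, hp⟩, rfl⟩

/-- The dimension formula for E₁ + E₂ makes both conditions on E₁ ∩ E₂ equivalent already before
taking closures. -/
theorem restrictedSecant_overlap [FiniteDimensional ℂ V] {n k : ℕ} (hn : finrank ℂ V = n)
    (r : ℕ) : restrictedSecant V 2 (overlap r k n) k = restrictedSecant V 2 r k := by
  unfold restrictedSecant
  congr 1
  ext p
  refine exists_congr fun E => and_congr_right fun hE => and_congr_left fun _ => ?_
  have h2 : (⨅ i, E i) = E 0 ⊓ E 1 := by
    refine le_antisymm (le_inf (iInf_le _ _) (iInf_le _ _)) (le_iInf fun i => ?_)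
    fin_cases i
    exacts [inf_le_left, inf_le_right]
  have h3 := Submodule.finrank_sup_add_finrank_inf_eq (E 0) (E 1)
  have h4 := Submodule.finrank_le (E 0 ⊔ E 1)
  rw [hE, hE] at h3
  rw [h2, overlap]
  omega

end Projection

/-! ### Algebras of polynomial functions and their transcendence degrees. -/

section PolynomialFunctions

universe u

variable {W : Type*} [AddCommGroup W] [Module ℂ W] {W' : Type*} [AddCommGroup W'] [Module ℂ W']

/-- The algebra of polynomial functions on a vector space. -/
def polyAlg (W : Type*) [AddCommGroup W] [Module ℂ W] : Subalgebra ℂ (W → ℂ) :=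
  Algebra.adjoin ℂ (range fun φ : Dual ℂ W => (φ : W → ℂ))

/-- The algebra of the functions `f ∘ φ` with `f` polynomial. -/
def pullAlg {M : Type*} (φ : M → W) : Subalgebra ℂ (M → ℂ) :=
  Algebra.adjoin ℂ (range fun (ℓ : Dual ℂ W) (x : M) => ℓ (φ x))

/-- A map all of whose coordinates belong to an algebra of functions. -/
def IsPolyMap {M : Type*} (B : Subalgebra ℂ (M → ℂ)) (φ : M → W) : Prop :=
  ∀ ℓ : Dual ℂ W, (fun x => ℓ (φ x)) ∈ B

lemma isPolyMap_pullAlg {M : Type*} (φ : M → W) : IsPolyMap (pullAlg φ) φ :=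
  fun ℓ => Algebra.subset_adjoin (mem_range_self ℓ)

lemma isPolyMap_linearMap (L : W →ₗ[ℂ] W') : IsPolyMap (polyAlg W) L :=
  fun ℓ => Algebra.subset_adjoin (mem_range_self (ℓ ∘ₗ L))

namespace IsPolyMap

variable {M : Type*} {B : Subalgebra ℂ (M → ℂ)}

lemma const (w : W) : IsPolyMap B fun _ => w := fun ℓ => B.algebraMap_mem (ℓ w)

lemma add {φ ψ : M → W} (hφ : IsPolyMap B φ) (hψ : IsPolyMap B ψ) :
    IsPolyMap B fun x => φ x + ψ x := fun ℓ => by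
  simp only [map_add]
  exact B.add_mem (hφ ℓ) (hψ ℓ)

lemma sum {ι : Type*} (s : Finset ι) {φ : ι → M → W} (hφ : ∀ i ∈ s, IsPolyMap B (φ i)) :
    IsPolyMap B fun x => ∑ i ∈ s, φ i x := fun ℓ => by
  have : (fun x => ℓ (∑ i ∈ s, φ i x)) = ∑ i ∈ s, fun x => ℓ (φ i x) := by
    ext x
    simp
  rw [this]
  exact B.sum_mem fun i hi => hφ i hi ℓ

lemma smul {f : M → ℂ} (hf : f ∈ B) {φ : M → W} (hφ : IsPolyMap B φ) :
    IsPolyMap B fun x => f x • φ x := fun ℓ => by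
  simp only [map_smul, smul_eq_mul]
  exact B.mul_mem hf (hφ ℓ)

lemma linearMap {φ : M → W} (hφ : IsPolyMap B φ) (L : W →ₗ[ℂ] W') :
    IsPolyMap B fun x => L (φ x) := fun ℓ => hφ (ℓ ∘ₗ L)

lemma sub {φ ψ : M → W} (hφ : IsPolyMap B φ) (hψ : IsPolyMap B ψ) :
    IsPolyMap B fun x => φ x - ψ x := fun ℓ => by
  simp only [map_sub]
  exact B.sub_mem (hφ ℓ) (hψ ℓ)

lemma apply [FiniteDimensional ℂ W] {T : M → W →ₗ[ℂ] W'} (hT : ∀ w, IsPolyMap B fun x => T x w)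
    {φ : M → W} (hφ : IsPolyMap B φ) : IsPolyMap B fun x => T x (φ x) := by
  have : (fun x => T x (φ x)) =
      fun x => ∑ i, (finBasis ℂ W).coord i (φ x) • T x (finBasis ℂ W i) := by
    ext x
    conv_lhs => rw [← (finBasis ℂ W).sum_repr (φ x)]
    simp only [map_sum, map_smul, Basis.coord_apply]
  rw [this]
  exact sum _ fun i _ => smul (hφ _) (hT _)

lemma comp_mem {φ : M → W} (hφ : IsPolyMap B φ) {f : W → ℂ} (hf : f ∈ polyAlg W) :
    (fun x => f (φ x)) ∈ B := by
  induction hf using Algebra.adjoin_induction with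
  | mem x hx => obtain ⟨ℓ, rfl⟩ := hx; exact hφ ℓ
  | algebraMap r => exact B.algebraMap_mem r
  | add x y _ _ hx hy => exact B.add_mem hx hy
  | mul x y _ _ hx hy => exact B.mul_mem hx hy

lemma pullAlg_le {φ : M → W} (hφ : IsPolyMap B φ) : pullAlg φ ≤ B :=
  Algebra.adjoin_le (range_subset_iff.2 hφ)

lemma comp {N : Type*} {C : Subalgebra ℂ (N → ℂ)} {ψ : N → M} (h : ∀ f ∈ B, f ∘ ψ ∈ C)
    {φ : M → W} (hφ : IsPolyMap B φ) : IsPolyMap C fun y => φ (ψ y) :=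
  fun ℓ => h _ (hφ ℓ)

lemma of_subtype {S : Submodule ℂ W} {φ : M → S} (h : IsPolyMap B fun x => (φ x : W)) :
    IsPolyMap B φ := fun ℓ => by
  obtain ⟨ℓ', hℓ'⟩ := ℓ.exists_extend
  have : (fun x => ℓ (φ x)) = fun x => ℓ' (φ x) := by
    ext x
    rw [← hℓ']
    rfl
  rw [this]
  exact h ℓ'

lemma ιMulti {V : Type*} [AddCommGroup V] [Module ℂ V] [FiniteDimensional ℂ V] {k : ℕ}
    {v : M → Fin k → V} (hv : ∀ i, IsPolyMap B fun x => v x i) :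
    IsPolyMap B fun x => ExteriorAlgebra.ιMulti ℂ k (v x) := by
  induction k with
  | zero => simp only [ExteriorAlgebra.ιMulti_zero_apply]; exact const _
  | succ k ih =>
    simp only [ExteriorAlgebra.ιMulti_succ_apply]
    have h := ih (v := fun x => Matrix.vecTail (v x)) fun i => hv i.succ
    exact apply (T := fun x => LinearMap.mulRight ℂ
      (ExteriorAlgebra.ιMulti ℂ k (Matrix.vecTail (v x))) ∘ₗ ExteriorAlgebra.ι ℂ)
      (fun w => h.linearMap (LinearMap.mulLeft ℂ (ExteriorAlgebra.ι ℂ w))) (hv 0)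

end IsPolyMap

lemma pullAlg_subtype {M : Type*} {S : Submodule ℂ W} (φ : M → S) :
    pullAlg (fun x => (φ x : W)) = pullAlg φ :=
  le_antisymm ((isPolyMap_pullAlg φ).linearMap S.subtype).pullAlg_le
    (isPolyMap_pullAlg fun x => (φ x : W)).of_subtype.pullAlg_le

/-- Precomposition as a homomorphism of algebras of functions. -/
def precomp {M N : Type*} (φ : M → N) : (N → ℂ) →ₐ[ℂ] (M → ℂ) :=
  AlgHom.pi fun x => Pi.evalAlgHom ℂ _ (φ x)

lemma map_precomp_polyAlg {M : Type*} (φ : M → W) : (polyAlg W).map (precomp φ) = pullAlg φ := by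
  rw [polyAlg, AlgHom.map_adjoin, ← range_comp]
  rfl

/-- Both algebras are quotients of `polyAlg W`, and h says that the two kernels coincide. -/
lemma trdeg_pullAlg_eq {M M' : Type u} (φ : M → W) (ψ : M' → W)
    (h : ∀ f ∈ polyAlg W, (∀ x, f (φ x) = 0) ↔ ∀ y, f (ψ y) = 0) :
    Algebra.trdeg ℂ (pullAlg φ) = Algebra.trdeg ℂ (pullAlg ψ) := by
  have mem {N : Type u} (θ : N → W) (f : polyAlg W) : precomp θ f.1 ∈ pullAlg θ :=
    map_precomp_polyAlg θ ▸ ⟨f.1, f.2, rfl⟩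
  let F {N : Type u} (θ : N → W) : polyAlg W →ₐ[ℂ] pullAlg θ :=
    ((precomp θ).comp (polyAlg W).val).codRestrict _ (mem θ)
  have surj {N : Type u} (θ : N → W) : Function.Surjective (F θ) := by
    rintro ⟨f, hf⟩
    rw [← map_precomp_polyAlg] at hf
    obtain ⟨g, hg, rfl⟩ := hf
    exact ⟨⟨g, hg⟩, rfl⟩
  have hker : RingHom.ker (F φ) = RingHom.ker (F ψ) := by
    ext ⟨f, hf⟩
    rw [RingHom.mem_ker, RingHom.mem_ker, Subtype.ext_iff, Subtype.ext_iff, funext_iff, funext_iff]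
    exact h f hf
  exact (((Ideal.quotientKerAlgEquivOfSurjective (surj φ)).symm.trans
    (Ideal.quotientEquivAlgOfEq ℂ hker)).trans
    (Ideal.quotientKerAlgEquivOfSurjective (surj ψ))).trdeg_eq

lemma isForm_zero (d : ℕ) : IsForm d (0 : W → ℂ) := ⟨zero_mem _, by simp⟩

lemma IsForm.add {d : ℕ} {f g : W → ℂ} (hf : IsForm d f) (hg : IsForm d g) : IsForm d (f + g) :=
  ⟨add_mem hf.1 hg.1, fun c w => by simp only [Pi.add_apply, hf.2, hg.2]; ring⟩

lemma isForm_sum {d : ℕ} {ι : Type*} (s : Finset ι) {f : ι → W → ℂ}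
    (hf : ∀ i ∈ s, IsForm d (f i)) : IsForm d (∑ i ∈ s, f i) := by
  classical
  induction s using Finset.induction_on with
  | empty => exact isForm_zero d
  | insert a s ha ih =>
    rw [Finset.sum_insert ha]
    exact (hf a (Finset.mem_insert_self _ _)).add
      (ih fun i hi => hf i (Finset.mem_insert_of_mem hi))

/-- The decomposition of a polynomial function into homogeneous components. -/
lemma exists_homogeneous_components {f : W → ℂ} (hf : f ∈ polyAlg W) :
    ∃ P : Polynomial (W → ℂ), (∀ d, IsForm d (P.coeff d)) ∧ P.eval 1 = f := by
  induction hf using Algebra.adjoin_induction with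
  | mem x hx =>
    obtain ⟨φ, rfl⟩ := hx
    refine ⟨Polynomial.monomial 1 (φ : W → ℂ), fun d => ?_, by simp⟩
    rw [Polynomial.coeff_monomial]
    split_ifs with h
    · exact h ▸ isForm_dual φ
    · exact isForm_zero d
  | algebraMap r =>
    refine ⟨Polynomial.C (algebraMap ℂ (W → ℂ) r), fun d => ?_, by simp⟩
    rw [Polynomial.coeff_C]
    split_ifs with h
    · exact ⟨Subalgebra.algebraMap_mem _ r, by simp [h]⟩
    · exact isForm_zero d
  | add x y _ _ hx hy =>
    obtain ⟨P, hP, rfl⟩ := hx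
    obtain ⟨Q, hQ, rfl⟩ := hy
    exact ⟨P + Q, fun d => by rw [Polynomial.coeff_add]; exact (hP d).add (hQ d), by simp⟩
  | mul x y _ _ hx hy =>
    obtain ⟨P, hP, rfl⟩ := hx
    obtain ⟨Q, hQ, rfl⟩ := hy
    refine ⟨P * Q, fun d => ?_, by simp⟩
    rw [Polynomial.coeff_mul]
    refine isForm_sum _ fun i hi => ?_
    rw [← Finset.HasAntidiagonal.mem_antidiagonal.1 hi]
    exact (hP _).mul (hQ _)

/-- A polynomial vanishing on a cone is a sum of forms vanishing on it. -/
lemma vanishes_of_forms_vanish {M : Type*} {φ : M → W} (hφ : ∀ (c : ℂ) x, ∃ y, φ y = c • φ x)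
    {f : W → ℂ} (hf : f ∈ polyAlg W) (h0 : ∀ x, f (φ x) = 0) {w : W}
    (hw : ∀ d g, IsForm d g → (∀ x, g (φ x) = 0) → g w = 0) : f w = 0 := by
  obtain ⟨P, hP, rfl⟩ := exists_homogeneous_components hf
  have hev : ∀ v : W, (P.eval 1) v = P.sum fun d g => g v := by
    intro v
    rw [Polynomial.eval_eq_sum, Polynomial.sum, Polynomial.sum, Finset.sum_apply]
    simp
  rw [hev, Polynomial.sum]
  refine Finset.sum_eq_zero fun d _ => hw d _ (hP d) fun x => ?_
  -- On the line of multiples c • φ x the function is a polynomial in c vanishing identically; its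
  -- coefficients are the values of the homogeneous components at φ x.
  have hz : P.map (Pi.evalRingHom (fun _ => ℂ) (φ x)) = 0 := by
    apply Polynomial.funext
    intro c
    obtain ⟨y, hy⟩ := hφ c x
    have := h0 y
    rw [hev, hy, Polynomial.sum] at this
    rw [Polynomial.eval_map, Polynomial.eval₂_eq_sum, Polynomial.eval_zero, ← this,
      Polynomial.sum]
    refine Finset.sum_congr rfl fun e _ => ?_
    rw [(hP e).2, mul_comm]
    rfl
  have := congrArg (fun Q => Polynomial.coeff Q d) hz
  simpa [Polynomial.coeff_map] using this

/-- The homogeneous coordinate ring may be computed from a dense parametrization of the cone. -/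
lemma trdeg_coordRing {M W : Type u} [AddCommGroup W] [Module ℂ W] {X : Set (ℙ ℂ W)} {φ : M → W}
    (hX : ∀ x, φ x ∈ cone X) (hφ : ∀ (c : ℂ) x, ∃ y, φ y = c • φ x)
    (hd : ∀ d g, IsForm d g → (∀ x, g (φ x) = 0) → ∀ p ∈ X, g p.rep = 0) :
    Algebra.trdeg ℂ (coordRing X) = Algebra.trdeg ℂ (pullAlg φ) := by
  refine trdeg_pullAlg_eq (Subtype.val : cone X → W) φ fun f hf => ⟨fun h x => ?_, fun h => ?_⟩
  · exact h ⟨φ x, hX x⟩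
  · rintro ⟨w, p, hp, hw⟩
    refine vanishes_of_forms_vanish hφ hf h fun d g hg h0 => ?_
    exact (hg.vanish_iff p).2 (hd d g hg h0 p hp) w hw

lemma exists_polynomial_on_line {f : W → ℂ} (hf : f ∈ polyAlg W) (x u : W) :
    ∃ P : Polynomial ℂ, ∀ s : ℂ, f (x + s • u) = P.eval s := by
  induction hf using Algebra.adjoin_induction with
  | mem g hg =>
    obtain ⟨φ, rfl⟩ := hg
    exact ⟨Polynomial.C (φ x) + Polynomial.X * Polynomial.C (φ u), fun s => by simp; ring⟩
  | algebraMap r => exact ⟨Polynomial.C r, fun s => by simp⟩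
  | add g h _ _ hg hh =>
    obtain ⟨P, hP⟩ := hg
    obtain ⟨Q, hQ⟩ := hh
    exact ⟨P + Q, fun s => by simp [hP, hQ]⟩
  | mul g h _ _ hg hh =>
    obtain ⟨P, hP⟩ := hg
    obtain ⟨Q, hQ⟩ := hh
    exact ⟨P * Q, fun s => by simp [hP, hQ]⟩

/-- A polynomial function vanishing on a nonempty principal open subset vanishes. -/
lemma eq_zero_of_vanishes_on_open {f g : W → ℂ} (hf : f ∈ polyAlg W) (hg : g ∈ polyAlg W)
    (h : ∀ x, g x ≠ 0 → f x = 0) {x₀ : W} (hx₀ : g x₀ ≠ 0) (x : W) : f x = 0 := by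
  -- On the line from x to x₀ both functions are polynomials in s with zero product, and that of g
  -- is nonzero at s = 1.
  obtain ⟨P, hP⟩ := exists_polynomial_on_line hf x (x₀ - x)
  obtain ⟨Q, hQ⟩ := exists_polynomial_on_line hg x (x₀ - x)
  have hPQ : P * Q = 0 := by
    apply Polynomial.funext
    intro s
    rw [Polynomial.eval_mul, ← hP, ← hQ, Polynomial.eval_zero]
    by_cases hs : g (x + s • (x₀ - x)) = 0
    · rw [hs, mul_zero]
    · rw [h _ hs, zero_mul]
  have hQ0 : Q ≠ 0 := by
    rintro rfl
    have := hQ 1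
    simp [hx₀] at this
  have hP0 := (mul_eq_zero.1 hPQ).resolve_right hQ0
  have := hP 0
  simpa [hP0] using this

lemma isDomain_of_le_polyAlg {B : Subalgebra ℂ (W → ℂ)} (hB : B ≤ polyAlg W) : IsDomain B := by
  have : NoZeroDivisors B := by
    refine ⟨fun {f g} hfg => ?_⟩
    by_cases hg : g = 0
    · exact Or.inr hg
    · left
      obtain ⟨x₀, hx₀⟩ : ∃ x, g.1 x ≠ 0 := by
        by_contra! h
        exact hg (Subtype.ext (funext h))
      refine Subtype.ext (funext fun x => ?_)
      refine eq_zero_of_vanishes_on_open (hB f.2) (hB g.2) (fun y hy => ?_) hx₀ x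
      have := congrFun (congrArg Subtype.val hfg) y
      exact (mul_eq_zero.1 this).resolve_right hy
  exact NoZeroDivisors.to_isDomain B

lemma finiteType_pullAlg [FiniteDimensional ℂ W] {M : Type*} (φ : M → W) :
    Algebra.FiniteType ℂ (pullAlg φ) := by
  classical
  rw [← Subalgebra.fg_iff_finiteType]
  refine ⟨Finset.univ.image fun i => fun x => (finBasis ℂ W).coord i (φ x), ?_⟩
  apply le_antisymm
  · apply Algebra.adjoin_mono
    intro f hf
    simp only [Finset.coe_image, Finset.coe_univ, image_univ] at hf
    obtain ⟨i, rfl⟩ := hf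
    exact ⟨_, rfl⟩
  · refine Algebra.adjoin_le ?_
    rintro _ ⟨ℓ, rfl⟩
    have : (fun x => ℓ (φ x)) =
        ∑ i, ℓ (finBasis ℂ W i) • fun x => (finBasis ℂ W).coord i (φ x) := by
      ext x
      conv_lhs => rw [← (finBasis ℂ W).sum_repr (φ x)]
      simp only [map_sum, map_smul, Finset.sum_apply, Pi.smul_apply, smul_eq_mul,
        Basis.coord_apply, mul_comm]
    change (fun x => ℓ (φ x)) ∈ _
    rw [this]
    exact Subalgebra.sum_mem _ fun i _ => Subalgebra.smul_mem _ (Algebra.subset_adjoin (by simp)) _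

/-- `projDim` uses `Cardinal.toNat`, which sends infinite cardinals to 0; finiteness is needed for
it to respect sums and inequalities. -/
lemma trdeg_pullAlg_lt [FiniteDimensional ℂ W] {M : Type*} (φ : M → W) :
    Algebra.trdeg ℂ (pullAlg φ) < Cardinal.aleph0 :=
  have := finiteType_pullAlg φ
  trdeg_lt_aleph0_of_finiteType

end PolynomialFunctions

/-! ### Parametrized secants and a secant with trivial annihilator. -/

section Parametrization

variable {V : Type*} [AddCommGroup V] [Module ℂ V]

/-- The parametrization of the sums of `s` decomposable vectors. -/
def secantMap (s m : ℕ) (V : Type*) [AddCommGroup V] [Module ℂ V]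
    (y : Fin s → ℂ × (Fin m → V)) : ExteriorAlgebra ℂ V :=
  ∑ i, (y i).1 • ExteriorAlgebra.ιMulti ℂ m (y i).2

lemma secantMap_mem (s m : ℕ) (y : Fin s → ℂ × (Fin m → V)) :
    secantMap s m V y ∈ secantCone s m V :=
  ⟨_, fun i => ⟨(y i).1, (y i).2, rfl⟩, rfl⟩

lemma exists_secantMap_eq {s m : ℕ} {w : ExteriorAlgebra ℂ V} (hw : w ∈ secantCone s m V) :
    ∃ y, secantMap s m V y = w := by
  obtain ⟨a, ha, rfl⟩ := hw
  choose c v hv using ha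
  exact ⟨fun i => (c i, v i), Finset.sum_congr rfl fun i _ => (hv i).symm⟩

lemma smul_secantMap (s m : ℕ) (c : ℂ) (y : Fin s → ℂ × (Fin m → V)) :
    secantMap s m V (fun i => (c * (y i).1, (y i).2)) = c • secantMap s m V y := by
  simp only [secantMap, Finset.smul_sum, mul_smul]

lemma isPolyMap_ιMulti_mul_secantMap [FiniteDimensional ℂ V] (s r m : ℕ) :
    IsPolyMap (polyAlg ((Fin r → V) × (Fin s → ℂ × (Fin m → V))))
      fun x => ExteriorAlgebra.ιMulti ℂ r x.1 * secantMap s m V x.2 := by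
  have h : (fun x : (Fin r → V) × (Fin s → ℂ × (Fin m → V)) =>
      ExteriorAlgebra.ιMulti ℂ r x.1 * secantMap s m V x.2) = fun x =>
      ∑ i, (x.2 i).1 • ExteriorAlgebra.ιMulti ℂ (r + m) (Fin.append x.1 (x.2 i).2) := by
    ext x
    rw [secantMap, Finset.mul_sum]
    exact Finset.sum_congr rfl fun i _ => by
      rw [mul_smul_comm, ExteriorAlgebra.ιMulti_mul_ιMulti]
  rw [h]
  refine IsPolyMap.sum _ fun i _ => IsPolyMap.smul ?_ (IsPolyMap.ιMulti fun j => ?_)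
  · exact Algebra.subset_adjoin ⟨LinearMap.fst ℂ ℂ (Fin m → V) ∘ₗ LinearMap.proj i ∘ₗ
      LinearMap.snd ℂ (Fin r → V) (Fin s → ℂ × (Fin m → V)), rfl⟩
  · refine Fin.addCases (fun j => ?_) (fun j => ?_) j
    · simp only [Fin.append_left]
      exact isPolyMap_linearMap (LinearMap.proj j ∘ₗ
        LinearMap.fst ℂ (Fin r → V) (Fin s → ℂ × (Fin m → V)))
    · simp only [Fin.append_right]
      exact isPolyMap_linearMap (LinearMap.proj j ∘ₗ LinearMap.snd ℂ ℂ (Fin m → V) ∘ₗ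
        LinearMap.proj i ∘ₗ LinearMap.snd ℂ (Fin r → V) (Fin s → ℂ × (Fin m → V)))

lemma isPolyMap_secantMap [FiniteDimensional ℂ V] (s m : ℕ) :
    IsPolyMap (polyAlg (Fin s → ℂ × (Fin m → V))) (secantMap s m V) := by
  unfold secantMap
  refine IsPolyMap.sum _ fun i _ => IsPolyMap.smul ?_ (IsPolyMap.ιMulti fun j => ?_)
  · exact Algebra.subset_adjoin ⟨LinearMap.fst ℂ ℂ (Fin m → V) ∘ₗ LinearMap.proj i, rfl⟩
  · exact isPolyMap_linearMap (W := Fin s → ℂ × (Fin m → V)) (LinearMap.proj (φ := fun _ => V) j ∘ₗ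
      LinearMap.snd ℂ ℂ (Fin m → V) ∘ₗ LinearMap.proj (φ := fun _ => ℂ × (Fin m → V)) i)

/-- A general sum of two decomposable vectors of degree at least two has no linear divisor. -/
lemma exists_annihilator_eq_bot [FiniteDimensional ℂ V] {m : ℕ} (hm : 2 ≤ m)
    (hV : 2 * m ≤ finrank ℂ V) : ∃ y, annihilator (secantMap 2 m V y) = ⊥ := by
  let κ := Fin m ⊕ Fin m ⊕ Fin (finrank ℂ V - 2 * m)
  have hcard : Fintype.card (Fin (finrank ℂ V)) = Fintype.card κ := by
    simp only [κ, Fintype.card_fin, Fintype.card_sum]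
    omega
  let b : Basis κ ℂ V := (finBasis ℂ V).reindex (Fintype.equivOfCardEq hcard)
  let A : Fin m → κ := Sum.inl
  let B : Fin m → κ := fun i => Sum.inr (Sum.inl i)
  have hAi : Function.Injective A := Sum.inl_injective
  have hBi : Function.Injective B := Sum.inr_injective.comp Sum.inl_injective
  refine ⟨![(1, b ∘ A), (1, b ∘ B)], ?_⟩
  rw [eq_bot_iff]
  intro v hv
  rw [mem_annihilator] at hv
  have hsum : exteriorPower.ιMulti ℂ (m + 1) (Fin.cons v (b ∘ A) : Fin (m + 1) → V) +
      exteriorPower.ιMulti ℂ (m + 1) (Fin.cons v (b ∘ B) : Fin (m + 1) → V) = 0 := by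
    apply Subtype.ext
    change ExteriorAlgebra.ιMulti ℂ (m + 1) (Fin.cons v (b ∘ A) : Fin (m + 1) → V) +
      ExteriorAlgebra.ιMulti ℂ (m + 1) (Fin.cons v (b ∘ B) : Fin (m + 1) → V) = 0
    rw [ExteriorAlgebra.ιMulti_succ_apply, ExteriorAlgebra.ιMulti_succ_apply]
    simpa [secantMap, mul_add, Matrix.vecTail, Function.comp_def] using hv
  have key : ∀ (C D : Fin m → κ), Function.Injective C → Function.Injective D →
      (∀ i j, C i ≠ D j) →
      exteriorPower.ιMulti ℂ (m + 1) (Fin.cons v (b ∘ C) : Fin (m + 1) → V) +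
        exteriorPower.ιMulti ℂ (m + 1) (Fin.cons v (b ∘ D) : Fin (m + 1) → V) = 0 →
      ∀ l, (∀ i, C i ≠ l) → b.coord l v = 0 := by
    intro C D hC hD hCD h l hl
    -- This extracts the coefficient of b_l∧b_C. The term v∧b_C contributes the l-th coordinate of
    -- v. The term v∧b_D contributes nothing, since some D i differs from l, which needs m ≥ 2.
    have h1 := congrArg (exteriorPower.pairingDual ℂ V (m + 1) (exteriorPower.ιMulti ℂ (m + 1)
      (b.coord ∘ (Fin.cons l C : Fin (m + 1) → κ)))) h
    rw [map_add, map_zero, exteriorPower.pairingDual_ιMulti_ιMulti,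
      exteriorPower.pairingDual_ιMulti_ιMulti] at h1
    obtain ⟨i, hi⟩ : ∃ i, D i ≠ l := by
      by_contra! hcon
      have := hD ((hcon ⟨0, by omega⟩).trans (hcon ⟨1, by omega⟩).symm)
      simp at this
    have h2 : (Matrix.of fun i j => (b.coord ∘ (Fin.cons l C : Fin (m + 1) → κ)) j
        ((Fin.cons v (b ∘ D) : Fin (m + 1) → V) i)).det = 0 := by
      apply Matrix.det_eq_zero_of_row_eq_zero i.succ
      intro j
      refine Fin.cases ?_ (fun j => ?_) j
      · simp [hi]
      · simp [(hCD j i).symm]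
    have h3 : (Matrix.of fun i j => (b.coord ∘ (Fin.cons l C : Fin (m + 1) → κ)) j
        ((Fin.cons v (b ∘ C) : Fin (m + 1) → V) i)).det = b.coord l v := by
      rw [Matrix.det_succ_column_zero, Fin.sum_univ_succ, Finset.sum_eq_zero]
      · have : ((Matrix.of fun i j => (b.coord ∘ (Fin.cons l C : Fin (m + 1) → κ)) j
            ((Fin.cons v (b ∘ C) : Fin (m + 1) → V) i)).submatrix (Fin.succAbove 0) Fin.succ) =
            1 := by
          ext i j
          simp [Finsupp.single_apply, Matrix.one_apply, hC.eq_iff]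
        rw [this]
        simp
      · intro i _
        simp [hl i]
    rw [h2, h3, add_zero] at h1
    exact h1
  have hAB : ∀ i j, A i ≠ B j := fun i j => by simp [A, B]
  rw [Submodule.mem_bot, ← b.forall_coord_eq_zero_iff]
  -- An index in A lies outside B, and every other index lies outside A.
  rintro (l | l)
  · exact key B A hBi hAi (fun i j => (hAB j i).symm) ((add_comm _ _).trans hsum) _
      fun i => by simp [B]
  · exact key A B hAi hBi hAB hsum _ fun i => by simp [A]

/-- Contracting away e₁∧⋯∧eᵣ and reducing modulo E turns v∧e₁∧⋯∧eᵣ∧σ(t) = 0 into v̄∧t = 0. -/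
lemma annihilator_ιMulti_mul_le {E : Submodule ℂ V} {σ : (V ⧸ E) →ₗ[ℂ] V}
    (hσ : E.mkQ ∘ₗ σ = LinearMap.id) {r : ℕ} {e : Fin r → V} (he : LinearIndependent ℂ e)
    (hE : Submodule.span ℂ (range e) = E) {t : ExteriorAlgebra ℂ (V ⧸ E)}
    (ht : annihilator t = ⊥) :
    annihilator (ExteriorAlgebra.ιMulti ℂ r e * ExteriorAlgebra.map σ t) ≤ E := by
  intro v hv
  obtain ⟨φ, hφ⟩ := exists_dual_family he
  have heE : ∀ i, e i ∈ E := fun i => hE ▸ Submodule.subset_span (mem_range_self i)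
  rw [mem_annihilator, ← mul_assoc] at hv
  have h1 : ExteriorAlgebra.ιMulti ℂ r e *
      (ExteriorAlgebra.ι ℂ v * ExteriorAlgebra.map σ t) = 0 := by
    rw [← mul_assoc, ιMulti_mul_ι_comm, smul_mul_assoc, hv, smul_zero]
  have h2 := map_contrs_ιMulti_mul (f := E.mkQ) hφ (fun i => by simpa using heE i)
    (ExteriorAlgebra.ι ℂ v * ExteriorAlgebra.map σ t)
  rw [h1, map_zero, map_zero, map_mul, ExteriorAlgebra.map_apply_ι, ← AlgHom.comp_apply,
    ExteriorAlgebra.map_comp_map, hσ, ExteriorAlgebra.map_id, AlgHom.id_apply] at h2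
  have h3 : E.mkQ v ∈ annihilator t := h2.symm
  rw [ht, Submodule.mem_bot] at h3
  simpa using h3

end Parametrization

/-! ### Uniqueness in the general fiber of the projection. -/

section Fibers

variable {V : Type*} [AddCommGroup V] [Module ℂ V] [FiniteDimensional ℂ V]

/-- E always annihilates the product, and the dimension bound leaves room for nothing else. -/
lemma eq_annihilator_of_isWedge {r m k : ℕ} (hk : k = r + m) {p : ℙ ℂ (⋀[ℂ]^k V)}
    (hp : finrank ℂ (annihilator (p.rep : ExteriorAlgebra ℂ V)) ≤ r) {E : Submodule ℂ V}
    {q : ℙ ℂ (⋀[ℂ]^m (V ⧸ E))} (hE : finrank ℂ E = r) (hq : IsWedge r E q p) :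
    E = annihilator (p.rep : ExteriorAlgebra ℂ V) := by
  obtain ⟨e, he, -, hspan⟩ := exists_basis_of_finrank_eq hE
  obtain ⟨σ, hσ⟩ := exists_section E
  obtain ⟨c, -, hpc⟩ := (isWedge_iff hk he hspan hσ q p).1 hq
  refine Submodule.eq_of_le_of_finrank_le (fun v hv => ?_) (hp.trans hE.ge)
  rw [← hspan] at hv
  rw [mem_annihilator, hpc, Submodule.coe_smul, coe_wedgeMap, mul_smul_comm, ← mul_assoc,
    ι_mul_ιMulti_eq_zero hv, zero_mul, smul_zero]

/-- `contrMap` is a left inverse of `wedgeMap`, so p determines q once E is fixed. -/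
lemma isWedge_right_unique {r m k : ℕ} (hk : k = r + m) {p : ℙ ℂ (⋀[ℂ]^k V)}
    {E : Submodule ℂ V} (hE : finrank ℂ E = r) {q q' : ℙ ℂ (⋀[ℂ]^m (V ⧸ E))}
    (hq : IsWedge r E q p) (hq' : IsWedge r E q' p) : q = q' := by
  obtain ⟨e, he, heE, hspan⟩ := exists_basis_of_finrank_eq hE
  obtain ⟨σ, hσ⟩ := exists_section E
  obtain ⟨φ, hφ⟩ := exists_dual_family he
  obtain ⟨c, hc, hpc⟩ := (isWedge_iff hk he hspan hσ q p).1 hq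
  obtain ⟨c', -, hpc'⟩ := (isWedge_iff hk he hspan hσ q' p).1 hq'
  have hinv : ∀ t, contrMap hk φ E.mkQ (wedgeMap hk e σ t) = t := fun t =>
    Subtype.ext (map_contrs_ιMulti_mul_map_section hσ heE hφ _)
  have h := congrArg (contrMap hk φ E.mkQ) (hpc.symm.trans hpc')
  rw [map_smul, map_smul, hinv, hinv] at h
  rw [← q.mk_rep, ← q'.mk_rep, Projectivization.mk_eq_mk_iff']
  refine ⟨c⁻¹ * c', ?_⟩
  rw [mul_smul, ← h, smul_smul, inv_mul_cancel₀ hc, one_smul]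

lemma incidence_fiber_finite {s r k : ℕ} (hr : r ≤ k) {p : ℙ ℂ (⋀[ℂ]^k V)}
    (hp : finrank ℂ (annihilator (p.rep : ExteriorAlgebra ℂ V)) ≤ r) :
    (incidenceVariety V s r k ∩ Prod.snd ⁻¹' {p}).Finite := by
  have hk : k = r + (k - r) := by omega
  apply Set.Subsingleton.finite
  intro x hx y hy
  have hx1 : finrank ℂ x.1.1 = r := hx.1.1
  have hy1 : finrank ℂ y.1.1 = r := hy.1.1
  have hx2 : IsWedge r x.1.1 x.1.2 x.2 := hx.1.2.2
  have hy2 : IsWedge r y.1.1 y.1.2 y.2 := hy.1.2.2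
  have hxp : x.2 = p := hx.2
  have hyp : y.2 = p := hy.2
  clear hx hy
  obtain ⟨⟨E, q⟩, p₁⟩ := x
  obtain ⟨⟨E', q'⟩, p₂⟩ := y
  dsimp only at hx1 hy1 hx2 hy2 hxp hyp
  subst hxp hyp
  obtain rfl : E = E' :=
    (eq_annihilator_of_isWedge hk hp hx1 hx2).trans (eq_annihilator_of_isWedge hk hp hy1 hy2).symm
  rw [isWedge_right_unique hk hx1 hx2 hy2]

/-- If some point of the cone has annihilator of dimension `r`, so have general ones. -/
lemma restrictedSecant_subset_closure {s r m k : ℕ} (hk : k = r + m)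
    {w : ExteriorAlgebra ℂ V} (hw : w ∈ restrictedCone s r m V) (hw0 : w ≠ 0)
    (hann : finrank ℂ (annihilator w) ≤ r) :
    restrictedSecant V s r k ⊆ closure ({p : ℙ ℂ (⋀[ℂ]^k V) |
      r + 1 ≤ finrank ℂ (annihilator (p.rep : ExteriorAlgebra ℂ V))}ᶜ ∩
        restrictedSecant V s r k) := by
  refine closure_minimal (fun p hp => ?_) isClosed_closure
  rw [mem_ofPred_eq, mem_restricted_iff hk] at hp
  rw [mem_closure_iff_forms]
  intro d f hf hfX
  obtain ⟨F, hF, hZ⟩ := (isClosed_iff_isAlgebraicSet _).1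
    (isClosed_le_finrank_annihilator (V := V) k (r + 1))
  let Ψ : (Fin r → V) × (Fin s → ℂ × (Fin m → V)) → ⋀[ℂ]^k V := fun x =>
    ⟨ExteriorAlgebra.ιMulti ℂ r x.1 * secantMap s m V x.2, secantCone_subset
      (restrictedCone_subset_secantCone hk ⟨x.1, _, secantMap_mem s m x.2, rfl⟩)⟩
  have hΨ : IsPolyMap (polyAlg _) Ψ :=
    IsPolyMap.of_subtype (isPolyMap_ιMulti_mul_secantMap s r m)
  have hsurj : ∀ v : ⋀[ℂ]^k V, (v : ExteriorAlgebra ℂ V) ∈ restrictedCone s r m V →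
      ∃ x, Ψ x = v := by
    rintro v ⟨e, t, ht, hv⟩
    obtain ⟨y, rfl⟩ := exists_secantMap_eq ht
    exact ⟨(e, y), Subtype.ext hv.symm⟩
  obtain ⟨x₀, hx₀⟩ := hsurj ⟨w, secantCone_subset (restrictedCone_subset_secantCone hk hw)⟩ hw
  have hx₀0 : Ψ x₀ ≠ 0 := by
    rw [hx₀]
    exact fun h => hw0 (congrArg Subtype.val h)
  -- G is an equation of the locus of too large annihilators that fails at w. The linear form ℓ
  -- chosen below ensures that Ψ x ≠ 0 wherever (G·ℓ)(Ψ x) ≠ 0, so Ψ x defines a point there. The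
  -- parameters form a vector space, so f ∘ Ψ vanishes everywhere once it vanishes on this open set.
  obtain ⟨G, hG, hGw⟩ : ∃ G ∈ F, G (Ψ x₀) ≠ 0 := by
    by_contra! hcon
    have : Projectivization.mk ℂ _ hx₀0 ∈ zeroLocus F := by
      intro G hG v hv
      rw [Projectivization.submodule_mk, Submodule.mem_span_singleton] at hv
      obtain ⟨c, rfl⟩ := hv
      obtain ⟨e, he⟩ := hF G hG
      rw [he.2, hcon G hG, mul_zero]
    rw [← hZ, mem_ofPred_eq] at this
    obtain ⟨a, ha, hrep⟩ := mk_rep_smul hx₀0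
    rw [hrep, Submodule.coe_smul, annihilator_smul ha, hx₀] at this
    change r + 1 ≤ finrank ℂ (annihilator w) at this
    omega
  obtain ⟨e, he⟩ := hF G hG
  obtain ⟨ℓ, hℓ⟩ : ∃ ℓ : Dual ℂ (⋀[ℂ]^k V), ℓ (Ψ x₀) ≠ 0 := by
    by_contra! h'
    exact hx₀0 ((forall_dual_apply_eq_zero_iff ℂ _).1 h')
  have key : ∀ x, f (Ψ x) = 0 := by
    refine eq_zero_of_vanishes_on_open (hΨ.comp_mem hf.1)
      (hΨ.comp_mem (he.mul (isForm_dual ℓ)).1) (fun x hx => ?_) (mul_ne_zero hGw hℓ)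
    have hx' : G (Ψ x) * ℓ (Ψ x) ≠ 0 := hx
    have hx0 : Ψ x ≠ 0 := by
      intro h
      rw [h, map_zero, mul_zero] at hx'
      exact hx' rfl
    obtain ⟨a, ha, hrep⟩ := mk_rep_smul hx0
    have := hfX (Projectivization.mk ℂ _ hx0) ⟨fun hmem => ?_, ?_⟩
    · rw [hrep, hf.2] at this
      exact (mul_eq_zero.1 this).resolve_left (pow_ne_zero _ ha)
    · rw [hZ] at hmem
      refine left_ne_zero_of_mul hx' (hmem G hG _ ?_)
      rw [Projectivization.submodule_mk]
      exact Submodule.mem_span_singleton_self _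
    · apply subset_closure
      exact mk_mem_of_rep_iff (S := fun w : ⋀[ℂ]^k V =>
        (w : ExteriorAlgebra ℂ V) ∈ restrictedCone s r m V)
        (fun c _ hw => smul_mem_restrictedCone c hw) (mem_restricted_iff hk) hx0
        ⟨x.1, _, secantMap_mem s m x.2, rfl⟩
  obtain ⟨x, hx⟩ := hsurj _ hp
  rw [← hx]
  exact key x

lemma exists_restrictedCone_annihilator_le {s r m : ℕ} {E : Submodule ℂ V}
    (hE : finrank ℂ E = r) {y : Fin s → ℂ × (Fin m → V ⧸ E)}
    (hy : annihilator (secantMap s m (V ⧸ E) y) = ⊥) (hy0 : secantMap s m (V ⧸ E) y ≠ 0) :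
    ∃ w ∈ restrictedCone s r m V, w ≠ 0 ∧ finrank ℂ (annihilator w) ≤ r := by
  obtain ⟨e, he, heE, hspan⟩ := exists_basis_of_finrank_eq hE
  obtain ⟨σ, hσ⟩ := exists_section E
  obtain ⟨φ, hφ⟩ := exists_dual_family he
  refine ⟨_, ⟨e, _, map_mem_secantCone σ (secantMap_mem s m y), rfl⟩, fun h => hy0 ?_, ?_⟩
  · rw [← map_contrs_ιMulti_mul_map_section hσ heE hφ (secantMap s m (V ⧸ E) y), h, map_zero,
      map_zero]
  · exact (Submodule.finrank_mono (annihilator_ιMulti_mul_le hσ he hspan hy)).trans hE.le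

end Fibers

/-! ### Transcendence degree of a rationally equivalent subalgebra. -/

section TranscendenceDegree

universe u

/-- Polynomials with coefficients in an algebra of functions, as functions. -/
def mvPolynomialToFun (ι : Type) {N : Type u} (R : Subalgebra ℂ (N → ℂ)) :
    MvPolynomial ι R →ₐ[ℂ] ((ι → ℂ) × N → ℂ) :=
  MvPolynomial.aevalTower ((precomp Prod.snd).comp R.val) fun i x => x.1 i

lemma mvPolynomialToFun_C {ι : Type} {N : Type u} {R : Subalgebra ℂ (N → ℂ)} (f : R) :
    mvPolynomialToFun ι R (MvPolynomial.C f) = fun x => f.1 x.2 :=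
  MvPolynomial.aevalTower_C _ _ _

lemma mvPolynomialToFun_X {ι : Type} {N : Type u} {R : Subalgebra ℂ (N → ℂ)} (i : ι) :
    mvPolynomialToFun ι R (MvPolynomial.X i) = fun x => x.1 i :=
  MvPolynomial.aevalTower_X _ _ _

lemma mvPolynomialToFun_apply {ι : Type} {N : Type u} {R : Subalgebra ℂ (N → ℂ)}
    (P : MvPolynomial ι R) (x : ι → ℂ) (y : N) :
    mvPolynomialToFun ι R P (x, y) =
      MvPolynomial.eval x (P.map ((Pi.evalRingHom (fun _ => ℂ) y).comp R.val.toRingHom)) := by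
  induction P using MvPolynomial.induction_on with
  | C f =>
    rw [mvPolynomialToFun_C, MvPolynomial.map_C, MvPolynomial.eval_C]
    rfl
  | add p q hp hq => rw [map_add, Pi.add_apply, hp, hq, map_add, map_add]
  | mul_X p i hp =>
    rw [map_mul, Pi.mul_apply, hp, mvPolynomialToFun_X, map_mul, map_mul, MvPolynomial.map_X,
      MvPolynomial.eval_X]

lemma mvPolynomialToFun_injective (ι : Type) {N : Type u} (R : Subalgebra ℂ (N → ℂ)) :
    Function.Injective (mvPolynomialToFun ι R) := by
  rw [injective_iff_map_eq_zero]
  intro P hP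
  ext d y
  have h0 : P.map ((Pi.evalRingHom (fun _ => ℂ) y).comp R.val.toRingHom) = 0 := by
    apply MvPolynomial.funext
    intro x
    rw [← mvPolynomialToFun_apply, hP, map_zero]
    rfl
  have := congrArg (MvPolynomial.coeff d) h0
  rw [MvPolynomial.coeff_map] at this
  exact this

/-- Let `A` be a subalgebra of a polynomial ring over `R` such that the variables are rational over
`A` and `R` is contained in the algebra generated by `A` and the variables. Then the transcendence
degree of `A` is that of `R` plus the number of variables. -/
lemma trdeg_eq_add_of_rational {ι : Type} [Finite ι] {R F : Type u} [CommRing R] [IsDomain R]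
    [Algebra ℂ R] [CommRing F] [Algebra ℂ F] {θ : MvPolynomial ι R →ₐ[ℂ] F}
    (hθ : Function.Injective θ) {A : Subalgebra ℂ F} (hA : A ≤ θ.range)
    (hx : ∀ i, ∃ G ∈ A, G ≠ 0 ∧ G * θ (MvPolynomial.X i) ∈ A)
    (hR : ∀ B : Subalgebra ℂ F, A ≤ B → (∀ i, θ (MvPolynomial.X i) ∈ B) →
      ∀ f, θ (MvPolynomial.C f) ∈ B) :
    Algebra.trdeg ℂ A = Nat.card ι + Algebra.trdeg ℂ R := by
  set A' : Subalgebra ℂ (MvPolynomial ι R) := A.comap θ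
  have hmem : ∀ {P}, P ∈ A' ↔ θ P ∈ A := Iff.rfl
  have hmap : A'.map θ = A := by
    apply le_antisymm
    · rintro _ ⟨P, hP, rfl⟩
      exact hP
    · intro f hf
      obtain ⟨P, rfl⟩ := hA hf
      exact ⟨P, hf, rfl⟩
  have h1 : Algebra.trdeg ℂ A' = Algebra.trdeg ℂ A := by
    rw [← hmap]
    exact (A'.equivMapOfInjective θ hθ).trdeg_eq
  -- The goal is that the whole polynomial ring is algebraic over A'. Each variable is a quotient of
  -- elements of A', and then `hR` puts R in the closure. Additivity of transcendence degree through
  -- A' and through R finishes.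
  set Cl := Subalgebra.algebraicClosure A' (MvPolynomial ι R)
  have hX : ∀ i, MvPolynomial.X i ∈ Cl := by
    intro i
    obtain ⟨G, hG, hG0, hGX⟩ := hx i
    obtain ⟨P, rfl⟩ := hA hG
    have hP0 : P ≠ 0 := by
      rintro rfl
      exact hG0 (map_zero θ)
    have hPX : P * MvPolynomial.X i ∈ A' := by
      rw [hmem, map_mul]
      exact hGX
    exact IsAlgebraic.of_mul (mem_nonZeroDivisors_of_ne_zero hP0)
      (isAlgebraic_algebraMap (⟨P, hG⟩ : A'))
      (isAlgebraic_algebraMap (⟨P * MvPolynomial.X i, hPX⟩ : A'))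
  have hC : ∀ f : R, MvPolynomial.C f ∈ Cl := by
    intro f
    obtain ⟨P, hP, hPf⟩ := hR ((Cl.restrictScalars ℂ).map θ) (fun g hg => by
      obtain ⟨P, rfl⟩ := hA hg
      exact ⟨P, isAlgebraic_algebraMap (⟨P, hg⟩ : A'), rfl⟩) (fun i => ⟨_, hX i, rfl⟩) f
    exact hθ hPf ▸ hP
  have halg : Algebra.IsAlgebraic A' (MvPolynomial ι R) := by
    refine ⟨fun P => ?_⟩
    change P ∈ Cl
    induction P using MvPolynomial.induction_on with
    | C f => exact hC f
    | add p q hp hq => exact add_mem hp hq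
    | mul_X p i hp => exact mul_mem hp (hX i)
  have hf : FaithfulSMul ℂ A' :=
    (faithfulSMul_iff_algebraMap_injective ℂ A').2 (algebraMap ℂ A').injective
  have h2 := trdeg_add_eq ℂ A' (A := MvPolynomial ι R)
  have h3 := trdeg_add_eq ℂ R (A := MvPolynomial ι R)
  rw [trdeg_eq_zero_iff.2 halg, add_zero] at h2
  rw [← h1, h2, ← h3, MvPolynomial.trdeg_of_isDomain, add_comm]
  congr 1
  rw [← Nat.cast_card, Cardinal.lift_natCast]

end TranscendenceDegree

/-! ### The graph chart and recovery of the factor t. -/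

section Unipotent

variable {V : Type*} [AddCommGroup V] [Module ℂ V] {U : Type*} [AddCommGroup U] [Module ℂ U]

lemma IsPolyMap.exteriorMap {M : Type*} {B : Subalgebra ℂ (M → ℂ)} [FiniteDimensional ℂ U]
    {g : M → V →ₗ[ℂ] U} (hg : ∀ v, IsPolyMap B fun x => g x v) {k : ℕ}
    {w : ExteriorAlgebra ℂ V} (hw : w ∈ ⋀[ℂ]^k V) :
    IsPolyMap B fun x => ExteriorAlgebra.map (g x) w := by
  rw [← ExteriorAlgebra.ιMulti_span_fixedDegree] at hw
  induction hw using Submodule.span_induction with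
  | mem w hw =>
    obtain ⟨v, rfl⟩ := hw
    simp only [ExteriorAlgebra.map_apply_ιMulti]
    exact IsPolyMap.ιMulti fun i => hg (v i)
  | zero => simp only [map_zero]; exact IsPolyMap.const 0
  | add w w' _ _ h h' => simp only [map_add]; exact h.add h'
  | smul c w _ h => simp only [map_smul]; exact h.linearMap (c • LinearMap.id)

lemma IsPolyMap.exteriorMap_apply {M : Type*} {B : Subalgebra ℂ (M → ℂ)} [FiniteDimensional ℂ V]
    [FiniteDimensional ℂ U] {g : M → V →ₗ[ℂ] U} (hg : ∀ v, IsPolyMap B fun x => g x v) {k : ℕ}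
    {φ : M → ⋀[ℂ]^k V} (hφ : IsPolyMap B φ) :
    IsPolyMap B fun x => ExteriorAlgebra.map (g x) (φ x : ExteriorAlgebra ℂ V) :=
  IsPolyMap.apply (T := fun x => (ExteriorAlgebra.map (g x)).toLinearMap ∘ₗ (⋀[ℂ]^k V).subtype)
    (fun w => IsPolyMap.exteriorMap hg w.2) hφ

/-- The linear map with matrix `x` in terms of a given family of vectors. -/
def matrixVector {r d : ℕ} (ω : Fin d → U) (x : Fin r × Fin d → ℂ) (i : Fin r) : U :=
  ∑ j, x (i, j) • ω j

/-- Subtracting φᵢ ∘ σ ∘ π, with π the quotient map, makes φᵢ vanish on the complement and leaves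
its values on E unchanged. -/
lemma exists_dual_family_section {E : Submodule ℂ V} {σ : (V ⧸ E) →ₗ[ℂ] V}
    (hσ : E.mkQ ∘ₗ σ = LinearMap.id) {r : ℕ} {e : Fin r → V} (he : LinearIndependent ℂ e)
    (heE : ∀ i, e i ∈ E) : ∃ φ : Fin r → Dual ℂ V,
      (∀ i j, φ i (e j) = if i = j then 1 else 0) ∧ ∀ i u, φ i (σ u) = 0 := by
  obtain ⟨φ, hφ⟩ := exists_dual_family he
  refine ⟨fun i => φ i - φ i ∘ₗ σ ∘ₗ E.mkQ, fun i j => ?_, fun i u => ?_⟩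
  · have : E.mkQ (e j) = 0 := by simpa using heE j
    simp [hφ, this]
  · have : E.mkQ (σ u) = u := LinearMap.congr_fun hσ u
    rw [LinearMap.sub_apply, LinearMap.comp_apply, LinearMap.comp_apply, this, sub_self]

/-- The family of the vectors `(e₁ + X₁) ∧ ⋯ ∧ (eᵣ + Xᵣ) ∧ t`, where the `Xᵢ` range over a
complement of `⟨e₁, …, eᵣ⟩` and `t` over a family in an exterior power of this complement. -/
def graphMap {E : Submodule ℂ V} {r d m : ℕ} {N : Type*} (e : Fin r → V) (σ : (V ⧸ E) →ₗ[ℂ] V)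
    (ω : Fin d → V ⧸ E) (t : N → ⋀[ℂ]^m (V ⧸ E)) (x : (Fin r × Fin d → ℂ) × N) :
    ExteriorAlgebra ℂ V :=
  ExteriorAlgebra.ιMulti ℂ r (fun i => e i + σ (matrixVector ω x.1 i)) *
    ExteriorAlgebra.map σ (t x.2)

variable {E : Submodule ℂ V} {r d m : ℕ} {N : Type*}

lemma graphMap_mem {k : ℕ} (hk : k = r + m) (e : Fin r → V) (σ : (V ⧸ E) →ₗ[ℂ] V)
    (ω : Fin d → V ⧸ E) (t : N → ⋀[ℂ]^m (V ⧸ E)) (x : (Fin r × Fin d → ℂ) × N) :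
    graphMap e σ ω t x ∈ ⋀[ℂ]^k V :=
  ιMulti_mul_mem hk _ (map_mem_exteriorPower σ (t x.2).2)

lemma isPolyMap_matrixVector {B : Subalgebra ℂ ((Fin r × Fin d → ℂ) × N → ℂ)}
    (hB : ∀ i, (fun x => x.1 i) ∈ B) (ω : Fin d → U) (i : Fin r) :
    IsPolyMap B fun x => matrixVector ω x.1 i :=
  IsPolyMap.sum _ fun j _ => IsPolyMap.smul (hB (i, j)) (IsPolyMap.const (ω j))

lemma isPolyMap_graphMap [FiniteDimensional ℂ V] (e : Fin r → V)
    (σ : (V ⧸ E) →ₗ[ℂ] V) (ω : Fin d → V ⧸ E) {t : N → ⋀[ℂ]^m (V ⧸ E)}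
    {B : Subalgebra ℂ ((Fin r × Fin d → ℂ) × N → ℂ)} (hB : ∀ i, (fun x => x.1 i) ∈ B)
    (ht : IsPolyMap B fun x => t x.2) : IsPolyMap B (graphMap e σ ω t) := by
  let T : (Fin r × Fin d → ℂ) × N → ⋀[ℂ]^m (V ⧸ E) →ₗ[ℂ] ExteriorAlgebra ℂ V := fun x =>
    LinearMap.mulLeft ℂ (ExteriorAlgebra.ιMulti ℂ r
      fun i => e i + σ (matrixVector ω x.1 i)) ∘ₗ (ExteriorAlgebra.map σ).toLinearMap ∘ₗ
      (⋀[ℂ]^m (V ⧸ E)).subtype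
  have h : graphMap e σ ω t = fun x => T x (t x.2) := rfl
  rw [h]
  refine IsPolyMap.apply (fun w => ?_) ht
  refine IsPolyMap.linearMap (IsPolyMap.ιMulti fun i => ?_)
    (LinearMap.mulRight ℂ (ExteriorAlgebra.map σ (w : ExteriorAlgebra ℂ (V ⧸ E))))
  exact (IsPolyMap.const (e i)).add ((isPolyMap_matrixVector hB ω i).linearMap σ)

/-- The parameter `t` is polynomial in `X` and in `(e₁ + X₁) ∧ ⋯ ∧ (eᵣ + Xᵣ) ∧ t`. -/
lemma isPolyMap_of_graphMap [FiniteDimensional ℂ V] {e : Fin r → V} {σ : (V ⧸ E) →ₗ[ℂ] V}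
    (hσ : E.mkQ ∘ₗ σ = LinearMap.id) (he : LinearIndependent ℂ e) (heE : ∀ i, e i ∈ E)
    (ω : Fin d → V ⧸ E) {t : N → ⋀[ℂ]^m (V ⧸ E)}
    {B : Subalgebra ℂ ((Fin r × Fin d → ℂ) × N → ℂ)} (hB : ∀ i, (fun x => x.1 i) ∈ B)
    (ht : IsPolyMap B (graphMap e σ ω t)) : IsPolyMap B fun x => t x.2 := by
  obtain ⟨φ, hφe, hφσ⟩ := exists_dual_family_section hσ he heE
  -- The unipotent map `g x` fixes the complement and straightens eᵢ+Xᵢ to eᵢ. It sends the point to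
  -- e₁∧⋯∧eᵣ∧σ(t), from which contraction reads off t, and it is polynomial in X.
  let g : (Fin r × Fin d → ℂ) × N → V →ₗ[ℂ] V := fun x =>
    LinearMap.id - ∑ i, (φ i).smulRight (σ (matrixVector ω x.1 i))
  have hg : ∀ x v, g x v = v - ∑ i, φ i v • σ (matrixVector ω x.1 i) := fun x v => by
    simp [g, LinearMap.sum_apply]
  have hgσ : ∀ x, g x ∘ₗ σ = σ := fun x => by
    refine LinearMap.ext fun u => ?_
    rw [LinearMap.comp_apply, hg, Finset.sum_eq_zero fun i _ => by rw [hφσ, zero_smul], sub_zero]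
  have hge : ∀ x i, g x (e i + σ (matrixVector ω x.1 i)) = e i := fun x i => by
    rw [hg]
    simp [hφe, hφσ]
  have hgmap : ∀ x, ExteriorAlgebra.map (g x) (graphMap e σ ω t x) =
      ExteriorAlgebra.ιMulti ℂ r e * ExteriorAlgebra.map σ (t x.2) := fun x => by
    rw [graphMap, map_mul, ExteriorAlgebra.map_apply_ιMulti, ← AlgHom.comp_apply,
      ExteriorAlgebra.map_comp_map, hgσ]
    congr 2
    ext i
    exact hge x i
  let Φ : (Fin r × Fin d → ℂ) × N → ⋀[ℂ]^(r + m) V := fun x =>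
    ⟨graphMap e σ ω t x, graphMap_mem rfl e σ ω t x⟩
  have hΦ : IsPolyMap B Φ := ht.of_subtype
  have h1 : IsPolyMap B fun x => ExteriorAlgebra.map (g x) (graphMap e σ ω t x) :=
    IsPolyMap.exteriorMap_apply (φ := Φ) (fun v => by
      simp only [hg]
      exact (IsPolyMap.const v).sub (IsPolyMap.sum _ fun i _ =>
        ((isPolyMap_matrixVector hB ω i).linearMap σ).linearMap (φ i v • LinearMap.id))) hΦ
  have h2 := h1.linearMap ((ExteriorAlgebra.map E.mkQ).toLinearMap ∘ₗ contrs r φ)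
  simp only [hgmap, LinearMap.comp_apply, AlgHom.toLinearMap_apply] at h2
  simp only [map_contrs_ιMulti_mul_map_section hσ heE hφe] at h2
  exact h2.of_subtype

end Unipotent

/-! ### Recovery of the coordinates X and the dimension count in the chart. -/

section GraphDimension

universe u

variable {V : Type u} [AddCommGroup V] [Module ℂ V]
  {E : Submodule ℂ V} {r d m : ℕ} {N : Type u}

/-- The coordinates of `X` are rational functions of `(e₁ + X₁) ∧ ⋯ ∧ (eᵣ + Xᵣ) ∧ t`. -/
lemma graphMap_coordinate_rational {e : Fin r → V} {σ : (V ⧸ E) →ₗ[ℂ] V}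
    (hσ : E.mkQ ∘ₗ σ = LinearMap.id) (he : LinearIndependent ℂ e)
    (hE : Submodule.span ℂ (range e) = E) {ω : Fin d → V ⧸ E} (hω : LinearIndependent ℂ ω)
    {t : N → ⋀[ℂ]^m (V ⧸ E)} {y₀ : N}
    (hy₀ : annihilator (t y₀ : ExteriorAlgebra ℂ (V ⧸ E)) = ⊥) (i : Fin r × Fin d) :
    ∃ G ∈ pullAlg (graphMap e σ ω t), G ≠ 0 ∧
      (G * fun x => x.1 i) ∈ pullAlg (graphMap e σ ω t) := by
  set A := pullAlg (graphMap e σ ω t)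
  have hA : IsPolyMap A (graphMap e σ ω t) := isPolyMap_pullAlg _
  set x₀ : (Fin r × Fin d → ℂ) × N := (0, y₀)
  have hΦ₀ : graphMap e σ ω t x₀ =
      ExteriorAlgebra.ιMulti ℂ r e * ExteriorAlgebra.map σ (t y₀) := by
    simp [graphMap, x₀, matrixVector]
  -- At X = 0 and t = t y₀ the annihilator lies in E, so no nonzero vector of the complement kills
  -- the point. Some d×d minor is therefore nonzero there.
  have hli : LinearIndependent ℂ fun j =>
      ExteriorAlgebra.ι ℂ (σ (ω j)) * graphMap e σ ω t x₀ := by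
    rw [Fintype.linearIndependent_iff]
    intro c hc
    have hmem : σ (∑ j, c j • ω j) ∈ annihilator (graphMap e σ ω t x₀) := by
      rw [mem_annihilator, ← hc, map_sum, map_sum, Finset.sum_mul]
      simp only [map_smul, smul_mul_assoc]
    rw [hΦ₀] at hmem
    have hmem' := annihilator_ιMulti_mul_le hσ he hE hy₀ hmem
    have h0 : ∑ j, c j • ω j = 0 := by
      have : E.mkQ (σ (∑ j, c j • ω j)) = 0 := (Submodule.Quotient.mk_eq_zero E).2 hmem'
      rwa [← LinearMap.comp_apply, hσ] at this
    exact Fintype.linearIndependent_iff.1 hω c h0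
  obtain ⟨ℓ, hℓ⟩ := (linearIndependent_iff_exists_det _).1 hli
  let MA : Matrix (Fin d) (Fin d) A := Matrix.of fun p j =>
    ⟨fun x => ℓ p (ExteriorAlgebra.ι ℂ (σ (ω j)) * graphMap e σ ω t x),
      hA (ℓ p ∘ₗ LinearMap.mulLeft ℂ (ExteriorAlgebra.ι ℂ (σ (ω j))))⟩
  let b : Fin d → A := fun p =>
    ⟨fun x => -ℓ p (ExteriorAlgebra.ι ℂ (e i.1) * graphMap e σ ω t x),
      hA (-(ℓ p ∘ₗ LinearMap.mulLeft ℂ (ExteriorAlgebra.ι ℂ (e i.1))))⟩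
  let X : Fin d → (Fin r × Fin d → ℂ) × N → ℂ := fun j x => x.1 (i.1, j)
  -- The identity (eᵢ + Σⱼ xᵢⱼ σ(ωⱼ))∧w = 0 is a linear system for the i-th row of X, with
  -- coefficients linear in the point w.
  have hlin : (MA.map A.val).mulVec X = fun p => (b p : (Fin r × Fin d → ℂ) × N → ℂ) := by
    ext p x
    have hz : ExteriorAlgebra.ι ℂ (e i.1 + σ (matrixVector ω x.1 i.1)) *
        graphMap e σ ω t x = 0 := by
      rw [graphMap, ← mul_assoc, ι_mul_ιMulti_eq_zero, zero_mul]
      exact Submodule.subset_span ⟨i.1, rfl⟩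
    have := congrArg (ℓ p) hz
    simp only [matrixVector, map_add, add_mul, map_sum, map_smul, Finset.sum_mul,
      smul_mul_assoc, map_zero] at this
    rw [Matrix.mulVec, dotProduct, Finset.sum_apply]
    have hb : (b p : (Fin r × Fin d → ℂ) × N → ℂ) x =
      -ℓ p (ExteriorAlgebra.ι ℂ (e i.1) * graphMap e σ ω t x) := rfl
    rw [hb, eq_neg_iff_add_eq_zero, add_comm, ← this]
    congr 1
    refine Finset.sum_congr rfl fun j _ => ?_
    exact mul_comm _ _
  refine ⟨MA.det, MA.det.2, fun h => hℓ ?_, ?_⟩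
  · have h1 := congrFun h x₀
    have h2 : (MA.det : (Fin r × Fin d → ℂ) × N → ℂ) x₀ =
        (((Pi.evalRingHom (fun _ => ℂ) x₀).comp A.val.toRingHom).mapMatrix MA).det := by
      rw [← RingHom.map_det]
      rfl
    rw [h2] at h1
    exact h1
  -- Cramer's rule: multiplying by the adjugate shows that the determinant times each coordinate
  -- lies in A.
  · have h1 : (MA.adjugate.map A.val).mulVec ((MA.map A.val).mulVec X) = A.val MA.det • X := by
      rw [Matrix.mulVec_mulVec, ← Matrix.map_mul, Matrix.adjugate_mul]
      ext j x
      simp [Matrix.mulVec, dotProduct, Matrix.smul_apply, Matrix.one_apply, apply_ite]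
    rw [hlin] at h1
    have h2 := congrFun h1 i.2
    have h3 : (A.val MA.det • X) i.2 = (MA.det : (Fin r × Fin d → ℂ) × N → ℂ) *
      fun x => x.1 i := rfl
    rw [h3] at h2
    rw [← h2, Matrix.mulVec, dotProduct]
    exact A.sum_mem fun p _ => A.mul_mem (MA.adjugate i.2 p).2 (b p).2

/-- The parameters are recovered from the point, X rationally and t polynomially given X, so
`trdeg_eq_add_of_rational` adds one for each of the rd entries of X. -/
theorem trdeg_graphMap [FiniteDimensional ℂ V] {e : Fin r → V} {σ : (V ⧸ E) →ₗ[ℂ] V}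
    (hσ : E.mkQ ∘ₗ σ = LinearMap.id) (he : LinearIndependent ℂ e)
    (hE : Submodule.span ℂ (range e) = E) {ω : Fin d → V ⧸ E} (hω : LinearIndependent ℂ ω)
    {t : N → ⋀[ℂ]^m (V ⧸ E)} (ht : IsDomain (pullAlg t)) {y₀ : N}
    (hy₀ : annihilator (t y₀ : ExteriorAlgebra ℂ (V ⧸ E)) = ⊥) :
    Algebra.trdeg ℂ (pullAlg (graphMap e σ ω t)) =
      ((r * d : ℕ) : Cardinal) + Algebra.trdeg ℂ (pullAlg t) := by
  have heE : ∀ i, e i ∈ E := fun i => hE ▸ Submodule.subset_span (mem_range_self i)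
  rw [trdeg_eq_add_of_rational (mvPolynomialToFun_injective (Fin r × Fin d) (pullAlg t))]
  · simp
  · refine (isPolyMap_graphMap (B := (mvPolynomialToFun (Fin r × Fin d) (pullAlg t)).range) e σ ω
      (fun i => ⟨_, mvPolynomialToFun_X i⟩) ?_).pullAlg_le
    exact (isPolyMap_pullAlg t).comp (C := (mvPolynomialToFun (Fin r × Fin d) (pullAlg t)).range)
      (ψ := Prod.snd) fun f hf => ⟨_, mvPolynomialToFun_C ⟨f, hf⟩⟩
  · intro i
    rw [mvPolynomialToFun_X]
    exact graphMap_coordinate_rational hσ he hE hω hy₀ i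
  · intro B hAB hB f
    simp only [mvPolynomialToFun_X] at hB
    rw [mvPolynomialToFun_C]
    have h := isPolyMap_of_graphMap hσ he heE ω hB fun ℓ => hAB (isPolyMap_pullAlg _ ℓ)
    have hle : (pullAlg t).map (precomp Prod.snd) ≤ B := by
      rw [pullAlg, AlgHom.map_adjoin, ← range_comp]
      exact Algebra.adjoin_le (range_subset_iff.2 h)
    exact hle ⟨f, f.2, rfl⟩

end GraphDimension

/-! ### Polynomial functions on a vector space and dense parametrizations. -/

section PolynomialAlgebra

universe u

variable {W : Type u} [AddCommGroup W] [Module ℂ W]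

lemma trdeg_polyAlg [FiniteDimensional ℂ W] : Algebra.trdeg ℂ (polyAlg W) = finrank ℂ W := by
  let b := finBasis ℂ W
  let θ : MvPolynomial (Fin (finrank ℂ W)) ℂ →ₐ[ℂ] (W → ℂ) :=
    MvPolynomial.aeval fun i w => b.coord i w
  have hθ : ∀ P w, θ P w = MvPolynomial.eval (fun i => b.coord i w) P := by
    intro P w
    induction P using MvPolynomial.induction_on with
    | C c => simp [θ]
    | add p q hp hq => rw [map_add, Pi.add_apply, hp, hq, map_add]
    | mul_X p i hp =>
      rw [map_mul, Pi.mul_apply, hp, map_mul]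
      simp [θ]
  have hinj : Function.Injective θ := by
    rw [injective_iff_map_eq_zero]
    intro P hP
    apply MvPolynomial.funext
    intro x
    have := hθ P (b.equivFun.symm x)
    rw [hP] at this
    have hx : (fun i => b.coord i (b.equivFun.symm x)) = x := by
      ext i
      rw [b.coord_apply, ← b.equivFun_apply, LinearEquiv.apply_symm_apply]
    rw [hx] at this
    simpa using this.symm
  have hrange : θ.range = polyAlg W := by
    apply le_antisymm
    · rintro _ ⟨P, rfl⟩
      change θ P ∈ polyAlg W
      induction P using MvPolynomial.induction_on with
      | C c =>
        rw [← MvPolynomial.algebraMap_eq, AlgHom.commutes]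
        exact (polyAlg W).algebraMap_mem c
      | add p q hp hq => rw [map_add]; exact add_mem hp hq
      | mul_X p i hp =>
        rw [map_mul]
        refine mul_mem hp ?_
        rw [MvPolynomial.aeval_X]
        exact Algebra.subset_adjoin ⟨b.coord i, rfl⟩
    · refine Algebra.adjoin_le ?_
      rintro _ ⟨ℓ, rfl⟩
      refine ⟨∑ i, MvPolynomial.C (ℓ (b i)) * MvPolynomial.X i, ?_⟩
      ext w
      change θ _ w = _
      rw [hθ]
      change _ = ℓ w
      conv_rhs => rw [← b.sum_repr w]
      rw [map_sum, map_sum]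
      refine Finset.sum_congr rfl fun i _ => ?_
      rw [map_mul, MvPolynomial.eval_C, MvPolynomial.eval_X, map_smul, smul_eq_mul, mul_comm]
      rfl
  have h := (AlgEquiv.ofInjective θ hinj).lift_trdeg_eq
  rw [hrange, MvPolynomial.trdeg_of_isDomain] at h
  simpa using h.symm

lemma trdeg_pullAlg_of_surjective [FiniteDimensional ℂ W] {M : Type u} {φ : M → W}
    (hφ : Function.Surjective φ) : Algebra.trdeg ℂ (pullAlg φ) = finrank ℂ W := by
  rw [← trdeg_polyAlg]
  refine (trdeg_pullAlg_eq φ (id : W → W) fun f _ => ⟨fun h y => ?_, fun h x => h _⟩)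
  obtain ⟨x, rfl⟩ := hφ y
  exact h x

/-- The dimension of the closure of a set of points with a dense polynomial parametrization of its
cone. -/
lemma trdeg_coordRing_of_cone {M : Type u} {S : Set W} (hS : ∀ (c : ℂ), ∀ w ∈ S, c • w ∈ S)
    {X : Set (ℙ ℂ W)} (hSX : ∀ p : ℙ ℂ W, p.rep ∈ S → p ∈ X)
    (hXS : X ⊆ closure {p | p.rep ∈ S}) {φ : M → W} (hφS : ∀ x, φ x ∈ S)
    (hφ : ∀ (c : ℂ) x, ∃ y, φ y = c • φ x) {x₀ : M} (hx₀ : φ x₀ ≠ 0)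
    (hd : ∀ f ∈ polyAlg W, (∀ x, f (φ x) = 0) → ∀ w ∈ S, f w = 0) :
    Algebra.trdeg ℂ (coordRing X) = Algebra.trdeg ℂ (pullAlg φ) := by
  have hmk : ∀ w (h : w ≠ 0), w ∈ S → Projectivization.mk ℂ w h ∈ X := fun w h hw => by
    apply hSX
    obtain ⟨c, -, hc⟩ := mk_rep_smul h
    exact hc ▸ hS c w hw
  refine trdeg_coordRing (fun x => ?_) hφ fun d g hg h p hp => ?_
  · by_cases h : φ x = 0
    · exact ⟨_, hmk _ hx₀ (hφS x₀), h ▸ zero_mem _⟩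
    · refine ⟨_, hmk _ h (hφS x), ?_⟩
      rw [Projectivization.submodule_mk]
      exact Submodule.mem_span_singleton_self _
  · exact (mem_closure_iff_forms _ p).1 (hXS hp) d g hg fun q hq => hd g hg.1 h _ hq

end PolynomialAlgebra

/-! ### Density of the graph chart. -/

section Chart

variable {V : Type*} [AddCommGroup V] [Module ℂ V]

/-- The parametrization of the `s`-secants of a Grassmannian as a map to `⋀ᵐV`. -/
def secantPoint (s m : ℕ) (V : Type*) [AddCommGroup V] [Module ℂ V]
    (y : Fin s → ℂ × (Fin m → V)) : ⋀[ℂ]^m V :=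
  ⟨secantMap s m V y, secantCone_subset (secantMap_mem s m y)⟩

lemma isPolyMap_secantPoint [FiniteDimensional ℂ V] (s m : ℕ) :
    IsPolyMap (polyAlg (Fin s → ℂ × (Fin m → V))) (secantPoint s m V) :=
  (isPolyMap_secantMap s m).of_subtype

lemma smul_secantPoint (s m : ℕ) (c : ℂ) (y : Fin s → ℂ × (Fin m → V)) :
    secantPoint s m V (fun i => (c * (y i).1, (y i).2)) = c • secantPoint s m V y :=
  Subtype.ext (smul_secantMap s m c y)

lemma secantPoint_one_zero_surjective :
    Function.Surjective (secantPoint 1 0 V) := by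
  intro w
  have hw : (w : ExteriorAlgebra ℂ V) ∈ LinearMap.range (ExteriorAlgebra.ι ℂ) ^ 0 := w.2
  rw [pow_zero, Submodule.mem_one] at hw
  obtain ⟨c, hc⟩ := hw
  refine ⟨fun _ => (c, 0), Subtype.ext ?_⟩
  simp [secantPoint, secantMap, ← hc, Algebra.algebraMap_eq_smul_one]

lemma map_secantMap {U : Type*} [AddCommGroup U] [Module ℂ U] (f : V →ₗ[ℂ] U) (s m : ℕ)
    (y : Fin s → ℂ × (Fin m → V)) : ExteriorAlgebra.map f (secantMap s m V y) =
      secantMap s m U fun i => ((y i).1, fun j => f ((y i).2 j)) := by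
  simp only [secantMap, map_sum, map_smul, ExteriorAlgebra.map_apply_ιMulti]
  rfl

variable {E : Submodule ℂ V} {r d : ℕ}

lemma eq_sum_add_section {e : Fin r → V} {σ : (V ⧸ E) →ₗ[ℂ] V}
    (hσ : E.mkQ ∘ₗ σ = LinearMap.id) (hE : Submodule.span ℂ (range e) = E)
    {φ : Fin r → Dual ℂ V} (hφe : ∀ i j, φ i (e j) = if i = j then 1 else 0)
    (hφσ : ∀ i u, φ i (σ u) = 0) (v : V) : v = ∑ i, φ i v • e i + σ (E.mkQ v) := by
  have h : v - (σ ∘ₗ E.mkQ) v ∈ Submodule.span ℂ (range e) := by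
    rw [hE, ← neg_sub]
    exact neg_mem (section_mkQ_sub_mem hσ v)
  rw [Submodule.mem_span_range_iff_exists_fun] at h
  obtain ⟨c, hc⟩ := h
  have hφ : ∀ i, φ i v = c i := fun i => by
    have := congrArg (φ i) hc
    simp only [map_sum, map_smul, hφe, smul_eq_mul, map_sub, LinearMap.comp_apply, hφσ] at this
    simpa using this.symm
  rw [LinearMap.comp_apply] at hc
  simp only [hφ]
  rw [hc, sub_add_cancel]

/-- The graphs over `E` fill the part of the restricted secants on which a determinant does not
vanish. -/
lemma exists_graphMap_eq [FiniteDimensional ℂ V] {s m : ℕ} {e : Fin r → V} {σ : (V ⧸ E) →ₗ[ℂ] V}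
    (hσ : E.mkQ ∘ₗ σ = LinearMap.id) (hE : Submodule.span ℂ (range e) = E)
    {ω : Fin d → V ⧸ E} (hω : Submodule.span ℂ (range ω) = ⊤) {φ : Fin r → Dual ℂ V}
    (hφe : ∀ i j, φ i (e j) = if i = j then 1 else 0) (hφσ : ∀ i u, φ i (σ u) = 0)
    {ε : Fin r → V} (hε : (Matrix.of fun i j => φ i (ε j)).det ≠ 0)
    (y : Fin s → ℂ × (Fin m → V)) :
    ∃ x, graphMap e σ ω (secantPoint s m (V ⧸ E)) x =
      ExteriorAlgebra.ιMulti ℂ r ε * secantMap s m V y := by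
  set Q := Matrix.of fun i j => φ i (ε j) with hQ
  -- The basis of ⟨ε⟩ dual to φ: now ε'ⱼ − eⱼ lies in the complement, as the chart requires. The
  -- change of basis costs a scalar c, absorbed into the coefficients of t.
  let ε' : Fin r → V := fun j => ∑ l, Q⁻¹ l j • ε l
  have hφε' : ∀ i j, φ i (ε' j) = if i = j then 1 else 0 := fun i j => by
    have h := congrFun (congrFun (Matrix.mul_nonsing_inv Q (isUnit_iff_ne_zero.2 hε)) i) j
    rw [Matrix.mul_apply, Matrix.one_apply] at h
    rw [← h]
    simp only [ε', map_sum, map_smul, smul_eq_mul]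
    exact Finset.sum_congr rfl fun l _ => mul_comm _ _
  have hε'li : LinearIndependent ℂ ε' := by
    rw [Fintype.linearIndependent_iff]
    intro c hc i
    have := congrArg (φ i) hc
    simpa [hφε'] using this
  have hεmem : ∀ j, ε j ∈ Submodule.span ℂ (range ε') := fun j => by
    have : ε j = ∑ i, Q i j • ε' i := by
      simp only [ε', Finset.smul_sum, smul_smul]
      rw [Finset.sum_comm]
      simp only [← Finset.sum_smul]
      have h : ∀ l, ∑ i, Q i j * Q⁻¹ l i = if l = j then 1 else 0 := fun l => by
        have h := congrFun (congrFun (Matrix.nonsing_inv_mul Q (isUnit_iff_ne_zero.2 hε)) l) j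
        rw [Matrix.mul_apply, Matrix.one_apply] at h
        rw [← h]
        exact Finset.sum_congr rfl fun l _ => mul_comm _ _
      simp [h]
    rw [this]
    exact Submodule.sum_mem _ fun i _ => Submodule.smul_mem _ _
      (Submodule.subset_span (mem_range_self i))
  obtain ⟨c, hc⟩ := ιMulti_mem_span hε'li hεmem
  -- f projects onto the complement σ(V/E) along ⟨ε'⟩, so it does not change products with ε'₁∧⋯∧ε'ᵣ
  -- and moves t into the chart.
  let f : V →ₗ[ℂ] V := LinearMap.id - ∑ i, (φ i).smulRight (ε' i)
  have hf : ∀ v, f v = v - ∑ i, φ i v • ε' i := fun v => by simp [f, LinearMap.sum_apply]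
  have hfσ : f = σ ∘ₗ (E.mkQ ∘ₗ f) := by
    ext v
    conv_lhs => rw [eq_sum_add_section hσ hE hφe hφσ (f v)]
    rw [Finset.sum_eq_zero, zero_add]
    · rfl
    · intro i _
      simp [hf, hφε']
  have hX : ∀ j, ∃ a : Fin d → ℂ, ∑ l, a l • ω l = E.mkQ (ε' j) := fun j => by
    rw [← Submodule.mem_span_range_iff_exists_fun, hω]
    trivial
  choose a ha using hX
  have hε' : (fun j => e j + σ (matrixVector ω (fun q : Fin r × Fin d => a q.1 q.2) j)) = ε' := by
    ext j
    conv_rhs => rw [eq_sum_add_section hσ hE hφe hφσ (ε' j)]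
    simp [hφε', matrixVector, ha]
  refine ⟨(fun q => a q.1 q.2, fun i => (c * (y i).1, fun j => (E.mkQ ∘ₗ f) ((y i).2 j))), ?_⟩
  have h1 : ExteriorAlgebra.ιMulti ℂ r ε' * secantMap s m V y =
      ExteriorAlgebra.ιMulti ℂ r ε' * ExteriorAlgebra.map f (secantMap s m V y) :=
    (ιMulti_mul_map (fun v => by
      rw [hf, sub_sub_cancel_left, Submodule.neg_mem_iff]
      exact Submodule.sum_mem _ fun i _ => Submodule.smul_mem _ _
        (Submodule.subset_span (mem_range_self i))) _).symm
  rw [hc, smul_mul_assoc, h1, hfσ, ← ExteriorAlgebra.map_comp_map, AlgHom.comp_apply,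
    map_secantMap (E.mkQ ∘ₗ _), ← hfσ, graphMap, hε', ← mul_smul_comm, ← map_smul,
    ← smul_secantMap]
  rfl

end Chart

/-! ### Dimensions of restricted secant varieties and of Grassmannians. -/

section Dimension

universe u

variable {V : Type u} [AddCommGroup V] [Module ℂ V] [FiniteDimensional ℂ V]

/-- A polynomial vanishing on the graphs over `E` vanishes on all restricted secants. -/
lemma vanishes_on_restrictedCone {E : Submodule ℂ V} {s r m k d : ℕ} (hk : k = r + m)
    {e : Fin r → V} {σ : (V ⧸ E) →ₗ[ℂ] V} (hσ : E.mkQ ∘ₗ σ = LinearMap.id)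
    (he : LinearIndependent ℂ e) (hE : Submodule.span ℂ (range e) = E)
    {ω : Fin d → V ⧸ E} (hω : Submodule.span ℂ (range ω) = ⊤) {f : ⋀[ℂ]^k V → ℂ}
    (hf : f ∈ polyAlg (⋀[ℂ]^k V))
    (h0 : ∀ x, f ⟨graphMap e σ ω (secantPoint s m (V ⧸ E)) x, graphMap_mem hk _ _ _ _ x⟩ = 0)
    {w : ⋀[ℂ]^k V} (hw : (w : ExteriorAlgebra ℂ V) ∈ restrictedCone s r m V) : f w = 0 := by
  obtain ⟨ε, t, ht, hw⟩ := hw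
  obtain ⟨y, rfl⟩ := exists_secantMap_eq ht
  obtain ⟨φ, hφe, hφσ⟩ := exists_dual_family_section hσ he
    fun i => hE ▸ Submodule.subset_span (mem_range_self i)
  let Ψ : (Fin r → V) × (Fin s → ℂ × (Fin m → V)) → ⋀[ℂ]^k V := fun x =>
    ⟨ExteriorAlgebra.ιMulti ℂ r x.1 * secantMap s m V x.2,
      ιMulti_mul_mem hk _ (secantCone_subset (secantMap_mem s m x.2))⟩
  have hΨ : IsPolyMap (polyAlg _) Ψ := (isPolyMap_ιMulti_mul_secantMap s r m).of_subtype
  obtain rfl : w = Ψ (ε, y) := Subtype.ext hw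
  let T : Fin r → Fin r → Dual ℂ ((Fin r → V) × (Fin s → ℂ × (Fin m → V))) := fun i j =>
    φ i ∘ₗ LinearMap.proj j ∘ₗ LinearMap.fst ℂ _ _
  -- Where det φᵢ(εⱼ) ≠ 0 the point lies in the chart. This open set contains (e, y), so vanishing
  -- there suffices.
  refine eq_zero_of_vanishes_on_open (f := fun x => f (Ψ x)) (x₀ := (e, y)) (hΨ.comp_mem hf)
    (isForm_det T).1 (fun x hx => ?_) ?_ (ε, y)
  · obtain ⟨z, hz⟩ := exists_graphMap_eq hσ hE hω hφe hφσ hx x.2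
    rw [← h0 z]
    exact congrArg f (Subtype.ext hz.symm)
  · have : (Matrix.of fun i j => T i j (e, y)) = 1 := by
      ext i j
      exact (hφe i j).trans (Matrix.one_apply ..).symm
    rw [this, Matrix.det_one]
    exact one_ne_zero

/-- The dimension of the `s`-restricted secants overlapping in dimension `r`. -/
theorem trdeg_restricted {E : Submodule ℂ V} {s r m k : ℕ} (hk : k = r + m)
    (hE : finrank ℂ E = r) {y₀ : Fin s → ℂ × (Fin m → V ⧸ E)}
    (hy₀ : annihilator (secantMap s m (V ⧸ E) y₀) = ⊥) (hy₀' : secantMap s m (V ⧸ E) y₀ ≠ 0)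
    {X : Set (ℙ ℂ (⋀[ℂ]^k V))}
    (hX : ∀ p : ℙ ℂ (⋀[ℂ]^k V), (p.rep : ExteriorAlgebra ℂ V) ∈ restrictedCone s r m V → p ∈ X)
    (hX' : X ⊆ closure {p | (p.rep : ExteriorAlgebra ℂ V) ∈ restrictedCone s r m V}) :
    Algebra.trdeg ℂ (coordRing X) = ((r * finrank ℂ (V ⧸ E) : ℕ) : Cardinal) +
      Algebra.trdeg ℂ (pullAlg (secantPoint s m (V ⧸ E))) := by
  obtain ⟨e, he, heE, hspan⟩ := exists_basis_of_finrank_eq hE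
  obtain ⟨σ, hσ⟩ := exists_section E
  obtain ⟨φ, hφ⟩ := exists_dual_family he
  let ω := finBasis ℂ (V ⧸ E)
  let Φ : (Fin r × Fin (finrank ℂ (V ⧸ E)) → ℂ) × (Fin s → ℂ × (Fin m → V ⧸ E)) → ⋀[ℂ]^k V :=
    fun x => ⟨graphMap e σ ω (secantPoint s m (V ⧸ E)) x, graphMap_mem hk _ _ _ _ x⟩
  have hdom : IsDomain (pullAlg (secantPoint s m (V ⧸ E))) :=
    isDomain_of_le_polyAlg (isPolyMap_secantPoint s m).pullAlg_le
  rw [← trdeg_graphMap hσ he hspan ω.linearIndependent hdom (y₀ := y₀) hy₀]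
  have hΦ : pullAlg (graphMap e σ ω (secantPoint s m (V ⧸ E))) = pullAlg Φ := pullAlg_subtype Φ
  rw [hΦ]
  refine trdeg_coordRing_of_cone
    (S := {w : ⋀[ℂ]^k V | (w : ExteriorAlgebra ℂ V) ∈ restrictedCone s r m V})
    (fun c w hw => by
      rw [mem_ofPred_eq] at hw ⊢
      exact smul_mem_restrictedCone c hw) hX hX' (x₀ := (0, y₀)) (fun x => ?_)
    (fun c x => ?_) (fun h => hy₀' ?_) fun f hf h0 w hw => ?_
  · exact ⟨_, _, map_mem_secantCone σ (secantMap_mem s m x.2), rfl⟩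
  · refine ⟨(x.1, fun i => (c * (x.2 i).1, (x.2 i).2)), Subtype.ext ?_⟩
    change graphMap _ _ _ _ _ = c • graphMap _ _ _ _ _
    simp only [graphMap]
    rw [smul_secantPoint, Submodule.coe_smul, map_smul, mul_smul_comm]
  · have h' : ExteriorAlgebra.ιMulti ℂ r e *
        ExteriorAlgebra.map σ (secantMap s m (V ⧸ E) y₀) = 0 := by
      have h' : graphMap e σ ω (secantPoint s m (V ⧸ E)) (0, y₀) = 0 := congrArg Subtype.val h
      simpa [graphMap, matrixVector, secantPoint] using h'
    rw [← map_contrs_ιMulti_mul_map_section hσ heE hφ (secantMap s m (V ⧸ E) y₀), h', map_zero,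
      map_zero]
  · exact vanishes_on_restrictedCone hk hσ he hspan ω.span_eq hf h0 hw

lemma trdeg_secantVariety {s m : ℕ} {y₀ : Fin s → ℂ × (Fin m → V)}
    (hy₀ : secantMap s m V y₀ ≠ 0) :
    Algebra.trdeg ℂ (coordRing (secantVariety s (grassmannian V m))) =
      Algebra.trdeg ℂ (pullAlg (secantPoint s m V)) := by
  have hX : secantVariety s (grassmannian V m) =
      closure {p | (p.rep : ExteriorAlgebra ℂ V) ∈ secantCone s m V} := by
    rw [secantVariety]
    congr 1
    ext p
    exact mem_secants_iff p
  refine trdeg_coordRing_of_cone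
    (S := {w : ⋀[ℂ]^m V | (w : ExteriorAlgebra ℂ V) ∈ secantCone s m V})
    (fun c w hw => by
      rw [mem_ofPred_eq] at hw ⊢
      exact smul_mem_secantCone c hw) (fun p hp => hX ▸ subset_closure hp) hX.le
    (x₀ := y₀) (fun x => secantMap_mem s m x) (fun c x => ⟨_, smul_secantPoint s m c x⟩)
    (fun h => hy₀ (congrArg Subtype.val h)) fun f _ h0 w hw => ?_
  obtain ⟨y, hy⟩ := exists_secantMap_eq hw
  rw [← h0 y]
  exact congrArg f (Subtype.ext hy.symm)

theorem projDim_restrictedSecant {E : Submodule ℂ V} {s r m k : ℕ} (hk : k = r + m)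
    (hE : finrank ℂ E = r) {y₀ : Fin s → ℂ × (Fin m → V ⧸ E)}
    (hy₀ : annihilator (secantMap s m (V ⧸ E) y₀) = ⊥) (hy₀' : secantMap s m (V ⧸ E) y₀ ≠ 0) :
    projDim (restrictedSecant V s r k) = (r * finrank ℂ (V ⧸ E) : ℕ) +
      projDim (secantVariety s (grassmannian (V ⧸ E) m)) := by
  have hX : restrictedSecant V s r k =
      closure {p | (p.rep : ExteriorAlgebra ℂ V) ∈ restrictedCone s r m V} := by
    rw [restrictedSecant]
    congr 1
    ext p
    exact mem_restricted_iff hk p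
  rw [projDim, projDim, trdeg_secantVariety hy₀', trdeg_restricted hk hE hy₀ hy₀'
    (fun p hp => hX ▸ subset_closure hp) hX.le,
    Cardinal.toNat_add (Cardinal.natCast_lt_aleph0) (trdeg_pullAlg_lt _), Cardinal.toNat_natCast]
  push_cast
  ring

/-- Gr(m, V) is the degenerate restricted variety with one summand of degree 0. The scalar 1 has
zero annihilator, and the scalars contribute transcendence degree 1, cancelled by the −1 in
`projDim`. -/
theorem projDim_grassmannian {m : ℕ} (hm : m ≤ finrank ℂ V) :
    projDim (grassmannian V m) = (m * (finrank ℂ V - m) : ℕ) := by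
  obtain ⟨e, he, -⟩ := exists_linearIndependent_mem (S := (⊤ : Submodule ℂ V)) (r := m)
    (by rwa [finrank_top])
  set E := Submodule.span ℂ (range e)
  have hE : finrank ℂ E = m := by rw [finrank_span_eq_card he, Fintype.card_fin]
  have hone : secantMap 1 0 (V ⧸ E) (fun _ => (1, 0)) = 1 := by simp [secantMap]
  have hcone : ∀ w : ExteriorAlgebra ℂ V, w ∈ decomposables m V ↔ w ∈ restrictedCone 1 m 0 V := by
    intro w
    constructor
    · rintro ⟨c, v, rfl⟩
      exact ⟨v, c • 1, ⟨fun _ => c • 1, fun _ => ⟨c, 0, by simp⟩, by simp⟩, by simp⟩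
    · rintro ⟨v, t, ⟨a, ha, rfl⟩, rfl⟩
      obtain ⟨c, u, hu⟩ := ha 0
      exact ⟨c, v, by simp [hu]⟩
  have hX : grassmannian V m =
      {p | (p.rep : ExteriorAlgebra ℂ V) ∈ restrictedCone 1 m 0 V} := by
    ext p
    rw [mem_grassmannian_iff, hcone]
    rfl
  rw [projDim, trdeg_restricted (s := 1) (m := 0) rfl hE (y₀ := fun _ => (1, 0)) ?_ ?_
    (fun p hp => hX ▸ hp) (hX ▸ subset_closure),
    trdeg_pullAlg_of_surjective secantPoint_one_zero_surjective, exteriorPower.finrank_eq,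
    Nat.choose_zero_right, ← Nat.cast_add, Cardinal.toNat_natCast]
  · have := E.finrank_quotient_add_finrank
    rw [hE] at this
    rw [← this, Nat.add_sub_cancel]
    push_cast
    ring
  · rw [hone, eq_bot_iff]
    intro v hv
    rw [mem_annihilator, mul_one] at hv
    exact (Submodule.mem_bot ℂ).2 ((ExteriorAlgebra.ι_eq_zero_iff v).1 hv)
  · rw [hone]
    exact one_ne_zero

end Dimension

/-! ### A Jacobian criterion for algebraic independence. -/

section Jacobian

lemma eval_aeval_polynomial {ι : Type*} (P : MvPolynomial ι ℂ) (q : ι → Polynomial ℂ) (s : ℂ) :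
    (MvPolynomial.aeval q P).eval s = MvPolynomial.eval (fun i => (q i).eval s) P := by
  rw [MvPolynomial.aeval_def, ← Polynomial.coe_evalRingHom, MvPolynomial.hom_eval₂,
    MvPolynomial.eval₂_eq, MvPolynomial.eval_eq]
  simp

lemma aeval_X_mul_of_isHomogeneous {ι : Type*} {P : MvPolynomial ι ℂ} {d : ℕ}
    (hP : P.IsHomogeneous d) (q : ι → Polynomial ℂ) :
    MvPolynomial.aeval (fun i => Polynomial.X * q i) P =
      Polynomial.X ^ d * MvPolynomial.aeval q P := by
  simp only [MvPolynomial.aeval_def, MvPolynomial.eval₂_eq, Finset.mul_sum]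
  refine Finset.sum_congr rfl fun a ha => ?_
  have hd : ∑ i ∈ a.support, a i = d := by
    have := hP (MvPolynomial.mem_support_iff.1 ha)
    rw [Finsupp.weight_apply, Finsupp.sum] at this
    simpa using this
  simp only [mul_pow, Finset.prod_mul_distrib,
    Finset.prod_pow_eq_pow_sum, hd]
  ring

/-- A polynomial relation between the coordinates of curves `s ↦ s • q(s)` with arbitrary
directions `q(0)` is trivial. -/
lemma eq_zero_of_aeval_X_mul {ι : Type*} {P : MvPolynomial ι ℂ}
    (h : ∀ z : ι → ℂ, ∃ q : ι → Polynomial ℂ, (∀ i, (q i).eval 0 = z i) ∧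
      MvPolynomial.aeval (fun i => Polynomial.X * q i) P = 0) : P = 0 := by
  by_contra hP
  have hex : ∃ d, MvPolynomial.homogeneousComponent d P ≠ 0 := by
    by_contra! h0
    exact hP (by rw [← MvPolynomial.sum_homogeneousComponent P, Finset.sum_eq_zero fun d _ => h0 d])
  classical
  -- The lowest nonzero component: dividing the relation along s • q(s) by s^d and setting s = 0
  -- leaves its value at q(0) = z.
  set d := Nat.find hex
  have hd : MvPolynomial.homogeneousComponent d P ≠ 0 := Nat.find_spec hex
  apply hd
  apply MvPolynomial.funext
  intro z
  obtain ⟨q, hq, hqP⟩ := h z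
  rw [← MvPolynomial.sum_homogeneousComponent P, map_sum] at hqP
  simp only [aeval_X_mul_of_isHomogeneous
    (MvPolynomial.homogeneousComponent_isHomogeneous _ P)] at hqP
  have hle : d ≤ P.totalDegree := by
    by_contra! hlt
    exact hd (MvPolynomial.homogeneousComponent_eq_zero _ _ hlt)
  have hfac : ∀ e ∈ Finset.range (P.totalDegree + 1),
      Polynomial.X ^ e * MvPolynomial.aeval q (MvPolynomial.homogeneousComponent e P) =
      Polynomial.X ^ d * (Polynomial.X ^ (e - d) *
        MvPolynomial.aeval q (MvPolynomial.homogeneousComponent e P)) := fun e _ => by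
    rcases lt_or_ge e d with he | he
    · rw [not_not.1 (Nat.find_min hex he)]
      simp
    · rw [← mul_assoc, ← pow_add, Nat.add_sub_cancel' he]
  rw [Finset.sum_congr rfl hfac, ← Finset.mul_sum] at hqP
  have h0 := (mul_eq_zero.1 hqP).resolve_left (pow_ne_zero _ Polynomial.X_ne_zero)
  have h1 := congrArg (Polynomial.eval 0) h0
  rw [Polynomial.eval_finsetSum, Finset.sum_eq_single d] at h1
  · have h2 : Polynomial.eval 0 (MvPolynomial.aeval q (MvPolynomial.homogeneousComponent d P)) =
        MvPolynomial.eval z (MvPolynomial.homogeneousComponent d P) := by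
      rw [eval_aeval_polynomial]
      simp only [hq]
    rw [← h2, map_zero]
    simpa using h1
  · intro e _ hed
    rcases lt_or_ge e d with he | he
    · rw [not_not.1 (Nat.find_min hex he)]
      simp
    · have : e - d ≠ 0 := by omega
      simp [this]
  · intro hd'
    exact absurd (Finset.mem_range.2 (Nat.lt_succ_of_le hle)) hd'

variable {M : Type*} [AddCommGroup M] [Module ℂ M]

/-- D is the differential at x and q the difference quotient along u. The Leibniz rule produces D
together with q, so linearity in u is built in. -/
lemma exists_derivative {f : M → ℂ} (hf : f ∈ polyAlg M) (x : M) :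
    ∃ D : Dual ℂ M, ∀ u, ∃ q : Polynomial ℂ, q.eval 0 = D u ∧
      ∀ s : ℂ, f (x + s • u) = f x + s * q.eval s := by
  induction hf using Algebra.adjoin_induction with
  | mem g hg =>
    obtain ⟨φ, rfl⟩ := hg
    exact ⟨φ, fun u => ⟨Polynomial.C (φ u), by simp, fun s => by simp⟩⟩
  | algebraMap r => exact ⟨0, fun u => ⟨0, by simp, fun s => by simp⟩⟩
  | add g h _ _ hg hh =>
    obtain ⟨D, hD⟩ := hg
    obtain ⟨D', hD'⟩ := hh
    refine ⟨D + D', fun u => ?_⟩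
    obtain ⟨q, hq, hq'⟩ := hD u
    obtain ⟨p, hp, hp'⟩ := hD' u
    exact ⟨q + p, by simp [hq, hp], fun s => by simp [hq', hp']; ring⟩
  | mul g h _ _ hg hh =>
    obtain ⟨D, hD⟩ := hg
    obtain ⟨D', hD'⟩ := hh
    refine ⟨g x • D' + h x • D, fun u => ?_⟩
    obtain ⟨q, hq, hq'⟩ := hD u
    obtain ⟨p, hp, hp'⟩ := hD' u
    exact ⟨Polynomial.C (g x) * p + Polynomial.C (h x) * q + Polynomial.X * q * p,
      by simp [hq, hp], fun s => by simp [hq', hp']; ring⟩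

/-- Polynomial functions with linearly independent differentials at a point are algebraically
independent. -/
lemma algebraicIndependent_of_derivative {ι : Type*} [Finite ι] [DecidableEq ι] {f : ι → M → ℂ}
    (hf : ∀ i, f i ∈ polyAlg M) {x : M} (hx : ∀ i, f i x = 0) {u : ι → M}
    (hu : ∀ i j (s : ℂ), f i (x + s • u j) = if i = j then s else 0) :
    AlgebraicIndependent ℂ f := by
  have := Fintype.ofFinite ι
  rw [algebraicIndependent_iff]
  intro P hP
  refine eq_zero_of_aeval_X_mul fun z => ?_
  choose D hD using fun i => exists_derivative (hf i) x
  have hDu : ∀ i j, D i (u j) = if i = j then 1 else 0 := fun i j => by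
    obtain ⟨q, hq, hq'⟩ := hD i (u j)
    have h : Polynomial.X * q = Polynomial.X * Polynomial.C (if i = j then 1 else 0) := by
      apply Polynomial.funext
      intro s
      have := hq' s
      rw [hu, hx, zero_add] at this
      rw [Polynomial.eval_mul, Polynomial.eval_X, ← this]
      split_ifs <;> simp
    rw [← hq, mul_left_cancel₀ Polynomial.X_ne_zero h, Polynomial.eval_C]
  -- Since D i (u j) = δᵢⱼ, moving in this direction gives difference quotients with constant terms
  -- zᵢ.
  choose q hq hq' using fun i => hD i (∑ j, z j • u j)
  refine ⟨q, fun i => by simp [hq, hDu], ?_⟩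
  apply Polynomial.funext
  intro s
  have h := congrFun hP (x + s • ∑ j, z j • u j)
  have h1 : (MvPolynomial.aeval f P) (x + s • ∑ j, z j • u j) =
      MvPolynomial.eval (fun i => f i (x + s • ∑ j, z j • u j)) P := by
    have := MvPolynomial.comp_aeval_apply (R := ℂ) f
      (Pi.evalAlgHom ℂ (fun _ : M => ℂ) (x + s • ∑ j, z j • u j)) P
    exact this
  have h2 : Polynomial.eval s (MvPolynomial.aeval (fun i => Polynomial.X * q i) P) =
      MvPolynomial.eval (fun i => s * (q i).eval s) P := by
    rw [eval_aeval_polynomial]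
    simp
  rw [h2, Polynomial.eval_zero]
  rw [h1] at h
  simp only [hq', hx, zero_add] at h
  exact h

end Jacobian

/-! ### Tangent directions at a sum of two disjoint basis multivectors. -/

section Tangent

universe u

lemma card_le_trdeg_of_derivative {M : Type u} [AddCommGroup M] [Module ℂ M] {ι : Type}
    [Fintype ι] [DecidableEq ι] {B : Subalgebra ℂ (M → ℂ)} (hB : B ≤ polyAlg M) {f : ι → M → ℂ}
    (hf : ∀ i, f i ∈ B) {x : M} (hx : ∀ i, f i x = 0) {u : ι → M}
    (hu : ∀ i j (s : ℂ), f i (x + s • u j) = if i = j then s else 0) :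
    (Fintype.card ι : Cardinal) ≤ Algebra.trdeg ℂ B := by
  have h : AlgebraicIndependent ℂ (B.val ∘ fun i => ⟨f i, hf i⟩) :=
    algebraicIndependent_of_derivative (fun i => hB (hf i)) hx hu
  have := (AlgebraicIndependent.of_comp B.val h).lift_cardinalMk_le_trdeg
  simpa using this

variable {W : Type u} [AddCommGroup W] [Module ℂ W]

/-- The coordinate of `⋀ᵐW` given by the wedge product of a family of coordinates of `W`. -/
def minorForm {κ : Type*} (b : Basis κ ℂ W) {m : ℕ} (f : Fin m → κ) : Dual ℂ (⋀[ℂ]^m W) :=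
  exteriorPower.pairingDual ℂ W m (exteriorPower.ιMulti ℂ m fun i => b.coord (f i))

lemma minorForm_secantPoint {κ : Type*} (b : Basis κ ℂ W) {s m : ℕ} (f : Fin m → κ)
    (y : Fin s → ℂ × (Fin m → W)) : minorForm b f (secantPoint s m W y) =
      ∑ c, (y c).1 * (Matrix.of fun i j => b.coord (f j) ((y c).2 i)).det := by
  have h : secantPoint s m W y = ∑ c, (y c).1 • exteriorPower.ιMulti ℂ m (y c).2 := by
    apply Subtype.ext
    simp [secantPoint, secantMap]
  rw [h, map_sum]
  refine Finset.sum_congr rfl fun c _ => ?_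
  rw [map_smul, smul_eq_mul, minorForm, exteriorPower.pairingDual_ιMulti_ιMulti]

variable {κ κ' : Type*} [DecidableEq κ] (b : Basis κ ℂ W) {m : ℕ}
  {A : Fin 2 → Fin m → κ} {B : Fin 2 → κ' → κ}

/-- The vectors `b_A` with the one of index `p` replaced by `b_{A p} + t b_B`. -/
def perturbedBasis (A : Fin 2 → Fin m → κ) (B : Fin 2 → κ' → κ) (c : Fin 2) (p : Fin m) (q : κ')
    (t : ℂ) (j : Fin m) : W :=
  b (A c j) + t • (Pi.single p (b (B c q)) : Fin m → W) j

lemma coord_perturbedBasis (c : Fin 2) (p : Fin m) (q : κ') (t : ℂ) (i : Fin m) (k : κ) :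
    b.coord k (perturbedBasis b A B c p q t i) = (if A c i = k then 1 else 0) +
      if i = p then (if B c q = k then t else 0) else 0 := by
  rw [perturbedBasis, map_add, map_smul, Pi.single_apply]
  simp only [b.coord_apply, apply_ite, map_zero, b.repr_self, Finsupp.single_apply, smul_eq_mul]
  split_ifs <;> simp

/-- Here 3 ≤ m matters: at least two indices differ from p, and injectivity sends at most one of
them to k. So families obtained from the two disjoint ones by a single replacement in each never
coincide. -/
lemma exists_ne_ne (hm : 3 ≤ m) {c' : Fin 2} (hA : Function.Injective (A c')) (p : Fin m) (k : κ) :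
    ∃ j, j ≠ p ∧ k ≠ A c' j := by
  by_contra! h
  have hsub : (Finset.univ.erase p).card ≤ 1 := by
    refine Finset.card_le_one.2 fun i hi j hj => hA ?_
    rw [← h i (Finset.ne_of_mem_erase hi), ← h j (Finset.ne_of_mem_erase hj)]
  rw [Finset.card_erase_of_mem (Finset.mem_univ p), Finset.card_univ, Fintype.card_fin] at hsub
  omega

lemma det_perturbedBasis_base (hm : 3 ≤ m) (hA : ∀ c i c' i', A c i = A c' i' ↔ c = c' ∧ i = i')
    (hAB : ∀ c i q, A c i ≠ B c q) (c c' : Fin 2) (p : Fin m) (q : κ') (t : ℂ) :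
    (Matrix.of fun i j => b.coord (A c' j) (perturbedBasis b A B c p q t i)).det =
      if c = c' then 1 else 0 := by
  simp only [coord_perturbedBasis]
  split_ifs with h
  · subst h
    have : (Matrix.of fun i j => (if A c i = A c j then (1 : ℂ) else 0) +
        if i = p then (if B c q = A c j then t else 0) else 0) = 1 := by
      ext i j
      rw [Matrix.of_apply, Matrix.one_apply, if_neg (hAB c j q).symm]
      simp [hA]
    rw [this, Matrix.det_one]
  · obtain ⟨j, -, hj⟩ := exists_ne_ne hm (c' := c') (fun i i' h => ((hA _ _ _ _).1 h).2) p (B c q)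
    refine Matrix.det_eq_zero_of_column_eq_zero j fun i => ?_
    rw [Matrix.of_apply, if_neg hj, if_neg fun h' => h ((hA _ _ _ _).1 h').1]
    simp

/-- The coordinate obtained by replacing one index detects exactly the matching move, linearly in t;
for every other move a row or a column vanishes. -/
lemma det_perturbedBasis_update [DecidableEq κ'] (hm : 3 ≤ m)
    (hA : ∀ c i c' i', A c i = A c' i' ↔ c = c' ∧ i = i') (hB : ∀ c, Function.Injective (B c))
    (hAB : ∀ c i q, A c i ≠ B c q) (c c' : Fin 2) (p p' : Fin m) (q q' : κ') (t : ℂ) :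
    (Matrix.of fun i j => b.coord (Function.update (A c') p' (B c' q') j)
      (perturbedBasis b A B c p q t i)).det =
      if c = c' ∧ p = p' ∧ q = q' then t else 0 := by
  simp only [coord_perturbedBasis]
  by_cases hc : c = c'
  · subst hc
    by_cases hp : p = p'
    · subst hp
      by_cases hq : q = q'
      · subst hq
        have : (Matrix.of fun i j =>
            (if A c i = Function.update (A c) p (B c q) j then (1 : ℂ) else 0) +
            if i = p then (if B c q = Function.update (A c) p (B c q) j then t else 0) else 0) =
            Matrix.diagonal (Function.update 1 p t) := by
          ext i j
          rw [Matrix.of_apply, Matrix.diagonal_apply]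
          by_cases hj : j = p
          · subst hj
            rw [Function.update_self, if_neg (hAB c i q), if_pos rfl, zero_add]
            split_ifs with h
            · rw [h, Function.update_self]
            · rfl
          · rw [Function.update_of_ne hj, if_neg (hAB c j q).symm]
            by_cases hij : i = j
            · subst hij
              simp [Function.update_of_ne hj]
            · simp [hA, hij]
        rw [this, Matrix.det_diagonal, Finset.prod_update_of_mem (Finset.mem_univ p)]
        simp
      · rw [if_neg fun h => hq h.2.2]
        refine Matrix.det_eq_zero_of_column_eq_zero p fun i => ?_
        rw [Matrix.of_apply, Function.update_self, if_neg (hAB c i q'),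
          if_neg fun h => hq (hB c h)]
        simp
    · rw [if_neg fun h => hp h.2.1]
      refine Matrix.det_eq_zero_of_row_eq_zero p' fun j => ?_
      rw [Matrix.of_apply, if_neg (Ne.symm hp), add_zero]
      apply if_neg
      by_cases hj : j = p'
      · subst hj
        rw [Function.update_self]
        exact hAB c j q'
      · rw [Function.update_of_ne hj]
        exact fun h => hj ((hA _ _ _ _).1 h).2.symm
  · rw [if_neg fun h => hc h.1]
    obtain ⟨j, hjp, hj⟩ :=
      exists_ne_ne hm (c' := c') (fun i i' h => ((hA _ _ _ _).1 h).2) p' (B c q)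
    refine Matrix.det_eq_zero_of_column_eq_zero j fun i => ?_
    rw [Matrix.of_apply, Function.update_of_ne hjp, if_neg hj,
      if_neg fun h' => hc ((hA _ _ _ _).1 h').1]
    simp

/-- Two disjoint families of indices and parametrizations of their complements. -/
lemma exists_index_families (m l : ℕ) :
    ∃ (A : Fin 2 → Fin m → Fin m ⊕ Fin m ⊕ Fin l)
      (B : Fin 2 → Fin m ⊕ Fin l → Fin m ⊕ Fin m ⊕ Fin l),
      (∀ c i c' i', A c i = A c' i' ↔ c = c' ∧ i = i') ∧ (∀ c, Function.Injective (B c)) ∧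
      ∀ c i q, A c i ≠ B c q := by
  refine ⟨![Sum.inl, fun i => Sum.inr (Sum.inl i)],
    ![Sum.inr, Sum.elim Sum.inl fun i => Sum.inr (Sum.inr i)], ?_, ?_, ?_⟩
  · intro c i c' i'
    fin_cases c <;> fin_cases c' <;> simp
  · intro c
    fin_cases c
    · exact Sum.inr_injective
    · rintro (q | q) (q' | q') h <;> simp_all
  · intro c i q
    fin_cases c <;> rcases q with q | q <;> simp

variable [FiniteDimensional ℂ W]

/-- The secant variety of `Gr(m, N)` has the virtual dimension for `3 ≤ m ≤ N - m`. -/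
theorem le_trdeg_secantPoint (hm : 3 ≤ m) (hN : 2 * m ≤ finrank ℂ W) :
    ((2 * (m * (finrank ℂ W - m) + 1) : ℕ) : Cardinal) ≤
      Algebra.trdeg ℂ (pullAlg (secantPoint 2 m W)) := by
  let κ := Fin m ⊕ Fin m ⊕ Fin (finrank ℂ W - 2 * m)
  let κ' := Fin m ⊕ Fin (finrank ℂ W - 2 * m)
  have hcard : Fintype.card (Fin (finrank ℂ W)) = Fintype.card κ := by
    simp only [κ, Fintype.card_fin, Fintype.card_sum]
    omega
  let b : Basis κ ℂ W := (finBasis ℂ W).reindex (Fintype.equivOfCardEq hcard)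
  obtain ⟨A, B, hA, hB, hAB⟩ := exists_index_families m (finrank ℂ W - 2 * m)
  let y₀ : Fin 2 → ℂ × (Fin m → W) := fun c => (1, fun i => b (A c i))
  -- For each of the two summands, `none` rescales it and `some (p, q)` is one of its m(N−m)
  -- elementary moves, N being the dimension of W. Subtracting 1 makes the functions vanish at y₀.
  let F : Fin 2 × Option (Fin m × κ') → (Fin 2 → ℂ × (Fin m → W)) → ℂ
    | (c, none) => fun y => minorForm b (A c) (secantPoint 2 m W y) - 1
    | (c, some (p, q)) => fun y =>
      minorForm b (Function.update (A c) p (B c q)) (secantPoint 2 m W y)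
  let u : Fin 2 × Option (Fin m × κ') → Fin 2 → ℂ × (Fin m → W)
    | (c, none) => Pi.single c (1, 0)
    | (c, some (p, q)) => Pi.single c (0, Pi.single p (b (B c q)))
  have hF : ∀ i, F i ∈ pullAlg (secantPoint 2 m W) := by
    rintro ⟨c, _ | ⟨p, q⟩⟩
    · exact sub_mem (isPolyMap_pullAlg _ _) (one_mem _)
    · exact isPolyMap_pullAlg _ _
  have p₀ : Fin m := ⟨0, by omega⟩
  have hbase : ∀ c i, b (A c i) = perturbedBasis b A B c p₀ (Sum.inl p₀) 0 i := fun c i => by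
    simp [perturbedBasis]
  have hu₀ : ∀ (c c' : Fin 2) (s : ℂ), (y₀ + s • u (c, none)) c' =
      (1 + if c' = c then s else 0, perturbedBasis b A B c' p₀ (Sum.inl p₀) 0) := fun c c' s => by
    have : y₀ c' = (1, perturbedBasis b A B c' p₀ (Sum.inl p₀) 0) :=
      Prod.ext rfl (funext (hbase c'))
    rw [Pi.add_apply, Pi.smul_apply, this]
    simp only [u, Pi.single_apply]
    split_ifs <;> simp
  have hu₁ : ∀ (c c' : Fin 2) p q (s : ℂ), (y₀ + s • u (c, some (p, q))) c' =
      (1, perturbedBasis b A B c' p q (if c' = c then s else 0)) := fun c c' p q s => by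
    rw [Pi.add_apply, Pi.smul_apply]
    simp only [u, Pi.single_apply]
    split_ifs with h
    · subst h
      refine Prod.ext (by simp [y₀]) (funext fun j => ?_)
      simp [y₀, perturbedBasis]
    · refine Prod.ext (by simp [y₀]) (funext fun j => ?_)
      simp [y₀, perturbedBasis]
  have hFu : ∀ i j (s : ℂ), F i (y₀ + s • u j) = if i = j then s else 0 := by
    rintro ⟨c', _ | ⟨p', q'⟩⟩ ⟨c, _ | ⟨p, q⟩⟩ s
    · simp only [F, minorForm_secantPoint, hu₀, det_perturbedBasis_base b hm hA hAB]
      simp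
    · simp only [F, minorForm_secantPoint, hu₁, det_perturbedBasis_base b hm hA hAB]
      simp
    · simp only [F, minorForm_secantPoint, hu₀, det_perturbedBasis_update b hm hA hB hAB]
      simp
    · simp only [F, minorForm_secantPoint, hu₁, det_perturbedBasis_update b hm hA hB hAB]
      rw [Finset.sum_eq_single c']
      · simp only [Prod.mk.injEq, Option.some.injEq, true_and, one_mul]
        split_ifs <;> simp_all
      · intro c'' _ hc
        rw [if_neg fun h => hc h.1, mul_zero]
      · simp
  have h := card_le_trdeg_of_derivative (isPolyMap_secantPoint 2 m).pullAlg_le hF (x := y₀)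
    (fun i => by simpa using hFu i (0, none) 0) hFu
  refine le_trans (le_of_eq ?_) h
  congr 1
  simp only [κ', Fintype.card_prod, Fintype.card_fin, Fintype.card_option, Fintype.card_sum]
  congr 3
  omega

end Tangent

/-! ### The case where every k-vector is decomposable. -/

section SmallCodimension

universe u

variable {V : Type u} [AddCommGroup V] [Module ℂ V]

lemma mem_restrictedCone_of_mem_decomposables {s r m k : ℕ} (hk : k = r + m)
    {w : ExteriorAlgebra ℂ V} (hw : w ∈ decomposables k V) :
    w ∈ restrictedCone (s + 1) r m V := by
  subst hk
  obtain ⟨c, v, rfl⟩ := hw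
  refine ⟨fun i => v (Fin.castAdd m i), c • ExteriorAlgebra.ιMulti ℂ m fun i => v (Fin.natAdd r i),
    ⟨Pi.single 0 (c • ExteriorAlgebra.ιMulti ℂ m fun i => v (Fin.natAdd r i)), fun i => ?_, ?_⟩, ?_⟩
  · rw [Pi.single_apply]
    split_ifs
    · exact ⟨_, _, rfl⟩
    · exact zero_mem_decomposables m
  · simp
  · rw [mul_smul_comm, ExteriorAlgebra.ιMulti_mul_ιMulti]
    congr 2
    exact (Fin.append_castAdd_natAdd).symm

variable [FiniteDimensional ℂ V]

/-- Every `k`-vector in a space of dimension at most `k + 1` is decomposable. -/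
lemma mem_decomposables_of_finrank_le {k : ℕ} (hk : k ≤ finrank ℂ V) (hV : finrank ℂ V ≤ k + 1)
    {w : ExteriorAlgebra ℂ V} (hw : w ∈ ⋀[ℂ]^k V) : w ∈ decomposables k V := by
  -- The target is zero if dim V = k and a line if dim V = k+1. Either way the kernel has dimension
  -- at least k, and dividing w by k independent vectors leaves a scalar.
  let T : V →ₗ[ℂ] ⋀[ℂ]^(k + 1) V :=
    (LinearMap.mulRight ℂ w ∘ₗ ExteriorAlgebra.ι ℂ).codRestrict _ fun v => by
      have h := ιMulti_mul_mem (add_comm k 1) (fun _ : Fin 1 => v) hw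
      rwa [ExteriorAlgebra.ιMulti_succ_apply, ExteriorAlgebra.ιMulti_zero_apply, mul_one] at h
  have hker : LinearMap.ker T = annihilator w := LinearMap.ker_codRestrict _ _ _
  have hrk := LinearMap.finrank_range_add_finrank_ker T
  have hle : finrank ℂ (LinearMap.range T) ≤ (finrank ℂ V).choose (k + 1) := by
    rw [← exteriorPower.finrank_eq]
    exact Submodule.finrank_le _
  have hann : k ≤ finrank ℂ (annihilator w) := by
    rw [← hker]
    rcases hV.lt_or_eq with h | h
    · rw [Nat.choose_eq_zero_of_lt h] at hle
      omega
    · rw [h, Nat.choose_self] at hle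
      omega
  obtain ⟨e, he, hew⟩ := exists_linearIndependent_mem hann
  obtain ⟨φ, hφ⟩ := exists_dual_family he
  have hc : contrs k φ w ∈ LinearMap.range (ExteriorAlgebra.ι ℂ) ^ 0 :=
    contrs_mem (add_zero k).symm φ hw
  rw [pow_zero, Submodule.mem_one] at hc
  obtain ⟨c, hc⟩ := hc
  refine ⟨c, e, ?_⟩
  rw [eq_ιMulti_mul_contrs hφ fun i => hew i, ← hc, ← Algebra.commutes, ← Algebra.smul_def]

lemma projDim_univ {W : Type u} [AddCommGroup W] [Module ℂ W] [FiniteDimensional ℂ W]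
    [Nontrivial W] : projDim (univ : Set (ℙ ℂ W)) = (finrank ℂ W : ℤ) - 1 := by
  obtain ⟨w, hw⟩ := exists_ne (0 : W)
  rw [projDim, trdeg_coordRing_of_cone (S := univ) (φ := (id : W → W)) (x₀ := w)
    (fun _ _ _ => mem_univ _) (fun _ _ => mem_univ _) (fun p _ => subset_closure (mem_univ p.rep))
    (fun _ => mem_univ _) (fun c x => ⟨c • x, rfl⟩) hw fun f _ h x _ => h x,
    trdeg_pullAlg_of_surjective Function.surjective_id, Cardinal.toNat_natCast]

theorem projDim_restrictedSecant_of_finrank_le {s r k : ℕ} (hr : r ≤ k) (hk : k ≤ finrank ℂ V)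
    (hV : finrank ℂ V ≤ k + 1) :
    projDim (restrictedSecant V (s + 1) r k) = ((finrank ℂ V).choose k : ℤ) - 1 := by
  have hX : restrictedSecant V (s + 1) r k = univ := by
    refine eq_univ_of_forall fun p => subset_closure ?_
    have hkm : k = r + (k - r) := by omega
    exact (mem_restricted_iff hkm p).2 (mem_restrictedCone_of_mem_decomposables hkm
      (mem_decomposables_of_finrank_le hk hV p.rep.2))
  have hfin : finrank ℂ (⋀[ℂ]^k V) = (finrank ℂ V).choose k := exteriorPower.finrank_eq ..
  have : Nontrivial (⋀[ℂ]^k V) :=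
    Module.nontrivial_of_finrank_pos (R := ℂ) (by rw [hfin]; exact Nat.choose_pos hk)
  rw [hX, projDim_univ, hfin]

end SmallCodimension

/-! ### Generic finiteness, defects and nondefectivity for chordal varieties. -/

section ChordalVarieties

universe u

variable {V : Type u} [AddCommGroup V] [Module ℂ V] [FiniteDimensional ℂ V]

lemma exists_annihilator_eq_bot_and_ne_zero {m : ℕ} (hm : 2 ≤ m) (hV : 2 * m ≤ finrank ℂ V) :
    ∃ y, annihilator (secantMap 2 m V y) = ⊥ ∧ secantMap 2 m V y ≠ 0 := by
  obtain ⟨y, hy⟩ := exists_annihilator_eq_bot hm hV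
  refine ⟨y, hy, fun h => ?_⟩
  have htop : annihilator (0 : ExteriorAlgebra ℂ V) = ⊤ :=
    eq_top_iff.2 fun v _ => mem_annihilator.2 (mul_zero _)
  rw [h, htop] at hy
  have h1 : finrank ℂ (⊤ : Submodule ℂ V) = 0 := by rw [hy, finrank_bot]
  rw [finrank_top] at h1
  omega

/-- The open set is where the annihilator has dimension at most r. The bound on dim V leaves room in
V/E for two independent m-planes, which give a point of it. -/
theorem exists_isOpen_fiber_finite {r m k : ℕ} (hk : k = r + m) (hm : 2 ≤ m)
    (hV : r + 2 * m ≤ finrank ℂ V) :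
    ∃ U : Set (ℙ ℂ (⋀[ℂ]^k V)), IsOpen U ∧
      restrictedSecant V 2 r k ⊆ closure (U ∩ restrictedSecant V 2 r k) ∧
      ∀ p ∈ U ∩ restrictedSecant V 2 r k,
        (incidenceVariety V 2 r k ∩ Prod.snd ⁻¹' {p}).Finite := by
  obtain ⟨e, he, -⟩ := exists_linearIndependent_mem (S := (⊤ : Submodule ℂ V)) (r := r)
    (by rw [finrank_top]; omega)
  have hE : finrank ℂ (Submodule.span ℂ (range e)) = r := by
    rw [finrank_span_eq_card he, Fintype.card_fin]
  have hQ := (Submodule.span ℂ (range e)).finrank_quotient_add_finrank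
  obtain ⟨y, hy, hy0⟩ := exists_annihilator_eq_bot_and_ne_zero (m := m)
    (V := V ⧸ Submodule.span ℂ (range e)) hm (by omega)
  obtain ⟨w, hw, hw0, hann⟩ := exists_restrictedCone_annihilator_le hE hy hy0
  refine ⟨_, (isClosed_le_finrank_annihilator k (r + 1)).isOpen_compl,
    restrictedSecant_subset_closure hk hw hw0 hann, fun p hp =>
      incidence_fiber_finite (by omega) ?_⟩
  have := hp.1
  rw [mem_compl_iff, mem_ofPred_eq] at this
  omega

theorem projDim_restrictedSecant_two {E : Submodule ℂ V} {r m k : ℕ} (hk : k = r + m)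
    (hm : 2 ≤ m) (hV : r + 2 * m ≤ finrank ℂ V) (hE : finrank ℂ E = r) :
    projDim (restrictedSecant V 2 r k) = (r * (finrank ℂ V - r) : ℤ) +
      projDim (secantVariety 2 (grassmannian (V ⧸ E) m)) := by
  have hQ := E.finrank_quotient_add_finrank
  obtain ⟨y, hy, hy0⟩ := exists_annihilator_eq_bot_and_ne_zero (V := V ⧸ E) hm (by omega)
  rw [projDim_restrictedSecant hk hE hy hy0, ← hQ, hE]
  push_cast
  ring

/-- Actual and virtual dimensions both increase by r(n−r), because dim Gr(m, V/E) = m(n−r−m) =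
(k−r)(n−k). -/
theorem restricted_defect_eq {E : Submodule ℂ V} {r m k : ℕ} (hk : k = r + m)
    (hm : 2 ≤ m) (hV : r + 2 * m ≤ finrank ℂ V) (hE : finrank ℂ E = r) :
    restrictedVirtualDim 2 r k (finrank ℂ V) - projDim (restrictedSecant V 2 r k) =
      secantVirtualDim 2 (grassmannian (V ⧸ E) m) -
        projDim (secantVariety 2 (grassmannian (V ⧸ E) m)) := by
  have hQ := E.finrank_quotient_add_finrank
  rw [projDim_restrictedSecant_two hk hm hV hE, secantVirtualDim, restrictedVirtualDim,
    projDim_grassmannian (by omega), ← hQ, hE, hk]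
  have hsub : ((finrank ℂ (V ⧸ E) - m : ℕ) : ℤ) = finrank ℂ (V ⧸ E) - m :=
    Nat.cast_sub (by omega)
  rw [Nat.cast_mul, hsub]
  push_cast
  ring

theorem le_projDim_secantVariety {m : ℕ} (hm : 3 ≤ m) (hV : 2 * m ≤ finrank ℂ V) :
    secantVirtualDim 2 (grassmannian V m) ≤ projDim (secantVariety 2 (grassmannian V m)) := by
  obtain ⟨y, -, hy0⟩ := exists_annihilator_eq_bot_and_ne_zero (m := m) (by omega) hV
  have h := Cardinal.toNat_le_toNat (le_trdeg_secantPoint hm hV) (trdeg_pullAlg_lt _)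
  rw [Cardinal.toNat_natCast] at h
  rw [secantVirtualDim, projDim_grassmannian (by omega), projDim, trdeg_secantVariety hy0]
  have h' : ((2 * (m * (finrank ℂ V - m) + 1) : ℕ) : ℤ) ≤
    (Cardinal.toNat (Algebra.trdeg ℂ (pullAlg (secantPoint 2 m V))) : ℤ) := Nat.cast_le.2 h
  push_cast at h' ⊢
  linarith

theorem le_projDim_restrictedSecant {r m k : ℕ} (hk : k = r + m) (hm : 3 ≤ m)
    (hV : r + 2 * m ≤ finrank ℂ V) :
    restrictedVirtualDim 2 r k (finrank ℂ V) ≤ projDim (restrictedSecant V 2 r k) := by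
  obtain ⟨e, he, -⟩ := exists_linearIndependent_mem (S := (⊤ : Submodule ℂ V)) (r := r)
    (by rw [finrank_top]; omega)
  have hE : finrank ℂ (Submodule.span ℂ (range e)) = r := by
    rw [finrank_span_eq_card he, Fintype.card_fin]
  have hQ := (Submodule.span ℂ (range e)).finrank_quotient_add_finrank
  have h1 := restricted_defect_eq hk (by omega) hV hE
  have h2 := le_projDim_secantVariety (V := V ⧸ Submodule.span ℂ (range e)) hm (by omega)
  linarith

end ChordalVarieties

end RestrictedChordal

end

theorem mainTheorem5 {V : Type*} [AddCommGroup V] [Module ℂ V] [FiniteDimensional ℂ V]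
    (n k r : ℕ) (hn : Module.finrank ℂ V = n) (hk : k ≤ n) (hr : r ≤ k) :
    -- the image of the projection is the restricted chordal variety
    Prod.snd '' RestrictedChordal.incidenceVariety V 2 r k =
        RestrictedChordal.restrictedSecant V 2 r k ∧
    -- raising `r` to the size of the general overlap does not change the variety
    RestrictedChordal.restrictedSecant V 2 (RestrictedChordal.overlap r k n) k =
        RestrictedChordal.restrictedSecant V 2 r k ∧
    (r + 2 ≤ k → k + 2 ≤ n →
      -- the projection has finite fibers over a dense open subset of its image
      (∃ U : Set (Projectivization ℂ (⋀[ℂ]^k V)), IsOpen U ∧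
        RestrictedChordal.restrictedSecant V 2 r k ⊆
          closure (U ∩ RestrictedChordal.restrictedSecant V 2 r k) ∧
        ∀ p ∈ U ∩ RestrictedChordal.restrictedSecant V 2 r k,
          (RestrictedChordal.incidenceVariety V 2 (RestrictedChordal.overlap r k n) k ∩
            Prod.snd ⁻¹' {p}).Finite) ∧
      -- the dimension is that of the incidence variety, and the defect is that of the
      -- ordinary secant variety
      (∀ E : Submodule ℂ V, Module.finrank ℂ E = RestrictedChordal.overlap r k n →
        RestrictedChordal.projDim (RestrictedChordal.restrictedSecant V 2 r k) =
          (RestrictedChordal.overlap r k n : ℤ) * ((n : ℤ) - RestrictedChordal.overlap r k n) +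
            RestrictedChordal.projDim (RestrictedChordal.secantVariety 2
              (RestrictedChordal.grassmannian (V ⧸ E)
                (k - RestrictedChordal.overlap r k n))) ∧
        RestrictedChordal.restrictedVirtualDim 2 (RestrictedChordal.overlap r k n) k n -
            RestrictedChordal.projDim (RestrictedChordal.restrictedSecant V 2 r k) =
          RestrictedChordal.secantVirtualDim 2 (RestrictedChordal.grassmannian (V ⧸ E)
              (k - RestrictedChordal.overlap r k n)) -
            RestrictedChordal.projDim (RestrictedChordal.secantVariety 2
              (RestrictedChordal.grassmannian (V ⧸ E)
                (k - RestrictedChordal.overlap r k n)))) ∧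
      -- a positive defect occurs only for `n = k + 2` or `k - r = 2`
      (RestrictedChordal.projDim (RestrictedChordal.restrictedSecant V 2 r k) <
          RestrictedChordal.restrictedVirtualDim 2 (RestrictedChordal.overlap r k n) k n →
        n = k + 2 ∨ k - r = 2)) ∧
    -- the dimension is less than the expected one only for `n = k + 2` or `k - r = 2`
    (r + 2 ≤ k →
      RestrictedChordal.projDim (RestrictedChordal.restrictedSecant V 2 r k) <
        RestrictedChordal.restrictedExpectedDim 2 (RestrictedChordal.overlap r k n) k n →
      n = k + 2 ∨ k - r = 2) := by
  subst hn
  refine ⟨RestrictedChordal.image_incidenceVariety 2 hr,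
    RestrictedChordal.restrictedSecant_overlap rfl r, fun hrk hkn => ?_, fun hrk hlt => ?_⟩
  · have hρ := RestrictedChordal.restrictedSecant_overlap (V := V) (k := k) rfl r
    rw [← hρ]
    have hle : r ≤ RestrictedChordal.overlap r k (Module.finrank ℂ V) := le_max_left _ _
    have hρ' : RestrictedChordal.overlap r k (Module.finrank ℂ V) =
      max r (2 * k - Module.finrank ℂ V) := rfl
    set ρ := RestrictedChordal.overlap r k (Module.finrank ℂ V)
    -- Since k − ρ = min(k−r, n−k), the hypotheses give 2 ≤ k − ρ; and ρ ≥ 2k − n is the room needed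
    -- in V/E.
    have hkρ : k = ρ + (k - ρ) := by omega
    have hm : 2 ≤ k - ρ := by omega
    have hV : ρ + 2 * (k - ρ) ≤ Module.finrank ℂ V := by omega
    refine ⟨RestrictedChordal.exists_isOpen_fiber_finite hkρ hm hV, fun E hE =>
      ⟨RestrictedChordal.projDim_restrictedSecant_two hkρ hm hV hE,
        RestrictedChordal.restricted_defect_eq hkρ hm hV hE⟩, fun hlt => ?_⟩
    -- If both alternatives fail, then k−r and n−k are at least 3, hence so is k−ρ, and there is no
    -- positive defect.
    by_contra hne
    exact absurd (RestrictedChordal.le_projDim_restrictedSecant hkρ (by omega) hV) hlt.not_ge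
  · by_contra hne
    -- For n ≤ k+1 the variety fills the projective space and attains the binomial term of the
    -- minimum. Otherwise the virtual dimension is attained when both alternatives fail.
    rcases lt_or_ge (Module.finrank ℂ V) (k + 2) with hkn | hkn
    · rw [RestrictedChordal.projDim_restrictedSecant_of_finrank_le (s := 1) hr hk (by omega)] at hlt
      exact absurd (hlt.trans_le (min_le_right _ _)) (lt_irrefl _)
    · have hρ := RestrictedChordal.restrictedSecant_overlap (V := V) (k := k) rfl r
      have hlt' := hlt.trans_le (min_le_left _ _)
      rw [← hρ] at hlt'
      have hρ' : RestrictedChordal.overlap r k (Module.finrank ℂ V) =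
        max r (2 * k - Module.finrank ℂ V) := rfl
      exact absurd (RestrictedChordal.le_projDim_restrictedSecant
        (m := k - RestrictedChordal.overlap r k (Module.finrank ℂ V)) (by omega) (by omega)
        (by omega)) hlt'.not_ge
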